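/- **Setting.** Let $\mathsf N\ge 1$, let $s_1,\dots,s_{\mathsf N}\in\{\tfrac12,1,\tfrac32,\dots\}$, $\xi_1,\dots,\xi_{\mathsf N}\in\mathbb C$, and let $\eta\in\mathbb C$ be such that $q=e^\eta$ is not a root of unity. Put $\mathsf N_s=2\sum_n s_n$, $[j]_q=\sinh(j\eta)/\sinh\eta$, $\xi_n^{(k)}=\xi_n+(s_n-k)\eta$ and $$a(\lambda)=\prod_{n=1}^{\mathsf N}\sinh(\lambda-\xi_n+s_n\eta),\qquad d(\lambda)=\prod_{n=1}^{\mathsf N}\sinh(\lambda-\xi_n-s_n\eta).$$ On $V_n=\mathbb C^{2s_n+1}$ with basis $|0\rangle,\dots,|2s_n\rangle$ let $S_n^z|k\rangle=(s_n-k)|k\rangle$, $S_n^-|k\rangle=x_n(k+1)|k+1\rangle$, $S_n^+|k\rangle=x_n(k)|k-1\rangle$, where $x_n(k)=\sqrt{[k]_q[2s_n-k+1]_q}$. Let $$\mathsf L_n(\lambda)=\begin{pmatrix}\sinh(\lambda+\eta S_n^z)&S_n^-\sinh\eta\\ S_n^+\sinh\eta&\sinh(\lambda-\eta S_n^z)\end{pmatrix},\qquad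 \mathsf L_{\mathsf N}(\lambda-\xi_{\mathsf N})\cdots\mathsf L_1(\lambda-\xi_1)=\begin{pmatrix}\mathsf A(\lambda)&\mathsf B(\lambda)\\ \mathsf C(\lambda)&\mathsf D(\lambda)\end{pmatrix},$$ and, for $\kappa\in\mathbb C\setminus\{0\}$, let $\bar{\mathsf T}^{(\kappa)}(\lambda)=\kappa^{-1}\mathsf B(\lambda)+\kappa\,\mathsf C(\lambda)$, acting on $\bigotimes_n V_n$. A function $\bar{\mathsf t}:\mathbb C\to\mathbb C$ is an eigenvalue function of $\bar{\mathsf T}^{(\kappa)}$ if there is a vector $v\ne0$, independent of $\lambda$, with $\bar{\mathsf T}^{(\kappa)}(\lambda)v=\bar{\mathsf t}(\lambda)v$ for all $\lambda\in\mathbb C$. Consider functions of the form $$Q(\lambda)=\prod_{j=1}^{\mathsf N_s}\sinh\Big(\frac{\lambda-\lambda_j}{2}\Big),\qquad \lambda_1,\dots,\lambda_{\mathsf N_s}\in\mathbb C. \tag{1}$$ If $Q$ has this form then so does $-Q$. Call $Q$ admissible if $\big(Q(\xi_n^{(0)}),Q(\xi_n^{(0)}+i\pi)\big)\ne(0,0)$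 for all $n\in\{1,\dots,\mathsf N\}$. For $\epsilon\in\{-1,1\}$ put $$w_\epsilon(\lambda)=2\epsilon\Big(\frac i2\Big)^{\mathsf N_s}\prod_{n=1}^{\mathsf N}\prod_{h=1}^{2s_n-1}\sinh(\lambda-\xi_n^{(h)}).$$ **Theorem 5.1.** Assume that the sets $\Xi_n=\{\xi_n+k\eta+k'i\pi\mid k=-s_n,-s_n+1,\dots,s_n;\ k'\in\mathbb Z\}$, $1\le n\le\mathsf N$, are pairwise disjoint. Then for every $\kappa\in\mathbb C\setminus\{0\}$ and every function $\bar{\mathsf t}:\mathbb C\to\mathbb C$ the following are equivalent. 1. $\bar{\mathsf t}$ is an eigenvalue function of $\bar{\mathsf T}^{(\kappa)}$. 2. $\bar{\mathsf t}$ is entire, $\bar{\mathsf t}(\lambda+i\pi)=(-1)^{\mathsf N-1}\bar{\mathsf t}(\lambda)$ for all $\lambda$, and there is a function $Q$ of the form (1), unique up to sign, such that $$\bar{\mathsf t}(\lambda)Q(\lambda)=-a(\lambda)Q(\lambda-\eta)+d(\lambda)Q(\lambda+\eta)\quad\text{for all }\lambda;$$ moreover this $Q$ is admissible. 3. $\bar{\mathsf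 t}$ is entire, and there is a couple $(\epsilon,Q)$ with $\epsilon\in\{-1,1\}$ and $Q$ of the form (1), unique up to the sign of $Q$, such that $$Q(\lambda)Q(\lambda+i\pi-\eta)+Q(\lambda+i\pi)Q(\lambda-\eta)=d(\lambda)\,w_\epsilon(\lambda)\quad\text{for all }\lambda$$ and, wherever $w_\epsilon(\lambda)\ne0$, $$\bar{\mathsf t}(\lambda)=\frac{Q(\lambda+\eta)Q(\lambda+i\pi-\eta)-Q(\lambda+\eta+i\pi)Q(\lambda-\eta)}{w_\epsilon(\lambda)};$$ moreover this $Q$ is admissible. -/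

import Mathlib

/-- The parameters of an inhomogeneous XXZ chain with `N` sites: the anisotropy parameter `η`, and,
at each site `n`, twice the spin (`twoS n = 2 s_n`) and the inhomogeneity parameter `ξ n`. -/
structure XXZChain (N : ℕ) where
  η : ℂ
  twoS : Fin N → ℕ
  ξ : Fin N → ℂ

namespace XXZChain

variable {N : ℕ}

/-- The spin `s_n`, a half-integer, as a complex number. -/
noncomputable def spin (X : XXZChain N) (n : Fin N) : ℂ := (X.twoS n : ℂ) / 2

/-- `N_s = 2 ∑ s_n`. -/
def Ns (X : XXZChain N) : ℕ := ∑ n, X.twoS n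

/-- The `q`-integer `[j]_q = sinh (η j) / sinh η`, with `q = e^η`. -/
noncomputable def qInt (X : XXZChain N) (j : ℕ) : ℂ :=
  Complex.sinh (X.η * j) / Complex.sinh X.η

/-- The coefficient `x_n(k) = √([k]_q [2 s_n - k + 1]_q)` (used for `k ≤ 2 s_n`), with the principal
branch of the square root. -/
noncomputable def xCoef (X : XXZChain N) (n : Fin N) (k : ℕ) : ℂ :=
  (X.qInt k * X.qInt (X.twoS n + 1 - k)) ^ (1 / 2 : ℂ)

/-- Index set of the basis `|k, n⟩`, `k = 0, …, 2 s_n`, of the local quantum space at site `n`. -/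
abbrev Loc (X : XXZChain N) (n : Fin N) : Type := Fin (X.twoS n + 1)

/-- Index set of the product basis of the space of states, the tensor product of the local
spaces. -/
abbrev Conf (X : XXZChain N) : Type := (n : Fin N) → X.Loc n

/-- Operators on the space of states, in the product basis. -/
abbrev Op (X : XXZChain N) : Type := Matrix X.Conf X.Conf ℂ

/-- `f(S^z)` at site `n`, where `S^z |k⟩ = (s_n - k) |k⟩`. -/
noncomputable def locSz (X : XXZChain N) (n : Fin N) (f : ℂ → ℂ) :
    Matrix (X.Loc n) (X.Loc n) ℂ :=
  Matrix.diagonal fun k => f (X.spin n - ((k : ℕ) : ℂ))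

/-- `S^- |k⟩ = x_n(k+1) |k+1⟩`. -/
noncomputable def locSminus (X : XXZChain N) (n : Fin N) : Matrix (X.Loc n) (X.Loc n) ℂ :=
  Matrix.of fun i j => if (i : ℕ) = j + 1 then X.xCoef n i else 0

/-- `S^+ |k⟩ = x_n(k) |k-1⟩`. -/
noncomputable def locSplus (X : XXZChain N) (n : Fin N) : Matrix (X.Loc n) (X.Loc n) ℂ :=
  Matrix.of fun i j => if (j : ℕ) = i + 1 then X.xCoef n j else 0

/-- The operator on the space of states acting as `A` on site `n` and as the identity on all other
sites. -/
noncomputable def atSite (X : XXZChain N) (n : Fin N) (A : Matrix (X.Loc n) (X.Loc n) ℂ) : X.Op :=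
  Matrix.of fun h h' => if ∀ l, l ≠ n → h l = h' l then A (h n) (h' n) else 0

/-- The Lax operator at site `n`, a `2 × 2` matrix over the auxiliary space whose entries are
operators on the space of states. -/
noncomputable def lax (X : XXZChain N) (n : Fin N) (z : ℂ) : Matrix (Fin 2) (Fin 2) X.Op :=
  !![X.atSite n (X.locSz n fun s => Complex.sinh (z + X.η * s)),
      X.atSite n (Complex.sinh X.η • X.locSminus n);
     X.atSite n (Complex.sinh X.η • X.locSplus n),
      X.atSite n (X.locSz n fun s => Complex.sinh (z - X.η * s))]

/-- The monodromy matrix `L_N(z - ξ_N) ⋯ L_1(z - ξ_1)`. -/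
noncomputable def monodromy (X : XXZChain N) (z : ℂ) : Matrix (Fin 2) (Fin 2) X.Op :=
  (List.ofFn fun n => X.lax n (z - X.ξ n)).reverse.prod

/-- The `κ`-twisted antiperiodic transfer matrix `κ⁻¹ B(z) + κ C(z)`, where `B` and `C` are the
upper right and the lower left entry of the monodromy matrix. -/
noncomputable def antiTransfer (X : XXZChain N) (κ z : ℂ) : X.Op :=
  κ⁻¹ • X.monodromy z 0 1 + κ • X.monodromy z 1 0

/-- The set of eigenvalue functions of the one-parameter family of operators
`z ↦ X.antiTransfer κ z`: the eigenvector does not depend on `z`. -/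
def eigenvalueFunctions (X : XXZChain N) (κ : ℂ) : Set (ℂ → ℂ) :=
  {t | ∃ v : X.Conf → ℂ, v ≠ 0 ∧ ∀ z, (X.antiTransfer κ z).mulVec v = t z • v}

/-- `a(z) = ∏ sinh (z - ξ_n + s_n η)`. -/
noncomputable def a (X : XXZChain N) (z : ℂ) : ℂ :=
  ∏ n, Complex.sinh (z - X.ξ n + X.spin n * X.η)

/-- `d(z) = ∏ sinh (z - ξ_n - s_n η)`. -/
noncomputable def d (X : XXZChain N) (z : ℂ) : ℂ :=
  ∏ n, Complex.sinh (z - X.ξ n - X.spin n * X.η)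

/-- The shifted inhomogeneity parameter `ξ_n^{(k)} = ξ_n + (s_n - k) η`. -/
noncomputable def xiShift (X : XXZChain N) (n : Fin N) (k : ℕ) : ℂ :=
  X.ξ n + (X.spin n - k) * X.η

/-- The set `Ξ_n = {ξ_n + k η + k' i π | k = -s_n, -s_n + 1, …, s_n, k' ∈ ℤ}`; here `k` runs in the
form `s_n - j` with `j = 0, …, 2 s_n`. -/
def xiString (X : XXZChain N) (n : Fin N) : Set ℂ :=
  {z | ∃ j : ℕ, j ≤ X.twoS n ∧ ∃ k' : ℤ,
    z = X.ξ n + (X.spin n - j) * X.η + k' * (Complex.I * Real.pi)}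

/-- The function `w_ε(z) = 2 ε (i/2)^{N_s} ∏_n ∏_{h=1}^{2 s_n - 1} sinh (z - ξ_n^{(h)})`. -/
noncomputable def w (X : XXZChain N) (ε : ℤ) (z : ℂ) : ℂ :=
  2 * (ε : ℂ) * (Complex.I / 2) ^ X.Ns *
    ∏ n, ∏ h ∈ Finset.Icc 1 (X.twoS n - 1), Complex.sinh (z - X.xiShift n h)

/-- `Q(z) = ∏_{j=1}^{N_s} sinh ((z - μ_j) / 2)` for some complex roots `μ_j`. -/
def IsQForm (X : XXZChain N) (Q : ℂ → ℂ) : Prop :=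
  ∃ μ : Fin X.Ns → ℂ, ∀ z, Q z = ∏ j, Complex.sinh ((z - μ j) / 2)

/-- The homogeneous Baxter equation `t(z) Q(z) = -a(z) Q(z - η) + d(z) Q(z + η)`. -/
def Baxter (X : XXZChain N) (t Q : ℂ → ℂ) : Prop :=
  ∀ z, t z * Q z = -X.a z * Q (z - X.η) + X.d z * Q (z + X.η)

/-- Admissibility: `(Q(ξ_n^{(0)}), Q(ξ_n^{(0)} + iπ)) ≠ (0, 0)` for every site `n`. -/
def Admissible (X : XXZChain N) (Q : ℂ → ℂ) : Prop :=
  ∀ n, (Q (X.xiShift n 0), Q (X.xiShift n 0 + Complex.I * Real.pi)) ≠ (0, 0)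

/-- The Wronskian identity `Q(z) Q(z + iπ - η) + Q(z + iπ) Q(z - η) = d(z) w_ε(z)`. -/
def WronskianIdentity (X : XXZChain N) (ε : ℤ) (Q : ℂ → ℂ) : Prop :=
  ∀ z, Q z * Q (z + Complex.I * Real.pi - X.η) + Q (z + Complex.I * Real.pi) * Q (z - X.η)
    = X.d z * X.w ε z

/-- `t(z) = (Q(z + η) Q(z + iπ - η) - Q(z + η + iπ) Q(z - η)) / w_ε(z)`, an identity of meromorphic
functions, i.e. wherever the denominator does not vanish. -/
def WronskianExpr (X : XXZChain N) (ε : ℤ) (t Q : ℂ → ℂ) : Prop :=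
  ∀ z, X.w ε z ≠ 0 →
    t z = (Q (z + X.η) * Q (z + Complex.I * Real.pi - X.η)
      - Q (z + X.η + Complex.I * Real.pi) * Q (z - X.η)) / X.w ε z

end XXZChain

/-!
The proof passes through a third description of the eigenvalue functions, `DiscreteBaxter`: `t` is a
trigonometric polynomial of degree `N - 1`, and on each string `ξ_n^{(0)}, …, ξ_n^{(2 s_n)}` the
Baxter equation has a solution that does not vanish at the first point.

*Separation of variables.* The monodromy matrix satisfies the exchange relations of the six-vertex
`R`-matrix and has a scalar quantum determinant (`isMonodromy_monodromy`). Starting from the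
reference row vector, an eigenvector of all the `D(z)`, the operators `C` at the points of the
strings generate joint eigenvectors of the commuting operators `D(z)`; under the genericity
assumptions their eigenvalues are separated, so that they form a basis
(`IsSeparating.linearIndependent`). In this basis the antiperiodic transfer matrix at a point of the
`n`-th string shifts the `n`-th coordinate by one, with the coefficients of the Baxter equation
(`IsSeparating.vecMul_antiTransfer`). Eigenvectors therefore factorize into solutions of the
equations on the strings, which is `Generic.mem_eigenvalueFunctions_iff`.

*From the strings to `Q`.* In the variable `x = e^z` the Baxter equation becomes a `q`-difference
equation `S f = -A f(p x) + B f(q x)`, `p = q⁻¹`, with `A`, `B` even and `S` odd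
(`baxter_halfPoly_iff`). Since `q` is not a root of unity, it has a unique formal power series
solution `f` with `f(0) = 1`, and the question is why `f` is a polynomial. As `f(-x)` solves the
equation with `-S`, the Wronskian of `f(x)` and `f(-x)` over one step is determined by a first order
equation: it is the explicit polynomial `2 f(0)² bodyPoly` (`IsSolution.wronskian`). The Wronskians
over `j` steps satisfy a three-term recursion in which one divides by `A(pʲ x)`; solvability on the
strings is what makes this division exact (`tailPoly_comp_dvd`), so that all of them are polynomials
of degree at most `2 N_s`. Their coefficients of order `2k`, read as polynomials in `pʲ` with `j`
odd, have the square of the `k`-th coefficient of `f` as a middle coefficient, up to a factor `±2`;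
hence `f` is a polynomial of degree at most `N_s` (`coeff_eq_zero_of_stepWronskian`). The comparison
of top coefficients in the Wronskian identity shows that the degree is exactly `N_s`, so that a
multiple of `f` gives a `Q` of the required form, and that the sign `ε` exists. Uniqueness up to
sign is the uniqueness of `f`, and `Q` is admissible because a common zero of `Q` and `Q(· + iπ)` at
the first point of a string would propagate to the next point and produce a double zero of
`bodyPoly`, which has none (`IsSolution.eval_ne_zero`).

*Between the two forms of the functional equation.* The Baxter equations for `Q` and `Q(· + iπ)`,
solved for `t`, give the expression of `t` as a quotient of Wronskians; conversely that expression
and the identity for the Wronskian at `z` and `z + η` give back the Baxter equation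
(`Baxter.wronskianExpr`, `WronskianExpr.baxter`). If `t` is entire, quasi-periodic and solves the
Baxter equation for some admissible `Q`, then it is a Laurent polynomial in `e^z` of the right
degrees, and the values of `Q` or of `Q(· + iπ)` on the strings solve the discrete equations
(`Baxter.discreteBaxter`).
-/

open scoped Polynomial

/-! ### Difference operators on power series, and the polynomials attached to the strings -/

namespace QDifference

section PowerSeries

variable {K : Type*} [Field K]

/-- The linear `q`-difference operator `f ↦ B f(rX) - A f(sX) - S f` on formal power series. -/
noncomputable def qOp (A B S : PowerSeries K) (r s : K) (f : PowerSeries K) : PowerSeries K :=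
  B * PowerSeries.rescale r f - A * PowerSeries.rescale s f - S * f

theorem qOp_sub (A B S : PowerSeries K) (r s : K) (f g : PowerSeries K) :
    qOp A B S r s (f - g) = qOp A B S r s f - qOp A B S r s g := by
  simp only [qOp, map_sub]; ring

theorem qOp_C_mul (A B S : PowerSeries K) (r s c : K) (f : PowerSeries K) :
    qOp A B S r s (PowerSeries.C c * f) = PowerSeries.C c * qOp A B S r s f := by
  have h : ∀ x : K, PowerSeries.rescale x (PowerSeries.C c) = PowerSeries.C c := by
    intro x
    ext n
    rw [PowerSeries.coeff_rescale, PowerSeries.coeff_C]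
    split_ifs with hn <;> simp [hn]
  simp only [qOp, map_mul, h]; ring

theorem coeff_mul_of_coeff_lt_eq_zero (G g : PowerSeries K) (n : ℕ)
    (h : ∀ m < n, PowerSeries.coeff m g = 0) :
    PowerSeries.coeff n (G * g) = PowerSeries.constantCoeff G * PowerSeries.coeff n g := by
  rw [PowerSeries.coeff_mul, Finset.sum_eq_single (0, n)]
  · simp
  · rintro ⟨i, j⟩ hij hne
    rw [Finset.HasAntidiagonal.mem_antidiagonal] at hij
    have : j < n := by
      rcases Nat.lt_or_ge j n with h1 | h1
      · exact h1
      · exfalso; apply hne; ext <;> simp at * <;> omega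
    simp [h j this]
  · simp

/-- The operator `qOp` is triangular in the basis of monomials, with diagonal entries
`rⁿ - sⁿ`. -/
theorem coeff_qOp_of_coeff_lt_eq_zero {A B S : PowerSeries K} (r s : K)
    (hA : PowerSeries.constantCoeff A = 1) (hB : PowerSeries.constantCoeff B = 1)
    (hS : PowerSeries.constantCoeff S = 0) (g : PowerSeries K) (n : ℕ)
    (h : ∀ m < n, PowerSeries.coeff m g = 0) :
    PowerSeries.coeff n (qOp A B S r s g) = (r ^ n - s ^ n) * PowerSeries.coeff n g := by
  have hr : ∀ x : K, ∀ m < n, PowerSeries.coeff m (PowerSeries.rescale x g) = 0 := by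
    intro x m hm
    rw [PowerSeries.coeff_rescale, h m hm, mul_zero]
  rw [qOp, map_sub, map_sub, coeff_mul_of_coeff_lt_eq_zero _ _ _ (hr r),
    coeff_mul_of_coeff_lt_eq_zero _ _ _ (hr s), coeff_mul_of_coeff_lt_eq_zero _ _ _ h, hA, hB, hS,
    PowerSeries.coeff_rescale, PowerSeries.coeff_rescale]
  ring

theorem eq_zero_of_qOp_eq_zero {A B S : PowerSeries K} {r s : K}
    (hrs : ∀ n, 1 ≤ n → r ^ n ≠ s ^ n)
    (hA : PowerSeries.constantCoeff A = 1) (hB : PowerSeries.constantCoeff B = 1)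
    (hS : PowerSeries.constantCoeff S = 0) {g : PowerSeries K}
    (hg : qOp A B S r s g = 0) (h0 : PowerSeries.constantCoeff g = 0) : g = 0 := by
  ext n
  induction n using Nat.strong_induction_on with
  | _ n ih =>
    rcases Nat.eq_zero_or_pos n with rfl | hn
    · simpa using h0
    · have h := coeff_qOp_of_coeff_lt_eq_zero r s hA hB hS g n (fun m hm => by simpa using ih m hm)
      rw [hg, map_zero] at h
      have h2 := mul_eq_zero.mp h.symm
      rcases h2 with h2 | h2
      · exact absurd (sub_eq_zero.mp h2) (hrs n hn)
      · simpa using h2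

/-- A sequence may be defined by prescribing each term as a function of the preceding ones. -/
theorem exists_sequence_of_recursion {α : Type*} [Zero α] (F : ℕ → (ℕ → α) → α) :
    ∃ c : ℕ → α, ∀ n, c n = F n (fun m => if m < n then c m else 0) := by
  let rec_step : (n : ℕ) → ((m : ℕ) → m < n → α) → α :=
    fun n c => F n (fun m => if h : m < n then c m h else 0)
  let c : ℕ → α := fun n => WellFounded.fix (wellFounded_lt : WellFounded ((· < ·) : ℕ → ℕ → Prop))
    rec_step n
  refine ⟨c, fun n => ?_⟩
  have h := WellFounded.fix_eq (wellFounded_lt : WellFounded ((· < ·) : ℕ → ℕ → Prop)) rec_step n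
  refine h.trans ?_
  simp only [rec_step, c]
  congr 1

theorem exists_qOp_eq_zero {A B S : PowerSeries K} {r s : K}
    (hrs : ∀ n, 1 ≤ n → r ^ n ≠ s ^ n)
    (hA : PowerSeries.constantCoeff A = 1) (hB : PowerSeries.constantCoeff B = 1)
    (hS : PowerSeries.constantCoeff S = 0) :
    ∃ f : PowerSeries K, PowerSeries.constantCoeff f = 1 ∧ qOp A B S r s f = 0 := by
  obtain ⟨c, hc⟩ := exists_sequence_of_recursion (α := K) (fun n c =>
    if n = 0 then 1
    else -(PowerSeries.coeff n (qOp A B S r s (PowerSeries.mk c))) / (r ^ n - s ^ n))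
  have hc0 : c 0 = 1 := by rw [hc]; simp
  refine ⟨PowerSeries.mk c, by simpa using hc0, ?_⟩
  ext n
  rcases Nat.eq_zero_or_pos n with rfl | hn
  · rw [coeff_qOp_of_coeff_lt_eq_zero r s hA hB hS _ 0 (by simp)]; simp
  · set g : PowerSeries K := PowerSeries.mk (fun m => if m < n then c m else 0) with hg
    have hlow : ∀ m < n, PowerSeries.coeff m (PowerSeries.mk c - g) = 0 := by
      intro m hm; simp [hg, hm]
    have h1 := coeff_qOp_of_coeff_lt_eq_zero r s hA hB hS _ n hlow
    rw [qOp_sub, map_sub] at h1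
    have h2 : PowerSeries.coeff n (PowerSeries.mk c - g) = c n := by simp [hg]
    have h3 := hc n
    rw [if_neg (by omega), ← hg, eq_div_iff (sub_ne_zero.mpr (hrs n hn))] at h3
    rw [h2] at h1
    rw [map_zero]
    linear_combination h1 + h3

end PowerSeries

section Polynomial

variable {K : Type*} [Field K]

theorem coe_comp_C_mul_X (P : K[X]) (c : K) :
    ((P.comp (Polynomial.C c * Polynomial.X) : K[X]) : PowerSeries K)
      = PowerSeries.rescale c (P : PowerSeries K) := by
  ext n
  rw [PowerSeries.coeff_rescale, Polynomial.coeff_coe, Polynomial.coeff_coe,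
    Polynomial.comp_C_mul_X_coeff, mul_comm]

/-- The even polynomial `1 - c X²`. -/
noncomputable def stringFactor (c : K) : K[X] := 1 - Polynomial.C c * Polynomial.X ^ 2

@[simp] theorem eval_stringFactor (c x : K) : (stringFactor c).eval x = 1 - c * x ^ 2 := by
  simp [stringFactor]

theorem natDegree_stringFactor {c : K} (hc : c ≠ 0) : (stringFactor c).natDegree = 2 := by
  unfold stringFactor; compute_degree!

theorem coeff_two_stringFactor (c : K) : (stringFactor c).coeff 2 = -c := by
  simp [stringFactor, Polynomial.coeff_one]

theorem stringFactor_ne_zero (c : K) : stringFactor c ≠ 0 := by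
  intro h
  have := eval_stringFactor c 0
  rw [h] at this
  simp at this

theorem stringFactor_comp (c s : K) :
    (stringFactor c).comp (Polynomial.C s * Polynomial.X) = stringFactor (c * s ^ 2) := by
  simp [stringFactor]; ring

theorem isCoprime_stringFactor {c d : K} (h : c ≠ d) :
    IsCoprime (stringFactor c) (stringFactor d) := by
  refine ⟨Polynomial.C (d / (d - c)), Polynomial.C (-c / (d - c)), ?_⟩
  have h' : d - c ≠ 0 := sub_ne_zero.mpr h.symm
  have h1 : Polynomial.C (d / (d - c)) + Polynomial.C (-c / (d - c)) = (1 : K[X]) := by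
    rw [← Polynomial.C_add, ← add_div, ← sub_eq_add_neg, div_self h', Polynomial.C_1]
  have h2 : Polynomial.C (d / (d - c)) * Polynomial.C c
      + Polynomial.C (-c / (d - c)) * Polynomial.C d = (0 : K[X]) := by
    rw [← Polynomial.C_mul, ← Polynomial.C_mul, ← Polynomial.C_add]
    rw [show d / (d - c) * c + -c / (d - c) * d = 0 by ring, Polynomial.C_0]
  simp only [stringFactor]
  linear_combination h1 - Polynomial.X ^ 2 * h2

theorem stringFactor_dvd [CharZero K] {c x : K} (hx : c * x ^ 2 = 1) {P : K[X]}
    (h1 : P.eval x = 0) (h2 : P.eval (-x) = 0) : stringFactor c ∣ P := by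
  have hx0 : x ≠ 0 := by rintro rfl; simp at hx
  have hco : IsCoprime (Polynomial.X - Polynomial.C x) (Polynomial.X - Polynomial.C (-x)) := by
    apply Polynomial.isCoprime_X_sub_C_of_isUnit_sub
    rw [sub_neg_eq_add, ← two_mul]
    exact (mul_ne_zero two_ne_zero hx0).isUnit
  have h := hco.mul_dvd (Polynomial.dvd_iff_isRoot.mpr h1) (Polynomial.dvd_iff_isRoot.mpr h2)
  obtain ⟨R, hR⟩ := h
  have hc : c ≠ 0 := by rintro rfl; simp at hx
  refine ⟨Polynomial.C (-c⁻¹) * R, ?_⟩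
  rw [hR, stringFactor]
  have e1 : Polynomial.C (c⁻¹) = (Polynomial.C x : K[X]) ^ 2 := by
    rw [← Polynomial.C_pow]; congr 1; field_simp; rw [← hx]
  have e2 : (Polynomial.C c : K[X]) * Polynomial.C x ^ 2 = 1 := by
    rw [← Polynomial.C_pow, ← Polynomial.C_mul, hx, Polynomial.C_1]
  simp only [Polynomial.C_neg, e1]
  linear_combination (-R * Polynomial.X ^ 2) * e2

end Polynomial

section Strings

variable {K : Type*} [Field K] {N : ℕ}

/-- `∏ₙ (1 - ζₙ X²)`: vanishes at the first points of the strings. -/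
noncomputable def headPoly (ζ : Fin N → K) : K[X] := ∏ n, stringFactor (ζ n)

/-- `∏ₙ (1 - ζₙ q^{2mₙ} X²)`: vanishes at the last points of the strings. -/
noncomputable def tailPoly (q : K) (m : Fin N → ℕ) (ζ : Fin N → K) : K[X] :=
  ∏ n, stringFactor (ζ n * q ^ (2 * m n))

/-- `∏ₙ ∏_{h < mₙ} (1 - ζₙ q^{2h} X²)`: vanishes at all points of the strings but the last ones. -/
noncomputable def bodyPoly (q : K) (m : Fin N → ℕ) (ζ : Fin N → K) : K[X] :=
  ∏ n, ∏ h ∈ Finset.range (m n), stringFactor (ζ n * q ^ (2 * h))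

/-- The odd polynomial `X τ(X²)`. -/
noncomputable def oddPoly (τ : K[X]) : K[X] := Polynomial.X * τ.comp (Polynomial.X ^ 2)

@[simp] theorem eval_headPoly (ζ : Fin N → K) (x : K) :
    (headPoly ζ).eval x = ∏ n, (1 - ζ n * x ^ 2) := by
  simp [headPoly, Polynomial.eval_prod]

@[simp] theorem eval_tailPoly (q : K) (m : Fin N → ℕ) (ζ : Fin N → K) (x : K) :
    (tailPoly q m ζ).eval x = ∏ n, (1 - ζ n * q ^ (2 * m n) * x ^ 2) := by
  simp [tailPoly, Polynomial.eval_prod]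

@[simp] theorem eval_bodyPoly (q : K) (m : Fin N → ℕ) (ζ : Fin N → K) (x : K) :
    (bodyPoly q m ζ).eval x
      = ∏ n, ∏ h ∈ Finset.range (m n), (1 - ζ n * q ^ (2 * h) * x ^ 2) := by
  simp [bodyPoly, Polynomial.eval_prod]

@[simp] theorem eval_oddPoly (τ : K[X]) (x : K) : (oddPoly τ).eval x = x * τ.eval (x ^ 2) := by
  simp [oddPoly]

theorem coeff_zero_headPoly (ζ : Fin N → K) : (headPoly ζ).coeff 0 = 1 := by
  simp [Polynomial.coeff_zero_eq_eval_zero]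

theorem coeff_zero_tailPoly (q : K) (m : Fin N → ℕ) (ζ : Fin N → K) :
    (tailPoly q m ζ).coeff 0 = 1 := by
  simp [Polynomial.coeff_zero_eq_eval_zero]

theorem coeff_zero_bodyPoly (q : K) (m : Fin N → ℕ) (ζ : Fin N → K) :
    (bodyPoly q m ζ).coeff 0 = 1 := by
  simp [Polynomial.coeff_zero_eq_eval_zero]

theorem coeff_zero_oddPoly (τ : K[X]) : (oddPoly τ).coeff 0 = 0 := by
  simp [Polynomial.coeff_zero_eq_eval_zero]

theorem headPoly_comp_neg (ζ : Fin N → K) (s : K) :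
    (headPoly ζ).comp (Polynomial.C (-s) * Polynomial.X)
      = (headPoly ζ).comp (Polynomial.C s * Polynomial.X) := by
  simp only [headPoly, Polynomial.prod_comp, stringFactor_comp]; simp

theorem tailPoly_comp_neg (q : K) (m : Fin N → ℕ) (ζ : Fin N → K) (s : K) :
    (tailPoly q m ζ).comp (Polynomial.C (-s) * Polynomial.X)
      = (tailPoly q m ζ).comp (Polynomial.C s * Polynomial.X) := by
  simp only [tailPoly, Polynomial.prod_comp, stringFactor_comp]; simp

theorem oddPoly_comp_neg (τ : K[X]) (s : K) :
    (oddPoly τ).comp (Polynomial.C (-s) * Polynomial.X)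
      = -(oddPoly τ).comp (Polynomial.C s * Polynomial.X) := by
  simp only [oddPoly, Polynomial.mul_comp, Polynomial.X_comp, Polynomial.comp_assoc,
    Polynomial.pow_comp]
  simp [mul_pow]

theorem natDegree_headPoly_le (ζ : Fin N → K) : (headPoly ζ).natDegree ≤ 2 * N := by
  refine (Polynomial.natDegree_prod_le _ _).trans ?_
  refine (Finset.sum_le_card_nsmul _ _ 2 ?_).trans (by simp [mul_comm])
  intro n _
  simp only [stringFactor]; compute_degree

theorem natDegree_tailPoly {q : K} (hq : q ≠ 0) (m : Fin N → ℕ) {ζ : Fin N → K}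
    (hζ : ∀ n, ζ n ≠ 0) : (tailPoly q m ζ).natDegree = 2 * N := by
  rw [tailPoly, Polynomial.natDegree_prod _ _ (fun n _ => stringFactor_ne_zero _)]
  rw [Finset.sum_congr rfl (fun n _ => natDegree_stringFactor
    (mul_ne_zero (hζ n) (pow_ne_zero _ hq)))]
  simp [mul_comm]

theorem natDegree_bodyPoly {q : K} (hq : q ≠ 0) (m : Fin N → ℕ) {ζ : Fin N → K}
    (hζ : ∀ n, ζ n ≠ 0) : (bodyPoly q m ζ).natDegree = 2 * ∑ n, m n := by
  rw [bodyPoly, Polynomial.natDegree_prod _ _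
    (fun n _ => Finset.prod_ne_zero_iff.mpr fun h _ => stringFactor_ne_zero _), Finset.mul_sum]
  refine Finset.sum_congr rfl fun n _ => ?_
  rw [Polynomial.natDegree_prod _ _ (fun n _ => stringFactor_ne_zero _)]
  rw [Finset.sum_congr rfl (fun h _ => natDegree_stringFactor
    (mul_ne_zero (hζ n) (pow_ne_zero _ hq)))]
  simp [mul_comm]

theorem leadingCoeff_bodyPoly {q : K} (hq : q ≠ 0) (m : Fin N → ℕ) {ζ : Fin N → K}
    (hζ : ∀ n, ζ n ≠ 0) : (bodyPoly q m ζ).leadingCoeff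
      = ∏ n, ∏ h ∈ Finset.range (m n), -(ζ n * q ^ (2 * h)) := by
  simp only [bodyPoly, Polynomial.leadingCoeff_prod]
  refine Finset.prod_congr rfl fun n _ => Finset.prod_congr rfl fun h _ => ?_
  rw [Polynomial.leadingCoeff, natDegree_stringFactor (mul_ne_zero (hζ n) (pow_ne_zero _ hq)),
    coeff_two_stringFactor]

/-- The `q`-Pearson equation satisfied by the polynomial attached to the strings: each string moves
by one step. -/
theorem headPoly_mul_bodyPoly_comp (q : K) (m : Fin N → ℕ) (ζ : Fin N → K) :
    headPoly ζ * (bodyPoly q m ζ).comp (Polynomial.C q * Polynomial.X)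
      = tailPoly q m ζ * bodyPoly q m ζ := by
  simp only [headPoly, bodyPoly, tailPoly, Polynomial.prod_comp, stringFactor_comp]
  rw [← Finset.prod_mul_distrib, ← Finset.prod_mul_distrib]
  refine Finset.prod_congr rfl fun n _ => ?_
  rw [mul_comm (stringFactor (ζ n * q ^ (2 * m n))),
    ← Finset.prod_range_succ (fun h => stringFactor (ζ n * q ^ (2 * h))), Finset.prod_range_succ',
    mul_comm]
  simp only [mul_zero, pow_zero, mul_one]
  congr 1
  refine Finset.prod_congr rfl fun h _ => ?_
  congr 1; ring

end Strings

end QDifference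

/-! ### Divisibility of the Wronskians -/

namespace QDifference

section Recursions

variable {K : Type*} [Field K]

/-- If a tridiagonal system of `m + 1` equations has a non-trivial solution `y`, then any `w`
solving the first `m` equations, with the signs of the off-diagonal coefficients reversed, solves
the last one as well: the first `m` equations determine `w` up to a scalar, and `(-1)ʰ y h` is a
solution. -/
theorem last_equation_of_tridiagonal (m : ℕ) (a b s y w : ℕ → K) (hy0 : y 0 ≠ 0)
    (hy : ∀ h ≤ m, s h * y h = -a h * y (h + 1) + b h * y (h - 1))
    (ha : ∀ h < m, a h ≠ 0) (ham : a m = 0) (hb : b 0 = 0)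
    (hw : ∀ h < m, a h * w (h + 1) = s h * w h + b h * w (h - 1)) :
    s m * w m + b m * w (m - 1) = 0 := by
  have key : ∀ h ≤ m, w h = (-1) ^ h * (w 0 / y 0) * y h := by
    intro h
    induction h using Nat.strong_induction_on with
    | _ h ih =>
      intro hm
      rcases h with _ | h
      · field_simp
      · have h1 := hw h (by omega)
        have h2 := hy h (by omega)
        have h3 := ih h (by omega) (by omega)
        apply mul_left_cancel₀ (ha h (by omega))
        rw [h1, h3]
        rcases h with _ | h
        · rw [hb] at h2 ⊢
          linear_combination (w 0 / y 0) * h2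
        · have h4 := ih h (by omega) (by omega)
          simp only [Nat.add_sub_cancel] at h2 ⊢
          rw [h4]
          linear_combination ((-1) ^ (h + 1) * (w 0 / y 0)) * h2
  have h2 := hy m le_rfl
  rw [ham] at h2
  rw [key m le_rfl]
  rcases m with _ | m
  · rw [hb] at h2 ⊢
    linear_combination (w 0 / y 0) * h2
  · rw [key _ (Nat.sub_le _ 1)]
    simp only [Nat.add_sub_cancel] at h2 ⊢
    linear_combination ((-1) ^ (m + 1) * (w 0 / y 0)) * h2

end Recursions

section Main

variable {N : ℕ} {p q : ℂ} {m : Fin N → ℕ} {ζ : Fin N → ℂ} {τ : ℂ[X]}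

/-- The discrete form of the difference equation: on every string `x, x p, …, x p^{mₙ}` the equation
`S y = -A y(·p) + B y(·q)` has a non-trivial solution. -/
def StringSolvable (p q : ℂ) (m : Fin N → ℕ) (ζ : Fin N → ℂ) (τ : ℂ[X]) : Prop :=
  ∀ n, ∃ x, ζ n * x ^ 2 = 1 ∧ ∃ y : ℕ → ℂ, y 0 ≠ 0 ∧ ∀ h ≤ m n,
    (oddPoly τ).eval (x * p ^ h) * y h = -(tailPoly q m ζ).eval (x * p ^ h) * y (h + 1)
      + (headPoly ζ).eval (x * p ^ h) * y (h - 1)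

/-- The strings are pairwise disjoint and consist of distinct points. -/
def StringInjective (q : ℂ) (m : Fin N → ℕ) (ζ : Fin N → ℂ) : Prop :=
  ∀ i h j h', h ≤ m i → h' ≤ m j → ζ i * q ^ (2 * h) = ζ j * q ^ (2 * h') → i = j ∧ h = h'

theorem tailPoly_eval_ne_zero (hpq : p * q = 1) (hinj : StringInjective q m ζ) {n : Fin N} {x : ℂ}
    (hx : ζ n * x ^ 2 = 1) {h : ℕ} (hh : h < m n) : (tailPoly q m ζ).eval (x * p ^ h) ≠ 0 := by
  rw [eval_tailPoly, Finset.prod_ne_zero_iff]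
  intro l _ h0
  have h1 : (p * q) ^ (2 * h) = 1 := by rw [hpq, one_pow]
  have h2 : ζ l * q ^ (2 * m l) = ζ n * q ^ (2 * h) := by
    have : ζ l * q ^ (2 * m l) * x ^ 2 * p ^ (2 * h) = 1 := by linear_combination -h0
    calc ζ l * q ^ (2 * m l) = ζ l * q ^ (2 * m l) * (ζ n * x ^ 2) * (p * q) ^ (2 * h) := by
          rw [hx, h1]; ring
      _ = (ζ l * q ^ (2 * m l) * x ^ 2 * p ^ (2 * h)) * (ζ n * q ^ (2 * h)) := by
          rw [mul_pow]; ring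
      _ = _ := by rw [this, one_mul]
  obtain ⟨h3, h4⟩ := hinj l (m l) n h le_rfl hh.le h2
  subst h3
  omega

theorem tailPoly_eval_last (hpq : p * q = 1) {n : Fin N} {x : ℂ}
    (hx : ζ n * x ^ 2 = 1) : (tailPoly q m ζ).eval (x * p ^ m n) = 0 := by
  rw [eval_tailPoly, Finset.prod_eq_zero_iff]
  refine ⟨n, Finset.mem_univ _, ?_⟩
  have h1 : (p * q) ^ (2 * m n) = 1 := by rw [hpq, one_pow]
  rw [mul_pow] at h1
  linear_combination -(q ^ (2 * m n) * p ^ (2 * m n)) * hx - h1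

theorem headPoly_eval_first {n : Fin N} {x : ℂ} (hx : ζ n * x ^ 2 = 1) :
    (headPoly ζ).eval x = 0 := by
  rw [eval_headPoly, Finset.prod_eq_zero_iff]
  exact ⟨n, Finset.mem_univ _, by rw [hx, sub_self]⟩

theorem bodyPoly_eval_eq_zero (hpq : p * q = 1) {n : Fin N} {x : ℂ}
    (hx : ζ n * x ^ 2 = 1) {h : ℕ} (hh : h < m n) : (bodyPoly q m ζ).eval (x * p ^ h) = 0 := by
  rw [eval_bodyPoly, Finset.prod_eq_zero_iff]
  refine ⟨n, Finset.mem_univ _, ?_⟩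
  rw [Finset.prod_eq_zero_iff]
  refine ⟨h, Finset.mem_range.mpr hh, ?_⟩
  have h1 : (p * q) ^ (2 * h) = 1 := by rw [hpq, one_pow]
  rw [mul_pow] at h1
  linear_combination -(q ^ (2 * h) * p ^ (2 * h)) * hx - h1

/-- Solvability on a string holds with any choice of the square root `x` of `1 / ζₙ`: changing the
sign of `x` amounts to changing the sign of every other component of the solution. -/
theorem StringSolvable.of_sq (hS : StringSolvable p q m ζ τ) (n : Fin N) {x : ℂ}
    (hx : ζ n * x ^ 2 = 1) :
    ∃ y : ℕ → ℂ, y 0 ≠ 0 ∧ ∀ h ≤ m n,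
    (oddPoly τ).eval (x * p ^ h) * y h = -(tailPoly q m ζ).eval (x * p ^ h) * y (h + 1)
      + (headPoly ζ).eval (x * p ^ h) * y (h - 1) := by
  obtain ⟨x', hx', y, hy0, hy⟩ := hS n
  have hζ : ζ n ≠ 0 := by intro h; simp [h] at hx
  have hsq : x ^ 2 = x' ^ 2 := mul_left_cancel₀ hζ (hx.trans hx'.symm)
  rcases sq_eq_sq_iff_eq_or_eq_neg.mp hsq with rfl | rfl
  · exact ⟨y, hy0, hy⟩
  · refine ⟨fun h => (-1) ^ h * y h, by simpa using hy0, fun h hh => ?_⟩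
    have h1 := hy h hh
    simp only [eval_oddPoly, eval_tailPoly, eval_headPoly, mul_pow, neg_sq] at h1 ⊢
    rcases h with _ | h
    · rw [show (∏ l, (1 - ζ l * (x' ^ 2 * (p ^ 0) ^ 2))) = 0 by
        simpa using headPoly_eval_first hx'] at h1 ⊢
      linear_combination -h1
    · simp only [Nat.add_sub_cancel] at h1 ⊢
      linear_combination (-1) ^ h * h1

/-- One step of the recursion for the Wronskians preserves polynomiality: at a root of the tail
polynomial, rescaled by `pʲ`, either a whole string has been crossed, and solvability on the string
applies, or the recursion has started inside the string, where the initial data vanish. -/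
theorem tailPoly_comp_dvd (hpq : p * q = 1)
    (hinj : StringInjective q m ζ) (hζ : ∀ n, ζ n ≠ 0) (hS : StringSolvable p q m ζ τ)
    (W : ℕ → ℂ[X]) (hW0 : W 0 = 0) (hW1 : bodyPoly q m ζ ∣ W 1) (j : ℕ) (hj : 1 ≤ j)
    (hrec : ∀ i, 1 ≤ i → i < j →
      (tailPoly q m ζ).comp (Polynomial.C (p ^ i) * Polynomial.X) * W (i + 1)
        = (oddPoly τ).comp (Polynomial.C (p ^ i) * Polynomial.X) * W i
          + (headPoly ζ).comp (Polynomial.C (p ^ i) * Polynomial.X) * W (i - 1)) :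
    (tailPoly q m ζ).comp (Polynomial.C (p ^ j) * Polynomial.X) ∣
      (oddPoly τ).comp (Polynomial.C (p ^ j) * Polynomial.X) * W j
          + (headPoly ζ).comp (Polynomial.C (p ^ j) * Polynomial.X) * W (j - 1) := by
  have hp0 : p ≠ 0 := left_ne_zero_of_mul_eq_one hpq
  have hq0 : q ≠ 0 := right_ne_zero_of_mul_eq_one hpq
  have hqp : ∀ k : ℕ, q ^ k * p ^ k = 1 := fun k => by rw [← mul_pow, mul_comm q, hpq, one_pow]
  -- the numerator vanishes at every point `r` with `r pʲ = x p^{mₙ}`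
  have hvan : ∀ n r, ζ n * q ^ (2 * m n) * (p ^ j) ^ 2 * r ^ 2 = 1 →
      ((oddPoly τ).comp (Polynomial.C (p ^ j) * Polynomial.X) * W j
        + (headPoly ζ).comp (Polynomial.C (p ^ j) * Polynomial.X) * W (j - 1)).eval r = 0 := by
    intro n r hr
    have hrec' : ∀ i, 1 ≤ i → i < j → (tailPoly q m ζ).eval (p ^ i * r) * (W (i + 1)).eval r
        = (oddPoly τ).eval (p ^ i * r) * (W i).eval r
          + (headPoly ζ).eval (p ^ i * r) * (W (i - 1)).eval r := by
      intro i hi hij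
      have := congrArg (Polynomial.eval r) (hrec i hi hij)
      simpa only [Polynomial.eval_mul, Polynomial.eval_add, Polynomial.eval_comp,
        Polynomial.eval_C, Polynomial.eval_X] using this
    simp only [Polynomial.eval_mul, Polynomial.eval_add, Polynomial.eval_comp,
        Polynomial.eval_C, Polynomial.eval_X]
    set x : ℂ := p ^ j * r * q ^ m n with hxdef
    have hx : ζ n * x ^ 2 = 1 := by rw [hxdef, ← hr]; ring
    have hxm : ∀ i k : ℕ, i + m n = j + k → p ^ i * r = x * p ^ k := by
      intro i k hik
      have : p ^ i * p ^ m n = p ^ j * p ^ k := by rw [← pow_add, ← pow_add, hik]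
      calc p ^ i * r = p ^ i * p ^ m n * q ^ m n * r := by
            rw [mul_assoc (p ^ i), mul_comm (p ^ m n), hqp, mul_one]
        _ = _ := by rw [this, hxdef]; ring
    rcases Nat.lt_or_ge (m n) j with hjm | hjm
    · obtain ⟨y, hy0, hy⟩ := hS.of_sq n hx
      have h := last_equation_of_tridiagonal (m n)
        (fun h => (tailPoly q m ζ).eval (x * p ^ h)) (fun h => (headPoly ζ).eval (x * p ^ h))
        (fun h => (oddPoly τ).eval (x * p ^ h)) y (fun h => (W (j - m n + h)).eval r) hy0 hy
        (fun h hh => tailPoly_eval_ne_zero hpq hinj hx hh) (tailPoly_eval_last hpq hx)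
        (by simpa using headPoly_eval_first hx) ?_
      · rw [hxm j (m n) rfl]
        rw [show j - m n + m n = j by omega] at h
        rcases Nat.eq_zero_or_pos (m n) with h0 | h0
        · have hb : (headPoly ζ).eval (x * p ^ m n) = 0 := by
            rw [h0]; simpa using headPoly_eval_first hx
          rw [hb] at h ⊢
          simpa using h
        · rwa [show j - m n + (m n - 1) = j - 1 by omega] at h
      · intro h hh
        have h1 := hrec' (j - m n + h) (by omega) (by omega)
        rw [hxm (j - m n + h) h (by omega)] at h1
        rcases Nat.eq_zero_or_pos h with h0 | h0
        · subst h0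
          have hb : (headPoly ζ).eval (x * p ^ 0) = 0 := by simpa using headPoly_eval_first hx
          simp only [hb] at h1 ⊢
          simpa using h1
        · rw [show j - m n + (h - 1) = j - m n + h - 1 by omega]
          exact h1
    · have hr1 : r = x * p ^ (m n - j) := by
        have := hxm 0 (m n - j) (by omega)
        simpa using this
      have hzero : ∀ i ≤ j, (W i).eval r = 0 := by
        intro i
        induction i using Nat.strong_induction_on with
        | _ i ih =>
          intro hi
          rcases i with _ | i
          · simp [hW0]
          rcases Nat.eq_zero_or_pos i with h0 | h0
          · subst h0
            obtain ⟨R, hR⟩ := hW1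
            rw [zero_add, hR, Polynomial.eval_mul, hr1, bodyPoly_eval_eq_zero hpq hx (by omega),
              zero_mul]
          · have h1 := hrec' i h0 (by omega)
            rw [ih i (by omega) (by omega), ih (i - 1) (by omega) (by omega), mul_zero, mul_zero,
              add_zero, hxm i (m n - j + i) (by omega)] at h1
            exact (mul_eq_zero.mp h1).resolve_left
              (tailPoly_eval_ne_zero hpq hinj hx (by omega))
      rw [hzero j le_rfl, hzero (j - 1) (by omega), mul_zero, mul_zero, add_zero]
  simp only [tailPoly, Polynomial.prod_comp, stringFactor_comp]
  refine Finset.prod_dvd_of_coprime ?_ ?_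
  · intro i _ l _ hil
    refine isCoprime_stringFactor fun h => hil ?_
    have h2 := mul_right_cancel₀ (pow_ne_zero 2 (pow_ne_zero j hp0)) h
    exact (hinj i (m i) l (m l) le_rfl le_rfl h2).1
  · intro n _
    obtain ⟨x, hx⟩ := IsAlgClosed.exists_pow_nat_eq ((ζ n * q ^ (2 * m n) * (p ^ j) ^ 2)⁻¹)
      (n := 2) (by norm_num)
    have hne : ζ n * q ^ (2 * m n) * (p ^ j) ^ 2 ≠ 0 :=
      mul_ne_zero (mul_ne_zero (hζ n) (pow_ne_zero _ hq0)) (pow_ne_zero 2 (pow_ne_zero j hp0))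
    have hx1 : ζ n * q ^ (2 * m n) * (p ^ j) ^ 2 * x ^ 2 = 1 := by
      rw [hx, mul_inv_cancel₀ hne]
    exact stringFactor_dvd hx1 (hvan n x hx1) (hvan n (-x) (by rw [neg_sq]; exact hx1))

end Main

end QDifference

/-! ### Polynomial solutions of the difference equation -/

namespace QDifference

section Main

variable {N : ℕ} {p q : ℂ} {m : Fin N → ℕ} {ζ : Fin N → ℂ} {τ : ℂ[X]}

/-- The difference equation `S f = -A f(pX) + B f(qX)` for formal power series. -/
def IsSolution (p q : ℂ) (m : Fin N → ℕ) (ζ : Fin N → ℂ) (τ : ℂ[X]) (f : PowerSeries ℂ) : Prop :=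
  (oddPoly τ : PowerSeries ℂ) * f = -(tailPoly q m ζ : PowerSeries ℂ) * PowerSeries.rescale p f
    + (headPoly ζ : PowerSeries ℂ) * PowerSeries.rescale q f

theorem isSolution_iff_qOp {f : PowerSeries ℂ} : IsSolution p q m ζ τ f ↔
    qOp (tailPoly q m ζ : PowerSeries ℂ) (headPoly ζ) (oddPoly τ) q p f = 0 := by
  unfold IsSolution qOp
  constructor <;> intro h <;> linear_combination -h

theorem constantCoeff_coe (P : ℂ[X]) :
    PowerSeries.constantCoeff (P : PowerSeries ℂ) = P.coeff 0 := by
  simp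

theorem IsSolution.rescale {f : PowerSeries ℂ} (hf : IsSolution p q m ζ τ f) (s : ℂ) :
    PowerSeries.rescale s (oddPoly τ : PowerSeries ℂ) * PowerSeries.rescale s f
      = -PowerSeries.rescale s (tailPoly q m ζ : PowerSeries ℂ) * PowerSeries.rescale (p * s) f
        + PowerSeries.rescale s (headPoly ζ : PowerSeries ℂ) * PowerSeries.rescale (q * s) f := by
  have h := congrArg (PowerSeries.rescale s) hf
  simpa only [map_mul, map_add, map_neg, PowerSeries.rescale_rescale] using h

/-- The equation after the substitution `X ↦ -sX`, which reverses the sign of the odd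
coefficient. -/
theorem IsSolution.rescale_neg {f : PowerSeries ℂ} (hf : IsSolution p q m ζ τ f) (s : ℂ) :
    PowerSeries.rescale s (oddPoly τ : PowerSeries ℂ) * PowerSeries.rescale (-s) f
      = PowerSeries.rescale s (tailPoly q m ζ : PowerSeries ℂ) * PowerSeries.rescale (-(p * s)) f
        - PowerSeries.rescale s (headPoly ζ : PowerSeries ℂ)
          * PowerSeries.rescale (-(q * s)) f := by
  have h := hf.rescale (-s)
  simp only [← coe_comp_C_mul_X, oddPoly_comp_neg, tailPoly_comp_neg, headPoly_comp_neg,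
    mul_neg, Polynomial.coe_neg] at h ⊢
  linear_combination -h

theorem pow_ne_pow_of_mul_eq_one (hpq : p * q = 1) (hq : ∀ n, 1 ≤ n → q ^ n ≠ 1) (n : ℕ)
    (hn : 1 ≤ n) : q ^ n ≠ p ^ n := by
  intro h
  refine hq (2 * n) (by omega) ?_
  have : (p * q) ^ n = 1 := by rw [hpq, one_pow]
  rw [mul_pow, ← h] at this
  rw [two_mul, pow_add, this]

theorem IsSolution.eq_C_mul (hpq : p * q = 1) (hq : ∀ n, 1 ≤ n → q ^ n ≠ 1) {f g : PowerSeries ℂ}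
    (hf : IsSolution p q m ζ τ f) (hg : IsSolution p q m ζ τ g)
    (hf0 : PowerSeries.constantCoeff f ≠ 0) :
    g = PowerSeries.C (PowerSeries.constantCoeff g / PowerSeries.constantCoeff f) * f := by
  rw [isSolution_iff_qOp] at hf hg
  rw [← sub_eq_zero]
  refine eq_zero_of_qOp_eq_zero (pow_ne_pow_of_mul_eq_one hpq hq) ?_ ?_ ?_
    (A := (tailPoly q m ζ : PowerSeries ℂ)) (B := (headPoly ζ : PowerSeries ℂ))
    (S := (oddPoly τ : PowerSeries ℂ)) ?_ ?_
  · rw [constantCoeff_coe, coeff_zero_tailPoly]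
  · rw [constantCoeff_coe, coeff_zero_headPoly]
  · rw [constantCoeff_coe, coeff_zero_oddPoly]
  · rw [qOp_sub, qOp_C_mul, hf, hg, mul_zero, sub_zero]
  · simp [div_mul_cancel₀ _ hf0]

/-- The quantum Wronskian of `f` and `f(-X)` satisfies a first order equation, and so is a multiple
of `bodyPoly`. -/
theorem IsSolution.wronskian (hpq : p * q = 1) (hq : ∀ n, 1 ≤ n → q ^ n ≠ 1) {f : PowerSeries ℂ}
    (hf : IsSolution p q m ζ τ f) :
    f * PowerSeries.rescale (-p) f + PowerSeries.rescale (-1) f * PowerSeries.rescale p f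
      = PowerSeries.C (2 * PowerSeries.constantCoeff f ^ 2) * (bodyPoly q m ζ : PowerSeries ℂ) := by
  have hqp : q * p = 1 := by rw [mul_comm, hpq]
  rw [← sub_eq_zero]
  refine eq_zero_of_qOp_eq_zero (r := q) (s := 1) (fun n hn => by rw [one_pow]; exact hq n hn)
    (A := (tailPoly q m ζ : PowerSeries ℂ)) (B := (headPoly ζ : PowerSeries ℂ))
    (S := 0) ?_ ?_ (by simp) ?_ ?_
  · rw [constantCoeff_coe, coeff_zero_tailPoly]
  · rw [constantCoeff_coe, coeff_zero_headPoly]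
  · rw [qOp_sub, qOp_C_mul]
    have h1 : qOp (tailPoly q m ζ : PowerSeries ℂ) (headPoly ζ) 0 q 1
        (bodyPoly q m ζ : PowerSeries ℂ) = 0 := by
      have h := headPoly_mul_bodyPoly_comp q m ζ
      have h' := congrArg (fun P : ℂ[X] => (P : PowerSeries ℂ)) h
      simp only [Polynomial.coe_mul, coe_comp_C_mul_X] at h'
      simp only [qOp, PowerSeries.rescale_one, RingHom.id_apply, h']
      ring
    rw [h1, mul_zero, sub_zero]
    have e1 : (oddPoly τ : PowerSeries ℂ) * f
        = -(tailPoly q m ζ : PowerSeries ℂ) * PowerSeries.rescale p f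
          + (headPoly ζ : PowerSeries ℂ) * PowerSeries.rescale q f := hf
    have e2 := hf.rescale_neg 1
    simp only [PowerSeries.rescale_one, RingHom.id_apply, mul_one] at e2
    simp only [qOp, map_add, map_mul, PowerSeries.rescale_rescale, PowerSeries.rescale_one,
      RingHom.id_apply, neg_mul, one_mul, hpq]
    linear_combination (-PowerSeries.rescale (-1) f) * e1 + f * e2
  · have : ∀ s : ℂ, PowerSeries.constantCoeff (PowerSeries.rescale s f)
        = PowerSeries.constantCoeff f := by
      intro s
      rw [← PowerSeries.coeff_zero_eq_constantCoeff_apply, PowerSeries.coeff_rescale]; simp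
    rw [map_sub, map_add, map_mul, map_mul, map_mul, this, this, this, constantCoeff_coe,
      coeff_zero_bodyPoly, PowerSeries.constantCoeff_C]
    ring

/-- The Wronskian of `f` and `f(-X)` over `j` steps, with the sign that makes it satisfy a
three-term recursion in `j`. -/
noncomputable def stepWronskian (p : ℂ) (f : PowerSeries ℂ) (j : ℕ) : PowerSeries ℂ :=
  f * PowerSeries.rescale (-(p ^ j)) f
    - (-1) ^ j * (PowerSeries.rescale (-1) f * PowerSeries.rescale (p ^ j) f)

theorem IsSolution.stepWronskian_recursion (hpq : p * q = 1) {f : PowerSeries ℂ}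
    (hf : IsSolution p q m ζ τ f) (j : ℕ) (hj : 1 ≤ j) :
    PowerSeries.rescale (p ^ j) (tailPoly q m ζ : PowerSeries ℂ) * stepWronskian p f (j + 1)
      = PowerSeries.rescale (p ^ j) (oddPoly τ : PowerSeries ℂ) * stepWronskian p f j
        + PowerSeries.rescale (p ^ j) (headPoly ζ : PowerSeries ℂ) * stepWronskian p f (j - 1) := by
  obtain ⟨j, rfl⟩ : ∃ i, j = i + 1 := ⟨j - 1, by omega⟩
  have e1 := hf.rescale (p ^ (j + 1))
  have e2 := hf.rescale_neg (p ^ (j + 1))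
  have h1 : q * p ^ (j + 1) = p ^ j := by
    rw [pow_succ', ← mul_assoc, mul_comm q, hpq, one_mul]
  rw [h1, ← pow_succ'] at e1 e2
  simp only [stepWronskian, Nat.add_sub_cancel]
  linear_combination (-(-1) ^ j * PowerSeries.rescale (-1) f) * e1 - f * e2

/-- When the equation is solvable on the strings, all the Wronskians of a formal solution are
polynomials, of bounded degree. -/
theorem IsSolution.stepWronskian_polynomial (hpq : p * q = 1) (hq : ∀ n, 1 ≤ n → q ^ n ≠ 1)
    (hinj : StringInjective q m ζ) (hζ : ∀ n, ζ n ≠ 0) (hτ : τ.natDegree ≤ N - 1) (hN : 1 ≤ N)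
    (hS : StringSolvable p q m ζ τ) {f : PowerSeries ℂ} (hf : IsSolution p q m ζ τ f) (j : ℕ) :
    ∃ W : ℕ → ℂ[X], ∀ i ≤ j, (W i).natDegree ≤ 2 * ∑ n, m n ∧
      (W i : PowerSeries ℂ) = stepWronskian p f i := by
  have hq0 : q ≠ 0 := right_ne_zero_of_mul_eq_one hpq
  have hp0 : p ≠ 0 := left_ne_zero_of_mul_eq_one hpq
  have hv0 : stepWronskian p f 0 = 0 := by
    simp [stepWronskian]; ring
  have hv1 : ((Polynomial.C (2 * PowerSeries.constantCoeff f ^ 2) * bodyPoly q m ζ : ℂ[X])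
      : PowerSeries ℂ) = stepWronskian p f 1 := by
    rw [Polynomial.coe_mul, Polynomial.coe_C, ← hf.wronskian hpq hq, stepWronskian]
    simp
  induction j with
  | zero =>
    refine ⟨fun _ => 0, fun i hi => ?_⟩
    obtain rfl : i = 0 := by omega
    simp [hv0]
  | succ j ih =>
    rcases Nat.eq_zero_or_pos j with h0 | hj
    · subst h0
      refine ⟨fun i => if i = 0 then 0
        else Polynomial.C (2 * PowerSeries.constantCoeff f ^ 2) * bodyPoly q m ζ, fun i hi => ?_⟩
      rcases Nat.eq_zero_or_pos i with h | h
      · subst h; simp [hv0]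
      · obtain rfl : i = 1 := by omega
        refine ⟨?_, by simpa using hv1⟩
        simp only [one_ne_zero, if_false]
        exact (Polynomial.natDegree_C_mul_le _ _).trans (natDegree_bodyPoly hq0 m hζ).le
    · obtain ⟨W, hW⟩ := ih
      have hcoe : ∀ P Q : ℂ[X], (P : PowerSeries ℂ) = Q → P = Q := fun P Q h =>
        Polynomial.coe_injective ℂ h
      have hrec : ∀ i, 1 ≤ i → i < j →
          (tailPoly q m ζ).comp (Polynomial.C (p ^ i) * Polynomial.X) * W (i + 1)
            = (oddPoly τ).comp (Polynomial.C (p ^ i) * Polynomial.X) * W i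
              + (headPoly ζ).comp (Polynomial.C (p ^ i) * Polynomial.X) * W (i - 1) := by
        intro i hi hij
        apply hcoe
        simp only [Polynomial.coe_mul, Polynomial.coe_add, coe_comp_C_mul_X]
        rw [(hW (i + 1) (by omega)).2, (hW i (by omega)).2, (hW (i - 1) (by omega)).2]
        exact hf.stepWronskian_recursion hpq i hi
      have hW0 : W 0 = 0 := hcoe _ _ (by rw [(hW 0 (by omega)).2, hv0]; simp)
      have hW1 : W 1 = Polynomial.C (2 * PowerSeries.constantCoeff f ^ 2) * bodyPoly q m ζ :=
        hcoe _ _ (by rw [(hW 1 (by omega)).2, hv1])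
      obtain ⟨R, hR⟩ := tailPoly_comp_dvd hpq hinj hζ hS W hW0 (hW1 ▸ Dvd.intro_left _ rfl) j hj
        hrec
      refine ⟨Function.update W (j + 1) R, fun i hi => ?_⟩
      rcases Nat.lt_or_ge i (j + 1) with h | h
      · rw [Function.update_of_ne (by omega)]
        exact hW i (by omega)
      · obtain rfl : i = j + 1 := by omega
        rw [Function.update_self]
        have hA : (tailPoly q m ζ).comp (Polynomial.C (p ^ j) * Polynomial.X) ≠ 0 := by
          simp only [tailPoly, Polynomial.prod_comp, stringFactor_comp]
          exact Finset.prod_ne_zero_iff.mpr fun n _ => stringFactor_ne_zero _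
        have hlin : ∀ P : ℂ[X], (P.comp (Polynomial.C (p ^ j) * Polynomial.X)).natDegree
            = P.natDegree := by
          intro P
          rw [Polynomial.natDegree_comp, Polynomial.natDegree_C_mul_X _ (pow_ne_zero j hp0),
            mul_one]
        constructor
        · rcases eq_or_ne R 0 with h0 | h0
          · simp [h0]
          · have hodd : (oddPoly τ).natDegree ≤ 2 * N := by
              refine Polynomial.natDegree_mul_le.trans ?_
              rw [Polynomial.natDegree_comp, Polynomial.natDegree_X_pow, Polynomial.natDegree_X]
              omega
            have h1 := congrArg Polynomial.natDegree hR
            rw [Polynomial.natDegree_mul hA h0, hlin, natDegree_tailPoly hq0 m hζ] at h1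
            have h2 : ((oddPoly τ).comp (Polynomial.C (p ^ j) * Polynomial.X) * W j
              + (headPoly ζ).comp (Polynomial.C (p ^ j) * Polynomial.X) * W (j - 1)).natDegree
                ≤ 2 * N + 2 * ∑ n, m n := by
              refine Polynomial.natDegree_add_le_of_degree_le ?_ ?_
              · refine Polynomial.natDegree_mul_le.trans (add_le_add ?_ (hW j (by omega)).1)
                rw [hlin]; exact hodd
              · refine Polynomial.natDegree_mul_le.trans (add_le_add ?_ (hW (j - 1) (by omega)).1)
                rw [hlin]; exact natDegree_headPoly_le ζ
            omega
        · have hA' : PowerSeries.rescale (p ^ j) (tailPoly q m ζ : PowerSeries ℂ) ≠ 0 := by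
            rw [← coe_comp_C_mul_X]
            exact fun h => hA (hcoe _ _ (by rw [h]; simp))
          apply mul_left_cancel₀ hA'
          rw [hf.stepWronskian_recursion hpq j hj, ← (hW j (by omega)).2,
            ← (hW (j - 1) (by omega)).2]
          have h' := congrArg (fun P : ℂ[X] => (P : PowerSeries ℂ)) hR
          simp only [Polynomial.coe_mul, Polynomial.coe_add, coe_comp_C_mul_X] at h'
          exact h'.symm

/-- If all Wronskians `f f(-pʲX) - (-1)ʲ f(-X) f(pʲX)` have degree at most `2M`, then `f` is a
polynomial of degree at most `M`: for odd `j`, the coefficient of order `2k > 2M` is a fixed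
polynomial in `pʲ`, which vanishes for infinitely many values of `pʲ`, and its middle coefficient is
a nonzero multiple of the square of the `k`-th coefficient of `f`. -/
theorem coeff_eq_zero_of_stepWronskian (hpq : p * q = 1) (hq : ∀ n, 1 ≤ n → q ^ n ≠ 1)
    {f : PowerSeries ℂ} {M : ℕ}
    (h : ∀ j k, 2 * M < k → PowerSeries.coeff k (stepWronskian p f j) = 0) (k : ℕ) (hk : M < k) :
    PowerSeries.coeff k f = 0 := by
  have hp0 : p ≠ 0 := left_ne_zero_of_mul_eq_one hpq
  set G : ℂ[X] := ∑ ij ∈ Finset.HasAntidiagonal.antidiagonal (2 * k),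
    Polynomial.monomial ij.2 (((-1) ^ ij.2 + (-1) ^ ij.1)
      * (PowerSeries.coeff ij.1 f * PowerSeries.coeff ij.2 f)) with hG
  have hroot : ∀ i : ℕ, G.IsRoot (p ^ (2 * i + 1)) := by
    intro i
    have h1 := h (2 * i + 1) (2 * k) (by omega)
    rw [stepWronskian, Odd.neg_one_pow ⟨i, rfl⟩, neg_one_mul, sub_neg_eq_add, map_add,
      PowerSeries.coeff_mul, PowerSeries.coeff_mul, ← Finset.sum_add_distrib] at h1
    rw [Polynomial.IsRoot, hG, Polynomial.eval_finsetSum, ← h1]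
    refine Finset.sum_congr rfl fun ij _ => ?_
    simp only [PowerSeries.coeff_rescale, Polynomial.eval_monomial]
    rw [neg_pow]
    ring
  have hinj : Function.Injective fun i : ℕ => p ^ (2 * i + 1) := by
    have aux : ∀ i l : ℕ, i < l → p ^ (2 * i + 1) ≠ p ^ (2 * l + 1) := by
      intro i l hil heq
      refine hq (2 * l + 1 - (2 * i + 1)) (by omega) ?_
      have h2 : p ^ (2 * l + 1) = p ^ (2 * i + 1) * p ^ (2 * l + 1 - (2 * i + 1)) := by
        rw [← pow_add]; congr 1; omega
      rw [h2] at heq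
      have h3 : p ^ (2 * l + 1 - (2 * i + 1)) = 1 := by
        have := mul_left_cancel₀ (pow_ne_zero (2 * i + 1) hp0) ((mul_one _).trans heq)
        exact this.symm
      have h4 : (p * q) ^ (2 * l + 1 - (2 * i + 1)) = 1 := by rw [hpq, one_pow]
      rwa [mul_pow, h3, one_mul] at h4
    intro i l hil
    rcases lt_trichotomy i l with h1 | h1 | h1
    · exact absurd hil (aux i l h1)
    · exact h1
    · exact absurd hil.symm (aux l i h1)
  have hG0 : G = 0 := Polynomial.eq_zero_of_infinite_isRoot _
    ((Set.infinite_range_of_injective hinj).mono (by rintro _ ⟨i, rfl⟩; exact hroot i))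
  have hc : G.coeff k
      = ((-1) ^ k + (-1) ^ k) * (PowerSeries.coeff k f * PowerSeries.coeff k f) := by
    rw [hG, Polynomial.finsetSum_coeff, Finset.sum_eq_single (k, k)]
    · simp
    · rintro ⟨i, l⟩ hil hne
      rw [Finset.HasAntidiagonal.mem_antidiagonal] at hil
      rw [Polynomial.coeff_monomial, if_neg]
      intro h5
      simp only at hil h5
      exact hne (by ext <;> simp only <;> omega)
    · intro h5
      exact absurd (Finset.HasAntidiagonal.mem_antidiagonal.mpr (by simp only; omega)) h5
  rw [hG0, Polynomial.coeff_zero, ← two_mul] at hc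
  have h6 := mul_eq_zero.mp hc.symm
  rcases h6 with h6 | h6
  · exact absurd h6 (mul_ne_zero two_ne_zero (pow_ne_zero _ (by norm_num)))
  · exact mul_self_eq_zero.mp h6

theorem IsSolution.wronskian_polynomial (hpq : p * q = 1) (hq : ∀ n, 1 ≤ n → q ^ n ≠ 1) {P : ℂ[X]}
    (hP : IsSolution p q m ζ τ P) :
    P * P.comp (Polynomial.C (-p) * Polynomial.X)
        + P.comp (Polynomial.C (-1) * Polynomial.X) * P.comp (Polynomial.C p * Polynomial.X)
      = Polynomial.C (2 * P.coeff 0 ^ 2) * bodyPoly q m ζ := by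
  apply Polynomial.coe_injective ℂ
  have h := hP.wronskian hpq hq
  rw [constantCoeff_coe] at h
  simpa only [Polynomial.coe_mul, Polynomial.coe_add, coe_comp_C_mul_X, Polynomial.coe_C] using h

/-- Comparison of the leading coefficients in the Wronskian identity. -/
theorem IsSolution.coeff_sq (hpq : p * q = 1) (hq : ∀ n, 1 ≤ n → q ^ n ≠ 1) (hζ : ∀ n, ζ n ≠ 0)
    {P : ℂ[X]} (hP : IsSolution p q m ζ τ P) (hdeg : P.natDegree ≤ ∑ n, m n) :
    P.coeff (∑ n, m n) ^ 2 * p ^ (∑ n, m n)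
      = P.coeff 0 ^ 2 * ∏ n, ∏ h ∈ Finset.range (m n), (ζ n * q ^ (2 * h)) := by
  have hq0 : q ≠ 0 := right_ne_zero_of_mul_eq_one hpq
  set M := ∑ n, m n with hM
  have h := congrArg (fun R : ℂ[X] => R.coeff (M + M)) (hP.wronskian_polynomial hpq hq)
  have hlin : ∀ c : ℂ, (P.comp (Polynomial.C c * Polynomial.X)).natDegree ≤ M := by
    intro c
    refine Polynomial.natDegree_comp_le.trans ?_
    calc P.natDegree * (Polynomial.C c * Polynomial.X).natDegree ≤ P.natDegree * 1 :=
          Nat.mul_le_mul_left _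
            ((Polynomial.natDegree_C_mul_le _ _).trans Polynomial.natDegree_X_le)
      _ ≤ M := by omega
  simp only [Polynomial.coeff_add] at h
  rw [Polynomial.coeff_mul_add_eq_of_natDegree_le hdeg (hlin _),
    Polynomial.coeff_mul_add_eq_of_natDegree_le (hlin _) (hlin _), Polynomial.coeff_C_mul,
    Polynomial.comp_C_mul_X_coeff, Polynomial.comp_C_mul_X_coeff, Polynomial.comp_C_mul_X_coeff,
    show M + M = (bodyPoly q m ζ).natDegree by rw [natDegree_bodyPoly hq0 m hζ]; ring,
    Polynomial.coeff_natDegree, leadingCoeff_bodyPoly hq0 m hζ] at h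
  have hs : (∏ n, ∏ h ∈ Finset.range (m n), -(ζ n * q ^ (2 * h)))
      = (-1) ^ M * ∏ n, ∏ h ∈ Finset.range (m n), (ζ n * q ^ (2 * h)) := by
    rw [hM, ← Finset.prod_pow_eq_pow_sum, ← Finset.prod_mul_distrib]
    refine Finset.prod_congr rfl fun n _ => ?_
    rw [Finset.prod_neg, Finset.card_range]
  rw [hs, neg_pow p M] at h
  have hne : (2 : ℂ) * (-1) ^ M ≠ 0 := mul_ne_zero two_ne_zero (pow_ne_zero _ (by norm_num))
  apply mul_left_cancel₀ hne
  linear_combination h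

/-- If the difference equation is solvable on each string, then its formal solution is a polynomial:
all the Wronskians of the formal solution are polynomials of bounded degree. -/
theorem exists_polynomial_isSolution (hpq : p * q = 1) (hq : ∀ n, 1 ≤ n → q ^ n ≠ 1)
    (hinj : StringInjective q m ζ) (hζ : ∀ n, ζ n ≠ 0) (hτ : τ.natDegree ≤ N - 1) (hN : 1 ≤ N)
    (hS : StringSolvable p q m ζ τ) :
    ∃ P : ℂ[X], P.coeff 0 = 1 ∧ P.natDegree ≤ ∑ n, m n ∧ P.coeff (∑ n, m n) ≠ 0 ∧
      IsSolution p q m ζ τ P := by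
  have hq0 : q ≠ 0 := right_ne_zero_of_mul_eq_one hpq
  obtain ⟨f, hf0, hf⟩ := exists_qOp_eq_zero (A := (tailPoly q m ζ : PowerSeries ℂ))
    (B := (headPoly ζ : PowerSeries ℂ)) (S := (oddPoly τ : PowerSeries ℂ))
    (pow_ne_pow_of_mul_eq_one hpq hq) (by rw [constantCoeff_coe, coeff_zero_tailPoly])
    (by rw [constantCoeff_coe, coeff_zero_headPoly]) (by rw [constantCoeff_coe, coeff_zero_oddPoly])
  rw [← isSolution_iff_qOp] at hf
  set M := ∑ n, m n with hM
  have hlarge : ∀ k, M < k → PowerSeries.coeff k f = 0 := by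
    refine coeff_eq_zero_of_stepWronskian hpq hq fun j k hk => ?_
    obtain ⟨W, hW⟩ := hf.stepWronskian_polynomial hpq hq hinj hζ hτ hN hS j
    obtain ⟨h1, h2⟩ := hW j le_rfl
    rw [← h2, Polynomial.coeff_coe]
    exact Polynomial.coeff_eq_zero_of_natDegree_lt (by omega)
  set P : ℂ[X] := PowerSeries.trunc (M + 1) f with hP
  have hPf : (P : PowerSeries ℂ) = f := by
    ext k
    rw [Polynomial.coeff_coe, hP, PowerSeries.coeff_trunc]
    split_ifs with h
    · rfl
    · exact (hlarge k (by omega)).symm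
  have hdeg : P.natDegree ≤ M := by
    rw [Polynomial.natDegree_le_iff_coeff_eq_zero]
    intro k hk
    rw [hP, PowerSeries.coeff_trunc, if_neg (by omega)]
  have hP0 : P.coeff 0 = 1 := by
    rw [← constantCoeff_coe, hPf, hf0]
  rw [← hPf] at hf
  refine ⟨P, hP0, hdeg, ?_, hf⟩
  intro h0
  have h := hf.coeff_sq hpq hq hζ hdeg
  rw [h0, hP0] at h
  refine absurd h.symm ?_
  have : ∏ n, ∏ h ∈ Finset.range (m n), (ζ n * q ^ (2 * h)) ≠ 0 :=
    Finset.prod_ne_zero_iff.mpr fun n _ => Finset.prod_ne_zero_iff.mpr fun h _ =>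
      mul_ne_zero (hζ n) (pow_ne_zero _ hq0)
  simpa using this

end Main

end QDifference

/-! ### Exchange relations of the six-vertex R-matrix -/

namespace RTT

variable {𝒜 ℬ : Type*} [Ring 𝒜]

/-- The product `M₁ M'₂` of two operator-valued `2 × 2` matrices acting on the two factors of
`ℂ² ⊗ ℂ²`. -/
def kron (M M' : Matrix (Fin 2) (Fin 2) 𝒜) : Matrix (Fin 2 × Fin 2) (Fin 2 × Fin 2) 𝒜 :=
  Matrix.of fun i k => M i.1 k.1 * M' i.2 k.2

/-- The product `M'₂ M₁`, in which the operator entries are multiplied in the opposite order. -/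
def kronRev (M M' : Matrix (Fin 2) (Fin 2) 𝒜) : Matrix (Fin 2 × Fin 2) (Fin 2 × Fin 2) 𝒜 :=
  Matrix.of fun i k => M' i.2 k.2 * M i.1 k.1

theorem kron_mul {M M' L L' : Matrix (Fin 2) (Fin 2) 𝒜}
    (h : ∀ i j k l, Commute (L i j) (M' k l)) :
    kron (M * L) (M' * L') = kron M M' * kron L L' := by
  ext i k
  simp only [kron, Matrix.of_apply, Matrix.mul_apply, Fintype.sum_prod_type]
  rw [Finset.sum_mul_sum]
  refine Finset.sum_congr rfl fun a _ => Finset.sum_congr rfl fun b _ => ?_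
  rw [mul_assoc, ← mul_assoc (L a k.1), (h a k.1 i.2 b).eq]
  simp only [mul_assoc]

theorem kronRev_mul {M M' L L' : Matrix (Fin 2) (Fin 2) 𝒜}
    (h : ∀ i j k l, Commute (L' i j) (M k l)) :
    kronRev (M * L) (M' * L') = kronRev M M' * kronRev L L' := by
  ext i k
  simp only [kronRev, Matrix.of_apply, Matrix.mul_apply, Fintype.sum_prod_type]
  rw [Finset.sum_mul_sum, Finset.sum_comm]
  refine Finset.sum_congr rfl fun a _ => Finset.sum_congr rfl fun b _ => ?_
  rw [mul_assoc, ← mul_assoc (L' b k.2), (h b k.2 i.1 a).eq]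
  simp only [mul_assoc]

variable [Algebra ℂ 𝒜] [Ring ℬ] [Algebra ℂ ℬ]

/-- The trigonometric six-vertex `R`-matrix. -/
noncomputable def rMatrix (𝒜 : Type*) [Ring 𝒜] [Algebra ℂ 𝒜] (η u : ℂ) :
    Matrix (Fin 2 × Fin 2) (Fin 2 × Fin 2) 𝒜 :=
  Matrix.of fun i k => algebraMap ℂ 𝒜 <|
    if i = k then (if i.1 = i.2 then Complex.sinh (u + η) else Complex.sinh u)
    else if i = k.swap then Complex.sinh η else 0

/-- The antisymmetric tensor in `ℂ² ⊗ ℂ²`. -/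
def antisymm (𝒜 : Type*) [Ring 𝒜] : Fin 2 × Fin 2 → 𝒜 :=
  fun i => if i = (0, 1) then 1 else if i = (1, 0) then -1 else 0

/-- `T` satisfies the exchange relations of the trigonometric six-vertex `R`-matrix, and its quantum
determinant is the scalar function `δ`. -/
structure IsMonodromy (η : ℂ) (δ : ℂ → ℂ) (T : ℂ → Matrix (Fin 2) (Fin 2) 𝒜) : Prop where
  rtt : ∀ z w, rMatrix 𝒜 η (z - w) * kron (T z) (T w)
    = kronRev (T z) (T w) * rMatrix 𝒜 η (z - w)
  qdet : ∀ z, (kronRev (T (z - η)) (T z)).mulVec (antisymm 𝒜) = δ z • antisymm 𝒜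

theorem IsMonodromy.one (η : ℂ) :
    IsMonodromy η (fun _ => 1) (fun _ => (1 : Matrix (Fin 2) (Fin 2) 𝒜)) := by
  have h1 : kron (1 : Matrix (Fin 2) (Fin 2) 𝒜) 1 = 1 := by
    ext ⟨i, j⟩ ⟨k, l⟩
    fin_cases i <;> fin_cases j <;> fin_cases k <;> fin_cases l <;> simp [kron, Matrix.one_apply]
  have h2 : kronRev (1 : Matrix (Fin 2) (Fin 2) 𝒜) 1 = 1 := by
    ext ⟨i, j⟩ ⟨k, l⟩
    fin_cases i <;> fin_cases j <;> fin_cases k <;> fin_cases l <;> simp [kronRev, Matrix.one_apply]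
  constructor
  · intro z w; rw [h1, h2, mul_one, one_mul]
  · intro z; rw [h2, Matrix.one_mulVec, one_smul]

/-- The coproduct: the product of two monodromy matrices with mutually commuting entries is a
monodromy matrix. -/
theorem IsMonodromy.mul {η : ℂ} {δ δ' : ℂ → ℂ} {M L : ℂ → Matrix (Fin 2) (Fin 2) 𝒜}
    (hM : IsMonodromy η δ M) (hL : IsMonodromy η δ' L)
    (h : ∀ z w i j k l, Commute (L z i j) (M w k l)) :
    IsMonodromy η (fun z => δ z * δ' z) (fun z => M z * L z) := by
  constructor
  · intro z w
    rw [kron_mul (h z w), kronRev_mul (h w z), ← mul_assoc, hM.rtt, mul_assoc, hL.rtt, mul_assoc]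
  · intro z
    rw [kronRev_mul (h z (z - η)), ← Matrix.mulVec_mulVec, hL.qdet, Matrix.mulVec_smul, hM.qdet,
      smul_smul, mul_comm]

theorem IsMonodromy.map {η : ℂ} {δ : ℂ → ℂ} {T : ℂ → Matrix (Fin 2) (Fin 2) 𝒜}
    (hT : IsMonodromy η δ T) (φ : 𝒜 →ₐ[ℂ] ℬ) :
    IsMonodromy η δ (fun z => (T z).map φ) := by
  have h1 : ∀ M M' : Matrix (Fin 2) (Fin 2) 𝒜, kron (M.map φ) (M'.map φ) = (kron M M').map φ := by
    intro M M'; ext; simp [kron]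
  have h2 : ∀ M M' : Matrix (Fin 2) (Fin 2) 𝒜,
      kronRev (M.map φ) (M'.map φ) = (kronRev M M').map φ := by
    intro M M'; ext; simp [kronRev]
  have h3 : ∀ u, rMatrix ℬ η u = (rMatrix 𝒜 η u).map φ := by
    intro u; ext; simp [rMatrix]
  have h4 : antisymm ℬ = φ ∘ antisymm 𝒜 := by
    ext i; simp only [antisymm, Function.comp]; split_ifs <;> simp
  constructor
  · intro z w
    rw [h1, h2, h3, ← Matrix.map_mul, ← Matrix.map_mul, hT.rtt]
  · intro z
    have h := congrArg (fun v : Fin 2 × Fin 2 → 𝒜 => φ ∘ v) (hT.qdet z)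
    rw [h2, h4]
    ext i
    have hi := congrFun h i
    simp only [Function.comp, Pi.smul_apply, map_smul] at hi ⊢
    rw [← hi]
    simp [Matrix.mulVec, dotProduct]

theorem IsMonodromy.shift {η : ℂ} {δ : ℂ → ℂ} {T : ℂ → Matrix (Fin 2) (Fin 2) 𝒜}
    (hT : IsMonodromy η δ T) (ξ : ℂ) :
    IsMonodromy η (fun z => δ (z - ξ)) (fun z => T (z - ξ)) := by
  constructor
  · intro z w
    have := hT.rtt (z - ξ) (w - ξ)
    rwa [sub_sub_sub_cancel_right] at this
  · intro z
    have := hT.qdet (z - ξ)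
    rwa [sub_right_comm] at this

section Relations

variable {η : ℂ} {δ : ℂ → ℂ} {T : ℂ → Matrix (Fin 2) (Fin 2) 𝒜}

theorem IsMonodromy.qdet_eq (hT : IsMonodromy η δ T) (z : ℂ) :
    T z 1 1 * T (z - η) 0 0 - T z 1 0 * T (z - η) 0 1 = algebraMap ℂ 𝒜 (δ z) := by
  have h := congrFun (hT.qdet z) (0, 1)
  simpa [Matrix.mulVec, dotProduct, Fintype.sum_prod_type, kronRev, antisymm,
    Algebra.algebraMap_eq_smul_one, sub_eq_add_neg] using h

theorem IsMonodromy.C_mul_C (hT : IsMonodromy η δ T) (z w : ℂ) :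
    Complex.sinh (z - w + η) • (T z 1 0 * T w 1 0)
      = Complex.sinh (z - w + η) • (T w 1 0 * T z 1 0) := by
  have h := congrFun (congrFun (hT.rtt z w) (1, 1)) (0, 0)
  simpa [Matrix.mul_apply, Fintype.sum_prod_type, kron, kronRev, rMatrix, Algebra.smul_def,
    Algebra.commutes] using h

theorem IsMonodromy.C_mul_D (hT : IsMonodromy η δ T) (z w : ℂ) :
    Complex.sinh (w - z + η) • (T w 1 1 * T z 1 0)
      = Complex.sinh (w - z) • (T z 1 0 * T w 1 1) + Complex.sinh η • (T z 1 1 * T w 1 0) := by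
  have h := congrFun (congrFun (hT.rtt w z) (1, 1)) (1, 0)
  simpa [Matrix.mul_apply, Fintype.sum_prod_type, kron, kronRev, rMatrix, Algebra.smul_def,
    Algebra.commutes, add_comm] using h

theorem IsMonodromy.B_mul_D (hT : IsMonodromy η δ T) (z w : ℂ) :
    Complex.sinh (z - w) • (T z 0 1 * T w 1 1) + Complex.sinh η • (T z 1 1 * T w 0 1)
      = Complex.sinh (z - w + η) • (T w 1 1 * T z 0 1) := by
  have h := congrFun (congrFun (hT.rtt z w) (0, 1)) (1, 1)
  simpa [Matrix.mul_apply, Fintype.sum_prod_type, kron, kronRev, rMatrix, Algebra.smul_def,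
    Algebra.commutes, add_comm] using h

end Relations

end RTT

namespace XXZChain

variable {N : ℕ}

theorem atSite_one (X : XXZChain N) (n : Fin N) : X.atSite n 1 = 1 := by
  ext h h'
  simp only [atSite, Matrix.of_apply, Matrix.one_apply]
  by_cases heq : h = h'
  · subst heq; simp
  · rw [if_neg heq]
    split_ifs with h1 h2
    · exact absurd (funext fun l => if hl : l = n then hl ▸ h2 else h1 l hl) heq
    · rfl
    · rfl

theorem atSite_add (X : XXZChain N) (n : Fin N) (A B : Matrix (X.Loc n) (X.Loc n) ℂ) :
    X.atSite n (A + B) = X.atSite n A + X.atSite n B := by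
  ext h h'
  simp only [atSite, Matrix.of_apply, Matrix.add_apply]
  split_ifs <;> simp

theorem atSite_smul (X : XXZChain N) (n : Fin N) (c : ℂ) (A : Matrix (X.Loc n) (X.Loc n) ℂ) :
    X.atSite n (c • A) = c • X.atSite n A := by
  ext h h'
  simp only [atSite, Matrix.of_apply, Matrix.smul_apply]
  split_ifs <;> simp

theorem atSite_mul (X : XXZChain N) (n : Fin N) (A B : Matrix (X.Loc n) (X.Loc n) ℂ) :
    X.atSite n (A * B) = X.atSite n A * X.atSite n B := by
  ext h h''
  rw [Matrix.mul_apply, ← Fintype.sum_of_injective (fun k : X.Loc n => Function.update h n k)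
    (Function.update_injective h n)
    (fun k => X.atSite n A h (Function.update h n k) * X.atSite n B (Function.update h n k) h'')
    _ _ (fun _ => rfl)]
  · simp only [atSite, Matrix.of_apply, Function.update_self]
    have h1 : ∀ k : X.Loc n, (∀ l, l ≠ n → h l = Function.update h n k l) := by
      intro k l hl; rw [Function.update_of_ne hl]
    have h2 : ∀ k : X.Loc n, (∀ l, l ≠ n → Function.update h n k l = h'' l)
        ↔ ∀ l, l ≠ n → h l = h'' l := by
      intro k
      refine forall₂_congr fun l hl => ?_
      rw [Function.update_of_ne hl]
    simp only [h2, if_pos (h1 _)]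
    split_ifs with h3
    · rw [Matrix.mul_apply]
    · simp
  · intro h' hh'
    simp only [atSite, Matrix.of_apply]
    rw [if_neg, zero_mul]
    intro h1
    exact hh' ⟨h' n, funext fun l => by
      by_cases hl : l = n
      · subst hl; simp
      · simp [Function.update_of_ne hl, h1 l hl]⟩

theorem atSite_mul_atSite_apply (X : XXZChain N) {n m : Fin N} (hnm : n ≠ m)
    (A : Matrix (X.Loc n) (X.Loc n) ℂ) (B : Matrix (X.Loc m) (X.Loc m) ℂ) (h h'' : X.Conf) :
    (X.atSite n A * X.atSite m B) h h''
      = if ∀ l, l ≠ n → l ≠ m → h l = h'' l then A (h n) (h'' n) * B (h m) (h'' m) else 0 := by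
  rw [Matrix.mul_apply, Finset.sum_eq_single (Function.update h n (h'' n))]
  · simp only [atSite, Matrix.of_apply, Function.update_self]
    rw [if_pos (fun l hl => by rw [Function.update_of_ne hl]), Function.update_of_ne hnm.symm]
    have h2 : (∀ l, l ≠ m → Function.update h n (h'' n) l = h'' l)
        ↔ ∀ l, l ≠ n → l ≠ m → h l = h'' l := by
      constructor
      · intro h1 l hl hm
        rw [← h1 l hm, Function.update_of_ne hl]
      · intro h1 l hm
        by_cases hl : l = n
        · subst hl; simp
        · rw [Function.update_of_ne hl, h1 l hl hm]
    simp only [h2]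
    split_ifs <;> simp
  · intro h' _ hne
    simp only [atSite, Matrix.of_apply]
    by_contra h0
    apply hne
    have h1 : ∀ l, l ≠ n → h l = h' l := by
      by_contra h1; rw [if_neg h1, zero_mul] at h0; exact h0 rfl
    have h2 : ∀ l, l ≠ m → h' l = h'' l := by
      by_contra h2; rw [if_neg h2, mul_zero] at h0; exact h0 rfl
    ext l
    by_cases hl : l = n
    · subst hl; simp [h2 l hnm]
    · simp [Function.update_of_ne hl, h1 l hl]
  · intro h1; exact absurd (Finset.mem_univ _) h1

theorem commute_atSite (X : XXZChain N) {n m : Fin N} (hnm : n ≠ m)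
    (A : Matrix (X.Loc n) (X.Loc n) ℂ) (B : Matrix (X.Loc m) (X.Loc m) ℂ) :
    Commute (X.atSite n A) (X.atSite m B) := by
  ext h h''
  rw [atSite_mul_atSite_apply X hnm, atSite_mul_atSite_apply X hnm.symm, mul_comm]
  refine if_congr ?_ rfl rfl
  exact ⟨fun h l h1 h2 => h l h2 h1, fun h l h1 h2 => h l h2 h1⟩

/-- The embedding of the operators at a site as an algebra homomorphism. -/
noncomputable def atSiteHom (X : XXZChain N) (n : Fin N) :
    Matrix (X.Loc n) (X.Loc n) ℂ →ₐ[ℂ] X.Op :=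
  AlgHom.ofLinearMap
    { toFun := X.atSite n
      map_add' := X.atSite_add n
      map_smul' := X.atSite_smul n } (X.atSite_one n) (X.atSite_mul n)

section Local

variable (X : XXZChain N) (n : Fin N)

theorem locSz_mul (f g : ℂ → ℂ) : X.locSz n f * X.locSz n g = X.locSz n (fun s => f s * g s) := by
  simp [locSz, Matrix.diagonal_mul_diagonal]

theorem locSz_add (f g : ℂ → ℂ) : X.locSz n f + X.locSz n g = X.locSz n (fun s => f s + g s) := by
  simp [locSz, Matrix.diagonal_add]

theorem locSz_smul (c : ℂ) (f : ℂ → ℂ) : c • X.locSz n f = X.locSz n (fun s => c * f s) := by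
  ext i j
  simp only [locSz, Matrix.smul_apply, Matrix.diagonal_apply, smul_eq_mul]
  split_ifs <;> simp

theorem locSminus_mul_locSz (f : ℂ → ℂ) :
    X.locSminus n * X.locSz n f = X.locSz n (fun s => f (s + 1)) * X.locSminus n := by
  ext i j
  simp only [locSz, Matrix.mul_diagonal, Matrix.diagonal_mul, locSminus, Matrix.of_apply]
  split_ifs with h
  · rw [h, mul_comm]; congr 2; push_cast; ring
  · simp

theorem locSplus_mul_locSz (f : ℂ → ℂ) :
    X.locSplus n * X.locSz n f = X.locSz n (fun s => f (s - 1)) * X.locSplus n := by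
  ext i j
  simp only [locSz, Matrix.mul_diagonal, Matrix.diagonal_mul, locSplus, Matrix.of_apply]
  split_ifs with h
  · rw [h, mul_comm]; congr 2; push_cast; ring
  · simp

theorem xCoef_mul_self (k : ℕ) :
    X.xCoef n k * X.xCoef n k = X.qInt k * X.qInt (X.twoS n + 1 - k) := by
  rw [xCoef, ← pow_two, one_div]
  exact_mod_cast Complex.cpow_nat_inv_pow _ (n := 2) two_ne_zero

/-- `S⁻ S⁺`, multiplied by `sinh² η`, as a function of `S^z`. -/
theorem sinh_smul_locSminus_mul_locSplus (hη : Complex.sinh X.η ≠ 0) :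
    (Complex.sinh X.η * Complex.sinh X.η) • (X.locSminus n * X.locSplus n)
      = X.locSz n (fun s => Complex.sinh (X.η * (X.spin n - s))
          * Complex.sinh (X.η * (X.spin n + 1 + s))) := by
  ext i j
  rw [Matrix.smul_apply, Matrix.mul_apply, locSz, Matrix.diagonal_apply]
  have hterm : ∀ l, X.locSminus n i l * X.locSplus n l j
      = if (i : ℕ) = l + 1 ∧ i = j then X.xCoef n i * X.xCoef n i else 0 := by
    intro l
    simp only [locSminus, locSplus, Matrix.of_apply]
    by_cases h1 : (i : ℕ) = l + 1
    · by_cases h2 : i = j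
      · subst h2; simp [h1]
      · have h3 : (j : ℕ) ≠ l + 1 := fun h => h2 (Fin.ext (h1.trans h.symm))
        simp [h2, h3]
    · simp [h1]
  simp only [hterm]
  by_cases hij : i = j
  · subst hij
    rw [if_pos rfl]
    rcases Nat.eq_zero_or_pos (i : ℕ) with h0 | h0
    · rw [h0]; simp
    · rw [Finset.sum_eq_single ⟨(i : ℕ) - 1, by omega⟩]
      · rw [if_pos ⟨by simp only; omega, rfl⟩, xCoef_mul_self, qInt, qInt,
          Nat.cast_sub (by omega), spin, smul_eq_mul]
        field_simp
        rw [show X.η * (X.twoS n - (X.twoS n - ((i : ℕ) : ℂ) * 2)) / 2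
            = X.η * ((i : ℕ) : ℂ) by ring,
          show X.η * (X.twoS n + 2 + (X.twoS n - ((i : ℕ) : ℂ) * 2)) / 2
            = X.η * ((X.twoS n + 1 : ℕ) - ((i : ℕ) : ℂ)) by push_cast; ring]
      · intro l _ hl
        rw [if_neg]
        rintro ⟨h1, -⟩
        exact hl (Fin.ext (by simp only; omega))
      · intro h1; exact absurd (Finset.mem_univ _) h1
  · simp [hij]

theorem sinh_smul_locSplus_mul_locSminus (hη : Complex.sinh X.η ≠ 0) :
    (Complex.sinh X.η * Complex.sinh X.η) • (X.locSplus n * X.locSminus n)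
      = X.locSz n (fun s => Complex.sinh (X.η * (X.spin n - s + 1))
          * Complex.sinh (X.η * (X.spin n + s))) := by
  ext i j
  rw [Matrix.smul_apply, Matrix.mul_apply, locSz, Matrix.diagonal_apply]
  have hterm : ∀ l, X.locSplus n i l * X.locSminus n l j
      = if (l : ℕ) = i + 1 ∧ i = j then X.xCoef n l * X.xCoef n l else 0 := by
    intro l
    simp only [locSminus, locSplus, Matrix.of_apply]
    by_cases h1 : (l : ℕ) = i + 1
    · by_cases h2 : i = j
      · subst h2; simp [h1]
      · have h3 : (i : ℕ) ≠ j := fun h => h2 (Fin.ext h)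
        simp [h2, h1, h3]
    · simp [h1]
  simp only [hterm]
  by_cases hij : i = j
  · subst hij
    rw [if_pos rfl]
    rcases Nat.lt_or_ge (i : ℕ) (X.twoS n) with h0 | h0
    · rw [Finset.sum_eq_single ⟨(i : ℕ) + 1, by omega⟩]
      · rw [if_pos ⟨rfl, rfl⟩, xCoef_mul_self, qInt, qInt,
          Nat.cast_sub (by simp only; omega), spin, smul_eq_mul]
        field_simp
        rw [show X.η * (X.twoS n - (X.twoS n - 2 * ((i : ℕ) : ℂ)) + 2) / 2
            = X.η * ((i + 1 : ℕ) : ℂ) by push_cast; ring,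
          show X.η * (X.twoS n + (X.twoS n - 2 * ((i : ℕ) : ℂ))) / 2
            = X.η * ((X.twoS n + 1 : ℕ) - ((i + 1 : ℕ) : ℂ)) by push_cast; ring]
      · intro l _ hl
        rw [if_neg]
        rintro ⟨h1, -⟩
        exact hl (Fin.ext h1)
      · intro h1; exact absurd (Finset.mem_univ _) h1
    · have h1 : (i : ℕ) = X.twoS n := by omega
      rw [Finset.sum_eq_zero, h1, spin]
      · rw [show X.η * ((X.twoS n : ℂ) / 2 + (X.twoS n / 2 - X.twoS n)) = 0 by ring]
        simp
      · intro l _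
        rw [if_neg]
        rintro ⟨h2, -⟩
        omega
  · simp [hij]

end Local

end XXZChain

/-! ### The Lax operator -/

namespace XXZChain

variable {N : ℕ} (X : XXZChain N)

theorem locSz_neg (n : Fin N) (f : ℂ → ℂ) : -X.locSz n f = X.locSz n (fun s => -f s) := by
  ext i j
  simp only [locSz, Matrix.neg_apply, Matrix.diagonal_apply]
  split_ifs <;> simp

theorem locSz_one (n : Fin N) : X.locSz n (fun _ => 1) = 1 := by
  simp [locSz]

/-- The Lax operator at a site, with entries acting on the local space only. -/
noncomputable def localLax (n : Fin N) (z : ℂ) :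
    Matrix (Fin 2) (Fin 2) (Matrix (X.Loc n) (X.Loc n) ℂ) :=
  !![X.locSz n fun s => Complex.sinh (z + X.η * s), Complex.sinh X.η • X.locSminus n;
     Complex.sinh X.η • X.locSplus n, X.locSz n fun s => Complex.sinh (z - X.η * s)]

/-- The local Lax operator satisfies the exchange relations. Each of the sixteen relations becomes
an addition formula for hyperbolic sines once the operators `S^z` are moved to the left. -/
theorem isMonodromy_localLax (n : Fin N) (hη : Complex.sinh X.η ≠ 0) :
    RTT.IsMonodromy X.η (fun z => Complex.sinh (z + X.spin n * X.η)
      * Complex.sinh (z - X.η - X.spin n * X.η)) (X.localLax n) := by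
  have e1 : ∀ c : ℂ, (c * Complex.sinh X.η * Complex.sinh X.η) • (X.locSminus n * X.locSplus n)
      = X.locSz n (fun s => c * (Complex.sinh (X.η * (X.spin n - s))
          * Complex.sinh (X.η * (X.spin n + 1 + s)))) := by
    intro c
    rw [mul_assoc, mul_smul, X.sinh_smul_locSminus_mul_locSplus n hη, locSz_smul]
  have e2 : ∀ c : ℂ, (c * Complex.sinh X.η * Complex.sinh X.η) • (X.locSplus n * X.locSminus n)
      = X.locSz n (fun s => c * (Complex.sinh (X.η * (X.spin n - s + 1))
          * Complex.sinh (X.η * (X.spin n + s)))) := by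
    intro c
    rw [mul_assoc, mul_smul, X.sinh_smul_locSplus_mul_locSminus n hη, locSz_smul]
  constructor
  · intro z w
    ext1 ⟨i, j⟩ ⟨k, l⟩
    fin_cases i <;> fin_cases j <;> fin_cases k <;> fin_cases l <;>
    simp [Matrix.mul_apply, Fintype.sum_prod_type, RTT.kron, RTT.kronRev, RTT.rMatrix,
      ← Algebra.smul_def, ← Algebra.commutes, localLax, smul_smul, locSz_mul,
      locSminus_mul_locSz, locSplus_mul_locSz] <;>
    simp only [e1, e2, ← smul_mul_assoc, locSz_smul, ← add_mul, locSz_add] <;>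
    first
    | refine congrArg (X.locSz n) (funext fun s => ?_)
    | refine congrArg (· * X.locSminus n) (congrArg (X.locSz n) (funext fun s => ?_))
    | refine congrArg (· * X.locSplus n) (congrArg (X.locSz n) (funext fun s => ?_))
    all_goals
      simp only [Complex.sinh, mul_add, neg_add, mul_one, sub_eq_add_neg, neg_neg,
        mul_neg, Complex.exp_add, Complex.exp_neg]
      field_simp <;> ring
  · intro z
    ext1 ⟨i, j⟩
    have e1' := X.sinh_smul_locSminus_mul_locSplus n hη
    have e2' := X.sinh_smul_locSplus_mul_locSminus n hη
    fin_cases i <;> fin_cases j <;>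
    simp [Matrix.mulVec, dotProduct, Fintype.sum_prod_type, RTT.kronRev, RTT.antisymm,
       localLax, smul_smul, locSz_mul, locSminus_mul_locSz, locSplus_mul_locSz, e1', e2'] <;>
    simp only [add_neg_eq_zero, ← X.locSz_one n, ← smul_mul_assoc, locSz_smul, locSz_neg,
      locSz_add] <;>
    first
    | refine congrArg (X.locSz n) (funext fun s => ?_)
    | refine congrArg (· * X.locSminus n) (congrArg (X.locSz n) (funext fun s => ?_))
    | refine congrArg (· * X.locSplus n) (congrArg (X.locSz n) (funext fun s => ?_))
    all_goals
      simp only [Complex.sinh, mul_add, neg_add, mul_one, sub_eq_add_neg, neg_neg,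
        mul_neg, Complex.exp_add, Complex.exp_neg]
      field_simp <;> ring

end XXZChain

/-! ### Trigonometric polynomials and the entries of the monodromy matrix -/

/-- `g(z) = e^{-Kz} p(e^{2z})` for a polynomial `p` of degree at most `K`: the trigonometric
polynomials of degree at most `K` that are multiplied by `(-1)^K` under `z ↦ z + iπ`. -/
def TrigPoly (K : ℕ) (g : ℂ → ℂ) : Prop :=
  ∃ p : ℂ[X], p.natDegree ≤ K ∧ ∀ z, g z = Complex.exp (-K * z) * p.eval (Complex.exp (2 * z))

namespace TrigPoly

theorem zero (K : ℕ) : TrigPoly K (fun _ => 0) := ⟨0, by simp, by simp⟩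

theorem const (c : ℂ) : TrigPoly 0 (fun _ => c) := ⟨Polynomial.C c, by simp, by simp⟩

theorem add {K : ℕ} {f g : ℂ → ℂ} (hf : TrigPoly K f) (hg : TrigPoly K g) :
    TrigPoly K (fun z => f z + g z) := by
  obtain ⟨p, hp, hp'⟩ := hf
  obtain ⟨r, hr, hr'⟩ := hg
  refine ⟨p + r, Polynomial.natDegree_add_le_of_degree_le hp hr, fun z => ?_⟩
  simp only [hp', hr', Polynomial.eval_add]; ring

theorem mul {K L : ℕ} {f g : ℂ → ℂ} (hf : TrigPoly K f) (hg : TrigPoly L g) :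
    TrigPoly (K + L) (fun z => f z * g z) := by
  obtain ⟨p, hp, hp'⟩ := hf
  obtain ⟨r, hr, hr'⟩ := hg
  refine ⟨p * r, Polynomial.natDegree_mul_le.trans (add_le_add hp hr), fun z => ?_⟩
  simp only [hp', hr', Polynomial.eval_mul, Nat.cast_add, neg_add, add_mul, Complex.exp_add]; ring

theorem const_mul {K : ℕ} {f : ℂ → ℂ} (c : ℂ) (hf : TrigPoly K f) :
    TrigPoly K (fun z => c * f z) := by
  simpa using (const c).mul hf

theorem add_two {K : ℕ} {f : ℂ → ℂ} (hf : TrigPoly K f) : TrigPoly (K + 2) f := by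
  obtain ⟨p, hp, hp'⟩ := hf
  refine ⟨Polynomial.X * p, Polynomial.natDegree_mul_le.trans ?_, fun z => ?_⟩
  · rw [Polynomial.natDegree_X]; omega
  · rw [hp', Polynomial.eval_mul, Polynomial.eval_X, ← mul_assoc, ← Complex.exp_add]
    congr 2; push_cast; ring

theorem sum {K : ℕ} {ι : Type*} (s : Finset ι) {f : ι → ℂ → ℂ} (hf : ∀ i, TrigPoly K (f i)) :
    TrigPoly K (fun z => ∑ i ∈ s, f i z) := by
  classical
  induction s using Finset.induction_on with
  | empty => simpa using zero K
  | insert a s ha ih =>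
    simp only [Finset.sum_insert ha]
    exact (hf a).add ih

theorem sinh_sub (c : ℂ) : TrigPoly 1 (fun z => Complex.sinh (z - c)) := by
  refine ⟨Polynomial.C (Complex.exp (-c) / 2) * Polynomial.X - Polynomial.C (Complex.exp c / 2),
    by compute_degree, fun z => ?_⟩
  simp only [Complex.sinh, Polynomial.eval_sub, Polynomial.eval_mul, Polynomial.eval_C,
    Polynomial.eval_X]
  rw [mul_sub, mul_comm (Complex.exp (-c) / 2), ← mul_assoc, ← Complex.exp_add, ← mul_div_assoc,
    ← Complex.exp_add, ← mul_div_assoc, ← Complex.exp_add, ← sub_div]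
  congr 3 <;> push_cast <;> ring

theorem differentiable {K : ℕ} {f : ℂ → ℂ} (hf : TrigPoly K f) : Differentiable ℂ f := by
  obtain ⟨p, -, hp⟩ := hf
  have : f = fun z => Complex.exp (-K * z) * p.eval (Complex.exp (2 * z)) := funext hp
  rw [this]
  have h1 : Differentiable ℂ fun z : ℂ => Complex.exp (2 * z) := by fun_prop
  have h2 : Differentiable ℂ fun z : ℂ => Complex.exp (-K * z) := by fun_prop
  exact h2.mul (p.differentiable.comp h1)

theorem add_pi {K : ℕ} {f : ℂ → ℂ} (hf : TrigPoly K f) (z : ℂ) :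
    f (z + Complex.I * Real.pi) = (-1) ^ K * f z := by
  obtain ⟨p, -, hp⟩ := hf
  rw [hp, hp, mul_add (2 : ℂ), Complex.exp_add,
    show (2 : ℂ) * (Complex.I * Real.pi) = 2 * Real.pi * Complex.I by ring,
    Complex.exp_two_pi_mul_I, mul_one, mul_add, Complex.exp_add,
    show -(K : ℂ) * (Complex.I * Real.pi) = K * -(Real.pi * Complex.I) by ring, Complex.exp_nat_mul,
    Complex.exp_neg, Complex.exp_pi_mul_I]
  norm_num
  ring

theorem eq_of_eq_on {K : ℕ} {f g : ℂ → ℂ} (hf : TrigPoly K f) (hg : TrigPoly K g)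
    {ι : Type*} [Fintype ι] (hK : K < Fintype.card ι) (x : ι → ℂ)
    (hx : Function.Injective fun i => Complex.exp (2 * x i))
    (h : ∀ i, f (x i) = g (x i)) (z : ℂ) : f z = g z := by
  obtain ⟨p, hp, hp'⟩ := hf
  obtain ⟨r, hr, hr'⟩ := hg
  have hpr : p = r := by
    rw [← sub_eq_zero]
    refine Polynomial.eq_zero_of_natDegree_lt_card_of_eval_eq_zero (p - r) hx ?_ ?_
    · intro i
      have := h i
      rw [hp', hr'] at this
      rw [Polynomial.eval_sub, sub_eq_zero]
      exact mul_left_cancel₀ (Complex.exp_ne_zero _) this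
    · exact ((Polynomial.natDegree_sub_le_of_le hp hr).trans (max_self K).le).trans_lt hK
  rw [hp', hr', hpr]

end TrigPoly

namespace XXZChain

variable {N : ℕ} (X : XXZChain N)

theorem lax_apply (n : Fin N) (z : ℂ) (i j : Fin 2) :
    X.lax n z i j = X.atSite n (X.localLax n z i j) := by
  fin_cases i <;> fin_cases j <;> rfl

theorem isMonodromy_lax (n : Fin N) (hη : Complex.sinh X.η ≠ 0) :
    RTT.IsMonodromy X.η (fun z => Complex.sinh (z + X.spin n * X.η)
      * Complex.sinh (z - X.η - X.spin n * X.η)) (X.lax n) := by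
  have h := (X.isMonodromy_localLax n hη).map (X.atSiteHom n)
  have : (fun z => (X.localLax n z).map (X.atSiteHom n)) = X.lax n := by
    funext z; ext1 i j; exact (X.lax_apply n z i j).symm
  rwa [this] at h

/-- The ordered product of the Lax operators of the sites in a list. -/
noncomputable def listMonodromy (l : List (Fin N)) (z : ℂ) : Matrix (Fin 2) (Fin 2) X.Op :=
  (l.map fun n => X.lax n (z - X.ξ n)).prod

theorem listMonodromy_cons (n : Fin N) (l : List (Fin N)) (z : ℂ) :
    X.listMonodromy (n :: l) z = X.lax n (z - X.ξ n) * X.listMonodromy l z := by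
  simp [listMonodromy]

theorem monodromy_eq_listMonodromy (z : ℂ) :
    X.monodromy z = X.listMonodromy (List.finRange N).reverse z := by
  rw [monodromy, listMonodromy, List.ofFn_eq_map, List.map_reverse]

theorem commute_atSite_listMonodromy {l : List (Fin N)} {n : Fin N} (hn : n ∉ l)
    (A : Matrix (X.Loc n) (X.Loc n) ℂ) (z : ℂ) (i j : Fin 2) :
    Commute (X.atSite n A) (X.listMonodromy l z i j) := by
  induction l generalizing i j with
  | nil =>
    simp only [listMonodromy, List.map_nil, List.prod_nil, Matrix.one_apply]
    split_ifs
    · exact Commute.one_right _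
    · exact Commute.zero_right _
  | cons m l ih =>
    rw [List.mem_cons, not_or] at hn
    rw [listMonodromy_cons, Matrix.mul_apply]
    refine Commute.sum_right _ _ _ fun k _ => Commute.mul_right ?_ (ih hn.2 k j)
    rw [lax_apply]
    exact X.commute_atSite hn.1 _ _

theorem isMonodromy_listMonodromy {l : List (Fin N)} (hl : l.Nodup) (hη : Complex.sinh X.η ≠ 0) :
    RTT.IsMonodromy X.η (fun z => (l.map fun n => Complex.sinh (z - X.ξ n + X.spin n * X.η)
      * Complex.sinh (z - X.ξ n - X.η - X.spin n * X.η)).prod) (X.listMonodromy l) := by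
  induction l with
  | nil =>
    have e : X.listMonodromy [] = fun _ => 1 := by funext z; simp [listMonodromy]
    rw [e]
    simpa using RTT.IsMonodromy.one (𝒜 := X.Op) X.η
  | cons n l ih =>
    rw [List.nodup_cons] at hl
    have h := ((X.isMonodromy_lax n hη).shift (X.ξ n)).mul (ih hl.2) ?_
    · have e : X.listMonodromy (n :: l)
          = fun z => X.lax n (z - X.ξ n) * X.listMonodromy l z :=
        funext fun z => X.listMonodromy_cons n l z
      rw [e]
      simpa only [List.map_cons, List.prod_cons] using h
    · intro z w i j k l'
      rw [lax_apply]
      exact (X.commute_atSite_listMonodromy hl.1 _ _ _ _).symm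

theorem isMonodromy_monodromy (hη : Complex.sinh X.η ≠ 0) :
    RTT.IsMonodromy X.η (fun z => X.a z * X.d (z - X.η)) X.monodromy := by
  have h := X.isMonodromy_listMonodromy (l := (List.finRange N).reverse)
    (List.nodup_reverse.mpr (List.nodup_finRange N)) hη
  have e : X.monodromy = X.listMonodromy (List.finRange N).reverse :=
    funext X.monodromy_eq_listMonodromy
  rw [e]
  convert h using 2 with z
  rw [List.map_reverse, List.prod_reverse, ← List.ofFn_eq_map, List.prod_ofFn, a, d,
    ← Finset.prod_mul_distrib]
  refine Finset.prod_congr rfl fun n _ => ?_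
  rw [sub_right_comm z X.η]

/-- The reference row vector, dual to the basis state with `k = 0` at every site. -/
def refCov : X.Conf → ℂ := Pi.single 0 1

theorem refCov_ne_zero : X.refCov ≠ 0 := by
  intro h
  have := congrFun h 0
  simp [refCov] at this

theorem refCov_vecMul_atSite (n : Fin N) (A : Matrix (X.Loc n) (X.Loc n) ℂ)
    (hA : ∀ j, j ≠ 0 → A 0 j = 0) :
    Matrix.vecMul X.refCov (X.atSite n A) = A 0 0 • X.refCov := by
  ext h
  rw [refCov, Matrix.single_one_vecMul]
  simp only [Matrix.row_apply, atSite, Matrix.of_apply, Pi.zero_apply, Pi.smul_apply, smul_eq_mul,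
    Pi.single_apply]
  by_cases h0 : h = 0
  · subst h0; simp
  · rw [if_neg h0, mul_zero]
    split_ifs with h1
    · apply hA
      intro h2
      apply h0
      ext1 l
      by_cases hl : l = n
      · subst hl; exact h2
      · exact (h1 l hl).symm
    · rfl

theorem refCov_listMonodromy {l : List (Fin N)} (hl : l.Nodup) (z : ℂ) :
    Matrix.vecMul X.refCov (X.listMonodromy l z 0 1) = 0 ∧
    Matrix.vecMul X.refCov (X.listMonodromy l z 1 1)
      = (l.map fun n => Complex.sinh (z - X.ξ n - X.spin n * X.η)).prod • X.refCov := by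
  induction l with
  | nil => simp [listMonodromy]
  | cons n l ih =>
    rw [List.nodup_cons] at hl
    obtain ⟨ih1, ih2⟩ := ih hl.2
    have hco := fun A i j => (X.commute_atSite_listMonodromy hl.1 A z i j).eq
    have hB : Matrix.vecMul X.refCov (X.lax n (z - X.ξ n) 0 1) = 0 := by
      rw [lax_apply, refCov_vecMul_atSite]
      · simp [localLax, locSminus]
      · intro j _; simp [localLax, locSminus]
    have hA : Matrix.vecMul X.refCov (X.lax n (z - X.ξ n) 0 0)
        = X.localLax n (z - X.ξ n) 0 0 0 0 • X.refCov := by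
      rw [lax_apply, refCov_vecMul_atSite]
      intro j hj
      simp [localLax, locSz, Matrix.diagonal_apply_ne _ hj.symm]
    have hD : Matrix.vecMul X.refCov (X.lax n (z - X.ξ n) 1 1)
        = Complex.sinh (z - X.ξ n - X.spin n * X.η) • X.refCov := by
      rw [lax_apply, refCov_vecMul_atSite]
      · simp [localLax, locSz, mul_comm]
      · intro j hj
        simp [localLax, locSz, Matrix.diagonal_apply_ne _ hj.symm]
    rw [listMonodromy_cons, Matrix.mul_apply, Matrix.mul_apply, Fin.sum_univ_two, Fin.sum_univ_two]
    constructor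
    · rw [Matrix.vecMul_add, ← Matrix.vecMul_vecMul, ← Matrix.vecMul_vecMul, hB, hA,
        Matrix.smul_vecMul, ih1]
      simp
    · rw [Matrix.vecMul_add, X.lax_apply n _ 1 0, hco, ← Matrix.vecMul_vecMul,
        ← Matrix.vecMul_vecMul, hD, ih1, Matrix.smul_vecMul, ih2, smul_smul]
      simp

theorem refCov_vecMul_D (z : ℂ) :
    Matrix.vecMul X.refCov (X.monodromy z 1 1) = X.d z • X.refCov := by
  rw [monodromy_eq_listMonodromy, (X.refCov_listMonodromy
    (List.nodup_reverse.mpr (List.nodup_finRange N)) z).2, List.map_reverse, List.prod_reverse,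
    ← List.ofFn_eq_map, List.prod_ofFn, d]

theorem trigPoly_lax_diag (n : Fin N) (i : Fin 2) (h h' : X.Conf) :
    TrigPoly 1 (fun z => X.lax n (z - X.ξ n) i i h h') := by
  simp only [lax_apply, atSite, Matrix.of_apply]
  split_ifs with h1
  · fin_cases i
    · simp only [localLax, locSz, Matrix.diagonal_apply, Fin.zero_eta, Matrix.of_apply,
        Matrix.cons_val', Matrix.cons_val_zero, Matrix.empty_val', Matrix.cons_val_fin_one]
      split_ifs
      · simpa only [sub_sub_eq_add_sub, sub_add, add_sub_assoc] using
          TrigPoly.sinh_sub (X.ξ n - X.η * (X.spin n - ((h n : ℕ) : ℂ)))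
      · exact TrigPoly.zero 1
    · simp only [localLax, locSz, Matrix.diagonal_apply, Fin.mk_one, Matrix.of_apply,
        Matrix.cons_val', Matrix.cons_val_one, Matrix.empty_val', Matrix.cons_val_fin_one]
      split_ifs
      · simpa only [sub_sub] using
          TrigPoly.sinh_sub (X.ξ n + X.η * (X.spin n - ((h n : ℕ) : ℂ)))
      · exact TrigPoly.zero 1
  · exact TrigPoly.zero 1

theorem trigPoly_lax_offDiag (n : Fin N) {i j : Fin 2} (hij : i ≠ j) (h h' : X.Conf) :
    TrigPoly 0 (fun z => X.lax n (z - X.ξ n) i j h h') := by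
  fin_cases i <;> fin_cases j <;> first | exact absurd rfl hij | exact TrigPoly.const _

/-- The diagonal entries of a product of `K` Lax operators are trigonometric polynomials of degree
`K`, the off-diagonal ones of degree `K - 1`, and vanish if `K = 0`. -/
theorem trigPoly_listMonodromy (l : List (Fin N)) (h h' : X.Conf) :
    (∀ i, TrigPoly l.length (fun z => X.listMonodromy l z i i h h')) ∧
    (∀ i j, i ≠ j → (l.length = 0 ∧ ∀ z, X.listMonodromy l z i j h h' = 0) ∨
      ∃ K, l.length = K + 1 ∧ TrigPoly K (fun z => X.listMonodromy l z i j h h')) := by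
  induction l generalizing h h' with
  | nil =>
    simp only [listMonodromy, List.map_nil, List.prod_nil, Matrix.one_apply_eq]
    refine ⟨fun i => TrigPoly.const _, fun i j hij => Or.inl ⟨rfl, fun z => ?_⟩⟩
    rw [Matrix.one_apply_ne hij, Matrix.zero_apply]
  | cons n l ih =>
    have hent : ∀ z i j k, k ≠ i → X.listMonodromy (n :: l) z i j h h'
        = (∑ g, X.lax n (z - X.ξ n) i i h g * X.listMonodromy l z i j g h')
          + ∑ g, X.lax n (z - X.ξ n) i k h g * X.listMonodromy l z k j g h' := by
      intro z i j k hk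
      rw [listMonodromy_cons, Matrix.mul_apply, Fin.sum_univ_two]
      fin_cases i <;> fin_cases k <;>
        first | exact absurd rfl hk | simp [Matrix.add_apply, Matrix.mul_apply, add_comm]
    have hne : ∀ i : Fin 2, 1 - i ≠ i := by decide
    have huniq : ∀ i j : Fin 2, i ≠ j → j = 1 - i := by decide
    constructor
    · intro i
      simp only [hent _ i i (1 - i) (hne i)]
      refine TrigPoly.add ?_ ?_
      · refine TrigPoly.sum _ fun g => ?_
        rw [List.length_cons, add_comm]
        exact (X.trigPoly_lax_diag n i h g).mul ((ih g h').1 i)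
      · refine TrigPoly.sum _ fun g => ?_
        rcases (ih g h').2 (1 - i) i (hne i) with ⟨-, h0⟩ | ⟨K, hK, hT⟩
        · simp only [h0, mul_zero]; exact TrigPoly.zero _
        · rw [List.length_cons, hK]
          have := (X.trigPoly_lax_offDiag n (hne i).symm h g).mul hT
          rw [zero_add] at this
          exact this.add_two
    · intro i j hij
      obtain rfl := huniq i j hij
      refine Or.inr ⟨l.length, rfl, ?_⟩
      simp only [hent _ i (1 - i) (1 - i) (hne i)]
      refine TrigPoly.add ?_ ?_
      · refine TrigPoly.sum _ fun g => ?_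
        rcases (ih g h').2 i (1 - i) hij with ⟨-, h0⟩ | ⟨K, hK, hT⟩
        · simp only [h0, mul_zero]; exact TrigPoly.zero _
        · rw [hK, add_comm]
          exact (X.trigPoly_lax_diag n i h g).mul hT
      · refine TrigPoly.sum _ fun g => ?_
        have := (X.trigPoly_lax_offDiag n hij h g).mul ((ih g h').1 (1 - i))
        rwa [zero_add] at this

theorem trigPoly_monodromy_diag (i : Fin 2) (h h' : X.Conf) :
    TrigPoly N (fun z => X.monodromy z i i h h') := by
  simp only [monodromy_eq_listMonodromy]
  have := (X.trigPoly_listMonodromy (List.finRange N).reverse h h').1 i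
  rwa [List.length_reverse, List.length_finRange] at this

theorem trigPoly_monodromy_offDiag (hN : 1 ≤ N) {i j : Fin 2} (hij : i ≠ j) (h h' : X.Conf) :
    TrigPoly (N - 1) (fun z => X.monodromy z i j h h') := by
  simp only [monodromy_eq_listMonodromy]
  have := (X.trigPoly_listMonodromy (List.finRange N).reverse h h').2 i j hij
  rw [List.length_reverse, List.length_finRange] at this
  rcases this with ⟨h0, -⟩ | ⟨K, hK, hT⟩
  · omega
  · obtain rfl : K = N - 1 := by omega
    exact hT

theorem trigPoly_antiTransfer (hN : 1 ≤ N) (κ : ℂ) (h h' : X.Conf) :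
    TrigPoly (N - 1) (fun z => X.antiTransfer κ z h h') := by
  simp only [antiTransfer, Matrix.add_apply, Matrix.smul_apply, smul_eq_mul]
  exact ((X.trigPoly_monodromy_offDiag hN (by decide) h h').const_mul _).add
    ((X.trigPoly_monodromy_offDiag hN (by decide) h h').const_mul _)

end XXZChain

/-! ### Separation of variables -/

theorem exp_two_mul_eq_one_of_sinh_eq_zero {x : ℂ} (h : Complex.sinh x = 0) :
    Complex.exp (2 * x) = 1 := by
  rw [Complex.sinh, div_eq_zero_iff, sub_eq_zero, Complex.exp_neg] at h
  rcases h with h | h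
  · rw [two_mul, Complex.exp_add]
    nth_rewrite 1 [h]
    exact inv_mul_cancel₀ (Complex.exp_ne_zero x)
  · exact absurd h two_ne_zero

open scoped IsMulCommutative in
/-- In a commuting family `c n k`, the products `∏ₙ ∏_{k < h n} c n k` are well defined. -/
theorem exists_commuting_products {M ι : Type*} [Monoid M] [Fintype ι] [DecidableEq ι]
    (c : ι → ℕ → M) (hc : ∀ n k n' k', c n k * c n' k' = c n' k' * c n k) :
    ∃ G : (ι → ℕ) → M, G 0 = 1 ∧
      ∀ h n, G (Function.update h n (h n + 1)) = G h * c n (h n) := by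
  let s : Set M := {x | ∃ n k, c n k = x}
  have hs : ∀ a ∈ s, ∀ b ∈ s, a * b = b * a := by
    rintro _ ⟨n, k, rfl⟩ _ ⟨n', k', rfl⟩; exact hc n k n' k'
  have := Submonoid.isMulCommutative_closure M hs
  let c' : ι → ℕ → Submonoid.closure s := fun n k =>
    ⟨c n k, Submonoid.subset_closure ⟨n, k, rfl⟩⟩
  refine ⟨fun h => ((∏ n, ∏ k ∈ Finset.range (h n), c' n k : Submonoid.closure s) : M), by simp,
    fun h n => ?_⟩
  have : (∏ l, ∏ k ∈ Finset.range (Function.update h n (h n + 1) l), c' l k)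
      = (∏ l, ∏ k ∈ Finset.range (h l), c' l k) * c' n (h n) := by
    rw [← Finset.prod_erase_mul _ _ (Finset.mem_univ n),
      ← Finset.prod_erase_mul (Finset.univ) (fun l => ∏ k ∈ Finset.range (h l), c' l k)
        (Finset.mem_univ n), Function.update_self, Finset.prod_range_succ, mul_assoc]
    congr 1
    refine Finset.prod_congr rfl fun l hl => ?_
    rw [Function.update_of_ne (Finset.ne_of_mem_erase hl)]
  simp only [this]
  rfl

theorem induction_update {ι : Type*} [Fintype ι] [DecidableEq ι] {P : (ι → ℕ) → Prop}
    (h0 : P 0) (hstep : ∀ h n, P h → P (Function.update h n (h n + 1))) (h : ι → ℕ) : P h := by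
  obtain ⟨k, hk⟩ : ∃ k, ∑ n, h n = k := ⟨_, rfl⟩
  induction k generalizing h with
  | zero =>
    rw [Finset.sum_eq_zero_iff] at hk
    have : h = 0 := funext fun n => hk n (Finset.mem_univ n)
    rwa [this]
  | succ k ih =>
    obtain ⟨n, -, hn⟩ := Finset.exists_ne_zero_of_sum_ne_zero (hk.trans_ne (Nat.succ_ne_zero k))
    have h1 := hstep (Function.update h n (h n - 1)) n (ih _ ?_)
    · rwa [Function.update_self, Function.update_idem, Nat.sub_add_cancel (by omega),
        Function.update_eq_self] at h1
    · rw [← Finset.sum_erase_add _ _ (Finset.mem_univ n)] at hk ⊢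
      have e : ∑ l ∈ Finset.univ.erase n, Function.update h n (h n - 1) l
          = ∑ l ∈ Finset.univ.erase n, h l :=
        Finset.sum_congr rfl (fun l hl => Function.update_of_ne (Finset.ne_of_mem_erase hl) _ h)
      rw [e, Function.update_self]
      omega

/-- Identity principle: entire functions that agree wherever an entire function `g ≢ 0` does not
vanish are equal. -/
theorem eq_of_eq_on_ne_zero {f₁ f₂ g : ℂ → ℂ} (h₁ : Differentiable ℂ f₁)
    (h₂ : Differentiable ℂ f₂) (hg : Differentiable ℂ g) (hg0 : ∃ z, g z ≠ 0)
    (h : ∀ z, g z ≠ 0 → f₁ z = f₂ z) (z : ℂ) : f₁ z = f₂ z := by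
  have key := AnalyticOnNhd.eq_zero_or_eq_zero_of_mul_eq_zero (𝕜 := ℂ) (U := Set.univ)
    (f := fun z => f₁ z - f₂ z) (g := g)
    (((h₁.sub h₂).differentiableOn).analyticOnNhd isOpen_univ)
    (hg.differentiableOn.analyticOnNhd isOpen_univ)
    (fun z _ => by
      by_cases hz : g z = 0
      · rw [hz, mul_zero]
      · rw [h z hz, sub_self, zero_mul]) isPreconnected_univ
  rcases key with key | key
  · exact sub_eq_zero.mp (key z (Set.mem_univ z))
  · obtain ⟨w, hw⟩ := hg0
    exact absurd (key w (Set.mem_univ w)) hw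

namespace XXZChain

variable {N : ℕ} (X : XXZChain N)

/-- `e^η` is not a root of unity, and the strings are pairwise disjoint. -/
structure Generic : Prop where
  exp_pow_ne_one : ∀ m : ℕ, 1 ≤ m → Complex.exp X.η ^ m ≠ 1
  disjoint : ∀ i j, i ≠ j → X.xiString i ∩ X.xiString j = ∅

variable {X}

theorem Generic.sinh_nat_mul_ne_zero (hX : X.Generic) {k : ℕ} (hk : 1 ≤ k) :
    Complex.sinh (k * X.η) ≠ 0 := by
  intro h
  have h1 := exp_two_mul_eq_one_of_sinh_eq_zero h
  refine hX.exp_pow_ne_one (2 * k) (by omega) ?_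
  rw [← Complex.exp_nat_mul, ← h1]
  congr 1; push_cast; ring

theorem Generic.sinh_eta_ne_zero (hX : X.Generic) : Complex.sinh X.η ≠ 0 := by
  simpa using hX.sinh_nat_mul_ne_zero le_rfl

theorem Generic.sinh_sub_mul_ne_zero (hX : X.Generic) {j k : ℕ} (hjk : j ≠ k) :
    Complex.sinh (((j : ℂ) - k) * X.η) ≠ 0 := by
  rcases Nat.lt_or_gt_of_ne hjk with h | h
  · rw [show ((j : ℂ) - k) * X.η = -(((k - j : ℕ) : ℂ) * X.η) by
      rw [Nat.cast_sub h.le]; ring, Complex.sinh_neg, neg_ne_zero]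
    exact hX.sinh_nat_mul_ne_zero (by omega)
  · rw [show ((j : ℂ) - k) * X.η = ((j - k : ℕ) : ℂ) * X.η by rw [Nat.cast_sub h.le]]
    exact hX.sinh_nat_mul_ne_zero (by omega)

theorem Generic.eq_of_sinh_eq_zero (hX : X.Generic) {n m : Fin N} {k l : ℕ}
    (hk : k ≤ X.twoS n) (hl : l ≤ X.twoS m)
    (h : Complex.sinh (X.xiShift n k - X.xiShift m l) = 0) : n = m ∧ k = l := by
  by_cases hnm : n = m
  · subst hnm
    refine ⟨rfl, ?_⟩
    by_contra hkl
    apply hX.sinh_sub_mul_ne_zero (Ne.symm hkl)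
    rw [← h, xiShift, xiShift]
    congr 1; ring
  · exfalso
    obtain ⟨j, hj⟩ := Complex.exp_eq_one_iff.mp (exp_two_mul_eq_one_of_sinh_eq_zero h)
    have hmem : X.xiShift n k ∈ X.xiString n ∩ X.xiString m := by
      refine ⟨⟨k, hk, 0, by simp [xiShift]⟩, ⟨l, hl, j, ?_⟩⟩
      rw [show X.ξ m + (X.spin m - l) * X.η = X.xiShift m l from rfl]
      linear_combination hj / 2
    rw [hX.disjoint n m hnm] at hmem
    exact hmem

variable (X)

theorem xiShift_succ (n : Fin N) (k : ℕ) : X.xiShift n (k + 1) = X.xiShift n k - X.η := by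
  simp only [xiShift]; push_cast; ring

theorem a_eq (z : ℂ) : X.a z = ∏ n, Complex.sinh (z - X.xiShift n (X.twoS n)) := by
  refine Finset.prod_congr rfl fun n _ => ?_
  simp only [xiShift, spin]; congr 1; ring

theorem d_eq (z : ℂ) : X.d z = ∏ n, Complex.sinh (z - X.xiShift n 0) := by
  refine Finset.prod_congr rfl fun n _ => ?_
  simp only [xiShift]; congr 1; push_cast; ring

theorem a_last (n : Fin N) : X.a (X.xiShift n (X.twoS n)) = 0 := by
  rw [a_eq]
  exact Finset.prod_eq_zero (Finset.mem_univ n) (by simp)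

theorem d_first (n : Fin N) : X.d (X.xiShift n 0) = 0 := by
  rw [d_eq]
  exact Finset.prod_eq_zero (Finset.mem_univ n) (by simp)

variable {X}

theorem Generic.a_ne_zero (hX : X.Generic) {n : Fin N} {k : ℕ} (hk : k < X.twoS n) :
    X.a (X.xiShift n k) ≠ 0 := by
  rw [a_eq, Finset.prod_ne_zero_iff]
  intro m _ h
  obtain ⟨rfl, h2⟩ := hX.eq_of_sinh_eq_zero hk.le le_rfl h
  omega

theorem Generic.d_ne_zero (hX : X.Generic) {n : Fin N} {k : ℕ} (hk : k + 1 ≤ X.twoS n) :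
    X.d (X.xiShift n (k + 1)) ≠ 0 := by
  rw [d_eq, Finset.prod_ne_zero_iff]
  intro m _ h
  obtain ⟨rfl, h2⟩ := hX.eq_of_sinh_eq_zero hk (Nat.zero_le _) h
  omega

theorem Generic.C_mul_C (hX : X.Generic) (z w : ℂ) :
    X.monodromy z 1 0 * X.monodromy w 1 0 = X.monodromy w 1 0 * X.monodromy z 1 0 := by
  have hT := X.isMonodromy_monodromy hX.sinh_eta_ne_zero
  by_cases h : Complex.sinh (z - w + X.η) = 0
  · have h' : Complex.sinh (w - z + X.η) ≠ 0 := by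
      intro h'
      have e1 := exp_two_mul_eq_one_of_sinh_eq_zero h
      have e2 := exp_two_mul_eq_one_of_sinh_eq_zero h'
      refine hX.exp_pow_ne_one 4 (by norm_num) ?_
      rw [← Complex.exp_nat_mul, show ((4 : ℕ) : ℂ) * X.η = 2 * (z - w + X.η) + 2 * (w - z + X.η) by
        push_cast; ring, Complex.exp_add, e1, e2, one_mul]
    exact (smul_right_injective _ h' (hT.C_mul_C w z)).symm
  · exact smul_right_injective _ h (hT.C_mul_C z w)

/-- The creation step: acting with `C` at a zero `z₀` of the eigenvalue of a joint eigencovector of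
the operators `D` moves this zero to `z₀ - η`. -/
theorem Generic.vecMul_C_D (hX : X.Generic) {u : X.Conf → ℂ} {z₀ : ℂ} {r : ℂ → ℂ}
    (hr : Differentiable ℂ r)
    (hu : ∀ z, Matrix.vecMul u (X.monodromy z 1 1) = (Complex.sinh (z - z₀) * r z) • u) (z : ℂ) :
    Matrix.vecMul (Matrix.vecMul u (X.monodromy z₀ 1 0)) (X.monodromy z 1 1)
      = (Complex.sinh (z - z₀ + X.η) * r z) • Matrix.vecMul u (X.monodromy z₀ 1 0) := by
  have hT := X.isMonodromy_monodromy hX.sinh_eta_ne_zero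
  ext h
  refine eq_of_eq_on_ne_zero (g := fun z => Complex.sinh (z - z₀))
    (f₁ := fun z => Matrix.vecMul (Matrix.vecMul u (X.monodromy z₀ 1 0)) (X.monodromy z 1 1) h)
    (f₂ := fun z => ((Complex.sinh (z - z₀ + X.η) * r z)
      • Matrix.vecMul u (X.monodromy z₀ 1 0)) h) ?_ ?_ (by fun_prop) ?_ ?_ z
  · simp only [Matrix.vecMul, dotProduct]
    exact Differentiable.fun_sum fun i _ =>
      (X.trigPoly_monodromy_diag 1 i h).differentiable.const_mul _
  · simp only [Pi.smul_apply, smul_eq_mul]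
    have : Differentiable ℂ fun z => Complex.sinh (z - z₀ + X.η) := by fun_prop
    exact (this.mul hr).mul_const _
  · exact ⟨z₀ + X.η, by simpa using hX.sinh_eta_ne_zero⟩
  · intro w hw
    have h1 := congrArg (Matrix.vecMul u) (hT.C_mul_D z₀ w)
    rw [Matrix.vecMul_add, Matrix.vecMul_smul, Matrix.vecMul_smul, Matrix.vecMul_smul,
      ← Matrix.vecMul_vecMul, ← Matrix.vecMul_vecMul, ← Matrix.vecMul_vecMul, hu, hu, sub_self,
      Complex.sinh_zero, zero_mul, zero_smul, Matrix.zero_vecMul, smul_zero, add_zero,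
      Matrix.smul_vecMul, smul_smul] at h1
    have h2 := congrFun h1 h
    simp only [Pi.smul_apply, smul_eq_mul] at h2 ⊢
    apply mul_left_cancel₀ hw
    rw [← h2]; ring

/-- The annihilation step: acting with `B` at a zero `z₀` of the eigenvalue of a joint eigencovector
of the operators `D` moves this zero to `z₀ + η`. -/
theorem Generic.vecMul_B_D (hX : X.Generic) {u : X.Conf → ℂ} {z₀ : ℂ} {r : ℂ → ℂ}
    (hr : Differentiable ℂ r)
    (hu : ∀ z, Matrix.vecMul u (X.monodromy z 1 1) = (Complex.sinh (z - z₀) * r z) • u) (z : ℂ) :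
    Matrix.vecMul (Matrix.vecMul u (X.monodromy z₀ 0 1)) (X.monodromy z 1 1)
      = (Complex.sinh (z - z₀ - X.η) * r z) • Matrix.vecMul u (X.monodromy z₀ 0 1) := by
  have hT := X.isMonodromy_monodromy hX.sinh_eta_ne_zero
  ext h
  refine eq_of_eq_on_ne_zero (g := fun z => Complex.sinh (z - z₀))
    (f₁ := fun z => Matrix.vecMul (Matrix.vecMul u (X.monodromy z₀ 0 1)) (X.monodromy z 1 1) h)
    (f₂ := fun z => ((Complex.sinh (z - z₀ - X.η) * r z)
      • Matrix.vecMul u (X.monodromy z₀ 0 1)) h) ?_ ?_ (by fun_prop) ?_ ?_ z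
  · simp only [Matrix.vecMul, dotProduct]
    exact Differentiable.fun_sum fun i _ =>
      (X.trigPoly_monodromy_diag 1 i h).differentiable.const_mul _
  · simp only [Pi.smul_apply, smul_eq_mul]
    have : Differentiable ℂ fun z => Complex.sinh (z - z₀ - X.η) := by fun_prop
    exact (this.mul hr).mul_const _
  · exact ⟨z₀ + X.η, by simpa using hX.sinh_eta_ne_zero⟩
  · intro w hw
    have h1 := congrArg (Matrix.vecMul u) (hT.B_mul_D z₀ w)
    rw [Matrix.vecMul_add, Matrix.vecMul_smul, Matrix.vecMul_smul, Matrix.vecMul_smul,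
      ← Matrix.vecMul_vecMul, ← Matrix.vecMul_vecMul, ← Matrix.vecMul_vecMul, hu, hu, sub_self,
      Complex.sinh_zero, zero_mul, zero_smul, Matrix.zero_vecMul, smul_zero, add_zero,
      Matrix.smul_vecMul, smul_smul] at h1
    have h2 := congrFun h1 h
    simp only [Pi.smul_apply, smul_eq_mul] at h2 ⊢
    apply mul_left_cancel₀ hw
    rw [show z₀ - w = -(w - z₀) by ring, Complex.sinh_neg,
      show -(w - z₀) + X.η = -(w - z₀ - X.η) by ring, Complex.sinh_neg] at h2
    linear_combination -h2

variable (X)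

/-- The eigenvalue `∏ₙ sinh (z - ξₙ^{(hₙ)})` of `D(z)`. -/
noncomputable def dEigen (h : Fin N → ℕ) (z : ℂ) : ℂ :=
  ∏ n, Complex.sinh (z - X.xiShift n (h n))

/-- A family of row vectors generated from the reference row vector by the operators `C`, normalized
so that the antiperiodic transfer matrix acts with the coefficients of the Baxter equation. -/
structure IsSeparating (κ : ℂ) (cov : (Fin N → ℕ) → X.Conf → ℂ) : Prop where
  zero : cov 0 = X.refCov
  step : ∀ h n, cov (Function.update h n (h n + 1))
    = (-κ / X.a (X.xiShift n (h n))) • Matrix.vecMul (cov h) (X.monodromy (X.xiShift n (h n)) 1 0)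

theorem dEigen_eq (h : Fin N → ℕ) (n : Fin N) (z : ℂ) :
    X.dEigen h z = Complex.sinh (z - X.xiShift n (h n))
      * ∏ m ∈ Finset.univ.erase n, Complex.sinh (z - X.xiShift m (h m)) := by
  rw [dEigen, Finset.mul_prod_erase _ (fun m => Complex.sinh (z - X.xiShift m (h m)))
    (Finset.mem_univ n)]

theorem dEigen_update (h : Fin N → ℕ) (n : Fin N) (k : ℕ) (z : ℂ) :
    X.dEigen (Function.update h n k) z = Complex.sinh (z - X.xiShift n k)
      * ∏ m ∈ Finset.univ.erase n, Complex.sinh (z - X.xiShift m (h m)) := by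
  rw [dEigen_eq X _ n, Function.update_self]
  congr 1
  refine Finset.prod_congr rfl fun m hm => ?_
  rw [Function.update_of_ne (Finset.ne_of_mem_erase hm)]

variable {X}

theorem Generic.exists_isSeparating (hX : X.Generic) (κ : ℂ) :
    ∃ cov, X.IsSeparating κ cov := by
  obtain ⟨G, hG0, hG⟩ := exists_commuting_products (M := X.Op)
    (fun n k => (-κ / X.a (X.xiShift n k)) • X.monodromy (X.xiShift n k) 1 0)
    (fun n k n' k' => by
      rw [smul_mul_smul_comm, smul_mul_smul_comm, hX.C_mul_C, mul_comm (-κ / _)])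
  refine ⟨fun h => Matrix.vecMul X.refCov (G h), by simp [hG0], fun h n => ?_⟩
  rw [hG, ← Matrix.vecMul_vecMul, Matrix.vecMul_smul]

theorem differentiable_prod_sinh (s : Finset (Fin N)) (c : Fin N → ℂ) :
    Differentiable ℂ fun z => ∏ m ∈ s, Complex.sinh (z - c m) :=
  Differentiable.fun_finsetProd fun m _ => by fun_prop

section Separating

variable {κ : ℂ} {cov : (Fin N → ℕ) → X.Conf → ℂ}

theorem IsSeparating.vecMul_D (hc : X.IsSeparating κ cov) (hX : X.Generic) (h : Fin N → ℕ) :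
    ∀ z, Matrix.vecMul (cov h) (X.monodromy z 1 1) = X.dEigen h z • cov h := by
  induction h using induction_update with
  | h0 =>
    intro z
    rw [hc.zero, refCov_vecMul_D, d_eq]
    rfl
  | hstep h n ih =>
    intro z
    simp only [dEigen_eq X h n] at ih
    rw [hc.step, Matrix.smul_vecMul, hX.vecMul_C_D (differentiable_prod_sinh _ _) ih z,
      dEigen_update, xiShift_succ, smul_comm, show z - (X.xiShift n (h n) - X.η)
        = z - X.xiShift n (h n) + X.η by ring]

theorem IsSeparating.vecMul_B (hc : X.IsSeparating κ cov) (hX : X.Generic) (h : Fin N → ℕ)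
    {n : Fin N} (hn : h n < X.twoS n) :
    Matrix.vecMul (cov (Function.update h n (h n + 1))) (X.monodromy (X.xiShift n (h n + 1)) 0 1)
      = (κ * X.d (X.xiShift n (h n + 1))) • cov h := by
  have hT := X.isMonodromy_monodromy hX.sinh_eta_ne_zero
  have h1 := congrArg (Matrix.vecMul (cov h)) (hT.qdet_eq (X.xiShift n (h n)))
  have h0 : X.dEigen h (X.xiShift n (h n)) = 0 := by rw [dEigen_eq X h n]; simp
  rw [Matrix.vecMul_sub, ← Matrix.vecMul_vecMul, ← Matrix.vecMul_vecMul, hc.vecMul_D hX, h0,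
    zero_smul, Matrix.zero_vecMul, zero_sub, ← xiShift_succ, Algebra.algebraMap_eq_smul_one,
    Matrix.vecMul_smul, Matrix.vecMul_one] at h1
  rw [hc.step, Matrix.smul_vecMul, neg_eq_iff_eq_neg.mp h1, ← neg_smul, smul_smul]
  congr 1
  have := hX.a_ne_zero hn
  field_simp

theorem IsSeparating.ne_zero (hc : X.IsSeparating κ cov) (hX : X.Generic) (hκ : κ ≠ 0)
    (h : Fin N → ℕ) : (∀ n, h n ≤ X.twoS n) → cov h ≠ 0 := by
  induction h using induction_update with
  | h0 => intro _; rw [hc.zero]; exact X.refCov_ne_zero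
  | hstep h n ih =>
    intro hb h0
    have hn : h n < X.twoS n := by
      have := hb n
      rw [Function.update_self] at this
      omega
    have h1 := hc.vecMul_B hX h hn
    rw [h0, Matrix.zero_vecMul] at h1
    have h2 := smul_eq_zero.mp h1.symm
    rcases h2 with h2 | h2
    · exact mul_ne_zero hκ (hX.d_ne_zero hn) h2
    · refine ih (fun m => ?_) h2
      by_cases hm : m = n
      · subst hm; omega
      · have := hb m
        rwa [Function.update_of_ne hm] at this

/-- The product of the operators `D` at all points of the strings except those of a configuration
`h₀` annihilates every covector of the family but the one of `h₀`. -/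
theorem IsSeparating.linearIndependent (hc : X.IsSeparating κ cov) (hX : X.Generic) (hκ : κ ≠ 0) :
    LinearIndependent ℂ (fun h : X.Conf => cov (fun n => (h n : ℕ))) := by
  rw [Fintype.linearIndependent_iff]
  intro g hg h₀
  have hlist : ∀ (l : List ℂ) (h : Fin N → ℕ),
      Matrix.vecMul (cov h) (l.map fun z => X.monodromy z 1 1).prod
        = (l.map (X.dEigen h)).prod • cov h := by
    intro l
    induction l with
    | nil => intro h; simp
    | cons z l ih =>
      intro h
      rw [List.map_cons, List.prod_cons, ← Matrix.vecMul_vecMul, hc.vecMul_D hX, Matrix.smul_vecMul,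
        ih, smul_smul, List.map_cons, List.prod_cons]
  let l : List ℂ := ((Finset.univ : Finset (Σ n, X.Loc n)).filter
    (fun x => x.2 ≠ h₀ x.1)).toList.map (fun x => X.xiShift x.1 x.2)
  have hmem : ∀ n k, k ≠ h₀ n → X.xiShift n (k : X.Loc n) ∈ l := by
    intro n k hk
    exact List.mem_map.mpr ⟨⟨n, k⟩, by simpa using hk, rfl⟩
  have h1 := congrArg (fun u => Matrix.vecMul u (l.map fun z => X.monodromy z 1 1).prod) hg
  simp only [Matrix.zero_vecMul, Matrix.sum_vecMul, Matrix.smul_vecMul, hlist] at h1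
  rw [Finset.sum_eq_single h₀] at h1
  · rw [smul_smul] at h1
    rcases smul_eq_zero.mp h1 with h2 | h2
    · refine (mul_eq_zero.mp h2).resolve_right ?_
      refine List.prod_ne_zero fun h3 => ?_
      obtain ⟨z, hz, hz0⟩ := List.mem_map.mp h3
      obtain ⟨⟨n, k⟩, hnk, rfl⟩ := List.mem_map.mp hz
      have hk : k ≠ h₀ n := by simpa using hnk
      rw [dEigen, Finset.prod_eq_zero_iff] at hz0
      obtain ⟨m, -, hm⟩ := hz0
      obtain ⟨h4, h5⟩ := hX.eq_of_sinh_eq_zero (Nat.lt_succ_iff.mp k.2)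
        (Nat.lt_succ_iff.mp (h₀ m).2) hm
      subst h4
      exact hk (Fin.ext h5)
    · exact absurd h2 (hc.ne_zero hX hκ _ fun n => Nat.lt_succ_iff.mp (h₀ n).2)
  · intro h _ hne
    obtain ⟨n, hn⟩ := Function.ne_iff.mp hne
    rw [List.prod_eq_zero, zero_smul, smul_zero]
    refine List.mem_map.mpr ⟨_, hmem n (h n) hn, ?_⟩
    rw [dEigen_eq X _ n]; simp
  · intro h; exact absurd (Finset.mem_univ _) h

theorem IsSeparating.span_eq_top (hc : X.IsSeparating κ cov) (hX : X.Generic) (hκ : κ ≠ 0) :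
    Submodule.span ℂ (Set.range fun h : X.Conf => cov (fun n => (h n : ℕ))) = ⊤ :=
  (hc.linearIndependent hX hκ).span_eq_top_of_card_eq_finrank' (by simp)

/-- The operators `D` have no other joint eigenvalues than those of the separating family. -/
theorem IsSeparating.eq_zero_of_vecMul_D (hc : X.IsSeparating κ cov) (hX : X.Generic) (hκ : κ ≠ 0)
    {u : X.Conf → ℂ} {g : ℂ → ℂ} (hu : ∀ z, Matrix.vecMul u (X.monodromy z 1 1) = g z • u)
    (hg : ∀ h : X.Conf, ∃ n, g (X.xiShift n (h n)) ≠ 0) : u = 0 := by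
  have hu' : u ∈ Submodule.span ℂ (Set.range fun h : X.Conf => cov (fun n => (h n : ℕ))) := by
    rw [hc.span_eq_top hX hκ]; trivial
  obtain ⟨c, hcu⟩ := (Submodule.mem_span_range_iff_exists_fun ℂ).mp hu'
  have hli := Fintype.linearIndependent_iff.mp (hc.linearIndependent hX hκ)
  have hc0 : ∀ h, c h = 0 := by
    intro h
    obtain ⟨n, hn⟩ := hg h
    have h1 := hu (X.xiShift n (h n))
    rw [← hcu, Matrix.sum_vecMul, Finset.smul_sum, ← sub_eq_zero, ← Finset.sum_sub_distrib] at h1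
    simp only [Matrix.smul_vecMul, hc.vecMul_D hX, smul_smul, ← sub_smul] at h1
    have h2 := hli _ h1 h
    rw [dEigen_eq X _ n, sub_self, Complex.sinh_zero, zero_mul, mul_zero, zero_sub,
      neg_eq_zero] at h2
    exact (mul_eq_zero.mp h2).resolve_left hn
  rw [← hcu]
  exact Finset.sum_eq_zero fun h _ => by rw [hc0, zero_smul]

/-- If the moved zero `w` is not congruent to any point of its own string, then
`sinh (z - w) ∏_{m ≠ n} sinh (z - ξₘ^{(hₘ)})` is not an eigenvalue of `D`. -/
theorem Generic.exists_ne_zero_of_moved (hX : X.Generic) {h : Fin N → ℕ}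
    (hh : ∀ m, h m ≤ X.twoS m) (n : Fin N) {w : ℂ}
    (hw : ∀ k ≤ X.twoS n, Complex.sinh (X.xiShift n k - w) ≠ 0) (h' : X.Conf) :
    ∃ m, Complex.sinh (X.xiShift m (h' m) - w)
      * ∏ l ∈ Finset.univ.erase n, Complex.sinh (X.xiShift m (h' m) - X.xiShift l (h l)) ≠ 0 := by
  refine ⟨n, mul_ne_zero (hw _ (Nat.lt_succ_iff.mp (h' n).2)) ?_⟩
  rw [Finset.prod_ne_zero_iff]
  intro l hl h0
  exact Finset.ne_of_mem_erase hl
    (hX.eq_of_sinh_eq_zero (Nat.lt_succ_iff.mp (h' n).2) (hh l) h0).1.symm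

/-- The antiperiodic transfer matrix acts on the separating family, at the points of the strings,
with the coefficients of the Baxter equation. The images under `C` at a last point and under `B` at
a first point vanish, as their eigenvalues under `D` would not be among those of the family. -/
theorem IsSeparating.vecMul_antiTransfer (hc : X.IsSeparating κ cov) (hX : X.Generic) (hκ : κ ≠ 0)
    (h : Fin N → ℕ) (hh : ∀ m, h m ≤ X.twoS m) (n : Fin N) :
    Matrix.vecMul (cov h) (X.antiTransfer κ (X.xiShift n (h n)))
      = -X.a (X.xiShift n (h n)) • cov (Function.update h n (h n + 1))
        + X.d (X.xiShift n (h n)) • cov (Function.update h n (h n - 1)) := by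
  have hD := hc.vecMul_D hX h
  simp only [dEigen_eq X h n] at hD
  have hC : κ • Matrix.vecMul (cov h) (X.monodromy (X.xiShift n (h n)) 1 0)
      = -X.a (X.xiShift n (h n)) • cov (Function.update h n (h n + 1)) := by
    rcases Nat.lt_or_ge (h n) (X.twoS n) with hn | hn
    · rw [hc.step, smul_smul]
      congr 1
      have := hX.a_ne_zero hn
      field_simp
    · have hn' : h n = X.twoS n := le_antisymm (hh n) hn
      have : Matrix.vecMul (cov h) (X.monodromy (X.xiShift n (h n)) 1 0) = 0 := by
        refine hc.eq_zero_of_vecMul_D hX hκ (hX.vecMul_C_D (differentiable_prod_sinh _ _) hD) ?_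
        intro h'
        simp only [sub_add]
        refine hX.exists_ne_zero_of_moved hh n (fun k hk h0 => ?_) h'
        rw [← xiShift_succ, xiShift, xiShift] at h0
        refine hX.sinh_sub_mul_ne_zero (j := h n + 1) (k := k) (by omega) ?_
        rw [← h0]; congr 1; ring
      rw [this, smul_zero, hn', a_last, neg_zero, zero_smul]
  have hB : κ⁻¹ • Matrix.vecMul (cov h) (X.monodromy (X.xiShift n (h n)) 0 1)
      = X.d (X.xiShift n (h n)) • cov (Function.update h n (h n - 1)) := by
    rcases Nat.eq_zero_or_pos (h n) with hn | hn
    · have : Matrix.vecMul (cov h) (X.monodromy (X.xiShift n (h n)) 0 1) = 0 := by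
        refine hc.eq_zero_of_vecMul_D hX hκ (hX.vecMul_B_D (differentiable_prod_sinh _ _) hD) ?_
        intro h'
        simp only [sub_sub]
        refine hX.exists_ne_zero_of_moved hh n (fun k hk h0 => ?_) h'
        rw [hn, xiShift, xiShift] at h0
        refine hX.sinh_sub_mul_ne_zero (j := 0) (k := k + 1) (by omega) ?_
        rw [← h0]; congr 1; push_cast; ring
      rw [this, smul_zero, hn, d_first, zero_smul]
    · have h1 := hc.vecMul_B hX (Function.update h n (h n - 1)) (n := n)
        (by rw [Function.update_self]; have := hh n; omega)
      rw [Function.update_self, Function.update_idem, Nat.sub_add_cancel hn,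
        Function.update_eq_self] at h1
      rw [h1, smul_smul, inv_mul_cancel_left₀ hκ]
  rw [antiTransfer, Matrix.vecMul_add, Matrix.vecMul_smul, Matrix.vecMul_smul, hC, hB, add_comm]

end Separating

variable (X)

/-- The separated, discrete form of the Baxter equation: `t` is a trigonometric polynomial of degree
`N - 1`, and on each string the Baxter equation has a non-trivial solution. -/
def DiscreteBaxter (t : ℂ → ℂ) : Prop :=
  TrigPoly (N - 1) t ∧ ∀ n, ∃ y : ℕ → ℂ, y 0 ≠ 0 ∧ ∀ k ≤ X.twoS n,
    t (X.xiShift n k) * y k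
      = -X.a (X.xiShift n k) * y (k + 1) + X.d (X.xiShift n k) * y (k - 1)

variable {X}

/-- A solution of the Baxter equation on a string vanishes identically if it vanishes at the first
point. -/
theorem Generic.string_ne_zero (hX : X.Generic) {t : ℂ → ℂ} {n : Fin N} {y : ℕ → ℂ}
    (hy : ∀ k ≤ X.twoS n, t (X.xiShift n k) * y k
      = -X.a (X.xiShift n k) * y (k + 1) + X.d (X.xiShift n k) * y (k - 1))
    {k : ℕ} (hk : k ≤ X.twoS n) (hyk : y k ≠ 0) : y 0 ≠ 0 := by
  intro h0
  have : ∀ j ≤ X.twoS n, y j = 0 := by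
    intro j
    induction j using Nat.strong_induction_on with
    | _ j ih =>
      intro hj
      rcases j with _ | j
      · exact h0
      · have h1 := hy j (by omega)
        rw [ih j (by omega) (by omega), ih (j - 1) (by omega) (by omega), mul_zero, mul_zero,
          add_zero] at h1
        exact (mul_eq_zero.mp h1.symm).resolve_left
          (neg_ne_zero.mpr (hX.a_ne_zero (by omega)))
  exact hyk (this k hk)

/-- Separation of variables: in the basis dual to the separating family, an eigenvector factorizes
into solutions of the Baxter equations on the strings. -/
theorem Generic.mem_eigenvalueFunctions_iff (hX : X.Generic) (hN : 1 ≤ N) {κ : ℂ} (hκ : κ ≠ 0)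
    (t : ℂ → ℂ) : t ∈ X.eigenvalueFunctions κ ↔ X.DiscreteBaxter t := by
  obtain ⟨cov, hc⟩ := hX.exists_isSeparating κ
  constructor
  · rintro ⟨v, hv0, hv⟩
    constructor
    · obtain ⟨i, hi⟩ := Function.ne_iff.mp hv0
      have h1 : t = fun z => (v i)⁻¹ * ∑ j, v j * X.antiTransfer κ z i j := by
        funext z
        have h2 := congrFun (hv z) i
        simp only [Matrix.mulVec, dotProduct, Pi.smul_apply, smul_eq_mul] at h2
        rw [eq_inv_mul_iff_mul_eq₀ hi, mul_comm, ← h2]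
        exact Finset.sum_congr rfl fun j _ => mul_comm _ _
      rw [h1]
      exact (TrigPoly.sum _ fun j => (X.trigPoly_antiTransfer hN κ i j).const_mul _).const_mul _
    · intro n
      obtain ⟨h, hh⟩ : ∃ h : X.Conf, cov (fun n => (h n : ℕ)) ⬝ᵥ v ≠ 0 := by
        by_contra hall
        push Not at hall
        apply hv0
        have hsp := hc.span_eq_top hX hκ
        have hz : ∀ u : X.Conf → ℂ, u ⬝ᵥ v = 0 := by
          intro u
          have hu : u ∈ Submodule.span ℂ
              (Set.range fun h : X.Conf => cov (fun n => (h n : ℕ))) := by rw [hsp]; trivial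
          induction hu using Submodule.span_induction with
          | mem x hx => obtain ⟨h, rfl⟩ := hx; exact hall h
          | zero => exact zero_dotProduct _
          | add x y _ _ hx hy => rw [add_dotProduct, hx, hy, add_zero]
          | smul c x _ hx => rw [smul_dotProduct, hx, smul_zero]
        ext i
        simpa using hz (Pi.single i 1)
      set h' : Fin N → ℕ := fun n => (h n : ℕ) with hh'
      have hb : ∀ m, h' m ≤ X.twoS m := fun m => Nat.lt_succ_iff.mp (h m).2
      have hy : ∀ k ≤ X.twoS n, t (X.xiShift n k) * (cov (Function.update h' n k) ⬝ᵥ v)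
          = -X.a (X.xiShift n k) * (cov (Function.update h' n (k + 1)) ⬝ᵥ v)
            + X.d (X.xiShift n k) * (cov (Function.update h' n (k - 1)) ⬝ᵥ v) := by
        intro k hk
        have h1 := hc.vecMul_antiTransfer hX hκ (Function.update h' n k) (fun m => by
          by_cases hm : m = n
          · subst hm; simpa using hk
          · rw [Function.update_of_ne hm]; exact hb m) n
        simp only [Function.update_self, Function.update_idem] at h1
        have h2 := congrArg (fun u => u ⬝ᵥ v) h1
        simp only [add_dotProduct, smul_dotProduct, smul_eq_mul] at h2
        rw [← Matrix.dotProduct_mulVec, hv, dotProduct_smul, smul_eq_mul] at h2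
        exact h2
      refine ⟨fun k => cov (Function.update h' n k) ⬝ᵥ v, ?_, hy⟩
      refine hX.string_ne_zero (y := fun k => cov (Function.update h' n k) ⬝ᵥ v) hy (hb n) ?_
      simpa using hh
  · rintro ⟨ht, hdisc⟩
    choose y hy0 hy using hdisc
    let G : Matrix X.Conf X.Conf ℂ := Matrix.of fun h => cov (fun n => (h n : ℕ))
    have hG : IsUnit G := Matrix.linearIndependent_rows_iff_isUnit.mp (hc.linearIndependent hX hκ)
    have hGinj := Matrix.mulVec_injective_iff_isUnit.mpr hG
    obtain ⟨v, hv⟩ := Matrix.mulVec_surjective_iff_isUnit.mpr hG (fun h => ∏ n, y n (h n))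
    have hcov : ∀ h : X.Conf, cov (fun n => (h n : ℕ)) ⬝ᵥ v = ∏ n, y n (h n) := fun h =>
      congrFun hv h
    refine ⟨v, ?_, fun z => ?_⟩
    · rintro rfl
      have h1 := hcov 0
      rw [dotProduct_zero] at h1
      exact Finset.prod_ne_zero_iff.mpr (fun n _ => hy0 n) h1.symm
    · apply hGinj
      funext h
      set h' : Fin N → ℕ := fun n => (h n : ℕ) with hh'
      have hb : ∀ m, h' m ≤ X.twoS m := fun m => Nat.lt_succ_iff.mp (h m).2
      refine TrigPoly.eq_of_eq_on (K := N - 1)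
        (f := fun z => G.mulVec ((X.antiTransfer κ z).mulVec v) h)
        (g := fun z => G.mulVec (t z • v) h) ?_ ?_
        (by rw [Fintype.card_fin]; omega) (fun n => X.xiShift n (h' n)) ?_ ?_ z
      · simp only [Matrix.mulVec, dotProduct]
        refine TrigPoly.sum _ fun i => TrigPoly.const_mul _ (TrigPoly.sum _ fun j => ?_)
        simp only [mul_comm _ (v j)]
        exact (X.trigPoly_antiTransfer hN κ i j).const_mul _
      · simp only [Matrix.mulVec_smul, Pi.smul_apply, smul_eq_mul, mul_comm (t _)]
        exact ht.const_mul _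
      · intro n m hnm
        refine (hX.eq_of_sinh_eq_zero (hb n) (hb m) ?_).1
        simp only at hnm
        have h1 : Complex.exp (2 * (X.xiShift n (h' n) - X.xiShift m (h' m))) = 1 := by
          rw [mul_sub, Complex.exp_sub, hnm, div_self (Complex.exp_ne_zero _)]
        rw [two_mul, Complex.exp_add] at h1
        rw [Complex.sinh, Complex.exp_neg, ← eq_inv_of_mul_eq_one_left h1, sub_self, zero_div]
      · intro n
        have hrow : ∀ u, G.mulVec u h = cov h' ⬝ᵥ u := fun u => rfl
        simp only [hrow]
        rw [Matrix.dotProduct_mulVec, hc.vecMul_antiTransfer hX hκ h' hb n, dotProduct_smul, hcov,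
          add_dotProduct, smul_dotProduct, smul_dotProduct]
        have hupd : ∀ k ≤ X.twoS n, cov (Function.update h' n k) ⬝ᵥ v
            = y n k * ∏ m ∈ Finset.univ.erase n, y m (h m) := by
          intro k hk
          have h1 := hcov (Function.update h n (⟨k, Nat.lt_succ_of_le hk⟩ : X.Loc n))
          rw [← Finset.mul_prod_erase _ (fun m => y m (Function.update h n
            (⟨k, Nat.lt_succ_of_le hk⟩ : X.Loc n) m)) (Finset.mem_univ n),
            Function.update_self] at h1
          rw [Finset.prod_congr rfl (g := fun m => y m (h m)) (fun m hm => by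
            rw [Function.update_of_ne (Finset.ne_of_mem_erase hm)])] at h1
          refine Eq.trans ?_ h1
          congr 2
          funext m
          by_cases hm : m = n
          · subst hm; simp
          · simp [Function.update_of_ne hm, hh']
        rw [hupd (h' n - 1) ((Nat.sub_le _ _).trans (hb n)),
          ← Finset.mul_prod_erase _ (fun m => y m (h m)) (Finset.mem_univ n)]
        have h2 := hy n (h' n) (hb n)
        have h3 : X.a (X.xiShift n (h' n)) * (cov (Function.update h' n (h' n + 1)) ⬝ᵥ v)
            = X.a (X.xiShift n (h' n)) * (y n (h' n + 1)
              * ∏ m ∈ Finset.univ.erase n, y m (h m)) := by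
          rcases Nat.lt_or_ge (h' n) (X.twoS n) with hlt | hge
          · rw [hupd _ hlt]
          · rw [le_antisymm (hb n) hge, a_last, zero_mul, zero_mul]
        simp only [smul_eq_mul]
        linear_combination -h3 - (∏ m ∈ Finset.univ.erase n, y m (h m)) * h2

end XXZChain

/-! ### Polynomials in the exponential -/

namespace QDifference

section

variable {N : ℕ} {p q : ℂ} {m : Fin N → ℕ} {ζ : Fin N → ℂ} {τ : ℂ[X]}

theorem isSolution_coe_iff {P : ℂ[X]} : IsSolution p q m ζ τ P ↔
    oddPoly τ * P = -tailPoly q m ζ * P.comp (Polynomial.C p * Polynomial.X)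
      + headPoly ζ * P.comp (Polynomial.C q * Polynomial.X) := by
  rw [← (Polynomial.coe_injective ℂ).eq_iff]
  simp only [IsSolution, Polynomial.coe_mul, Polynomial.coe_add, Polynomial.coe_neg,
    coe_comp_C_mul_X]

theorem IsSolution.C_mul {P : ℂ[X]} (hP : IsSolution p q m ζ τ P) (c : ℂ) :
    IsSolution p q m ζ τ ((Polynomial.C c * P : ℂ[X]) : PowerSeries ℂ) := by
  rw [isSolution_coe_iff] at hP ⊢
  simp only [Polynomial.mul_comp, Polynomial.C_comp]
  linear_combination Polynomial.C c * hP

/-- A polynomial solution does not vanish at both first points `x` and `-x` of a string: otherwise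
it would also vanish at the next points `xp` and `-xp`, and `bodyPoly`, being a multiple of the
Wronskian, would have a double zero. -/
theorem IsSolution.eval_ne_zero (hpq : p * q = 1) (hq : ∀ n, 1 ≤ n → q ^ n ≠ 1)
    (hinj : StringInjective q m ζ) {P : ℂ[X]} (hP : IsSolution p q m ζ τ P) (hP0 : P.coeff 0 ≠ 0)
    {n : Fin N} (hn : 1 ≤ m n) {x : ℂ} (hx : ζ n * x ^ 2 = 1) (h1 : P.eval x = 0)
    (h2 : P.eval (-x) = 0) : False := by
  have hnext : ∀ y, ζ n * y ^ 2 = 1 → P.eval y = 0 → P.eval (p * y) = 0 := by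
    intro y hy hPy
    have h := congrArg (Polynomial.eval y) (isSolution_coe_iff.mp hP)
    simp only [Polynomial.eval_mul, Polynomial.eval_add, Polynomial.eval_neg, Polynomial.eval_comp,
      Polynomial.eval_C, Polynomial.eval_X, hPy, headPoly_eval_first hy, mul_zero, zero_mul,
      add_zero] at h
    have hA := tailPoly_eval_ne_zero hpq hinj hy (h := 0) (by omega)
    rw [pow_zero, mul_one] at hA
    exact (mul_eq_zero.mp h.symm).resolve_left (neg_ne_zero.mpr hA)
  have hx' : ζ n * (-x) ^ 2 = 1 := by rw [neg_sq]; exact hx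
  have h3 := hnext x hx h1
  have h4 := hnext (-x) hx' h2
  have hdvd : ∀ c : ℂ, (P.eval (c * x) = 0) → (P.eval (c * -x) = 0) →
      stringFactor (ζ n) ∣ P.comp (Polynomial.C c * Polynomial.X) := by
    intro c e1 e2
    exact stringFactor_dvd hx (by simpa using e1) (by simpa using e2)
  have hW := hP.wronskian_polynomial hpq hq
  have hsq : stringFactor (ζ n) * stringFactor (ζ n)
      ∣ Polynomial.C (2 * P.coeff 0 ^ 2) * bodyPoly q m ζ := by
    rw [← hW]
    refine dvd_add (mul_dvd_mul (stringFactor_dvd hx h1 h2) (hdvd _ ?_ ?_))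
      (mul_dvd_mul (hdvd _ ?_ ?_) (hdvd _ h3 h4))
    · simpa using h4
    · simpa using h3
    · simpa using h2
    · simpa using h1
  have hbody : bodyPoly q m ζ = stringFactor (ζ n) *
      ∏ l ∈ (Finset.univ.sigma fun n => Finset.range (m n)).erase (⟨n, 0⟩ : Σ _ : Fin N, ℕ),
        stringFactor (ζ l.1 * q ^ (2 * l.2)) := by
    rw [bodyPoly, Finset.prod_sigma', ← Finset.mul_prod_erase _ _ (a := (⟨n, 0⟩ : Σ _ : Fin N, ℕ))
      (Finset.mem_sigma.mpr ⟨Finset.mem_univ n, Finset.mem_range.mpr hn⟩)]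
    simp
  rw [hbody, mul_left_comm, mul_dvd_mul_iff_left (stringFactor_ne_zero _)] at hsq
  obtain ⟨R, hR⟩ := hsq
  have h5 := congrArg (Polynomial.eval x) hR
  rw [Polynomial.eval_mul, Polynomial.eval_C, Polynomial.eval_mul, eval_stringFactor, hx, sub_self,
    zero_mul, Polynomial.eval_prod] at h5
  have h6 := (mul_eq_zero.mp h5).resolve_left (mul_ne_zero two_ne_zero (pow_ne_zero 2 hP0))
  obtain ⟨⟨l, k⟩, hl, h7⟩ := Finset.prod_eq_zero_iff.mp h6
  rw [Finset.mem_erase, Finset.mem_sigma, Finset.mem_range] at hl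
  rw [eval_stringFactor] at h7
  have hx0 : x ^ 2 ≠ 0 := by intro h; simp [h] at hx
  have h8 : ζ l * q ^ (2 * k) = ζ n * q ^ (2 * 0) := by
    apply mul_right_cancel₀ hx0
    rw [mul_zero, pow_zero, mul_one, hx]
    linear_combination -h7
  obtain ⟨rfl, rfl⟩ := hinj l k n 0 hl.2.2.le (Nat.zero_le _) h8
  exact hl.1 rfl

end

end QDifference

theorem infinite_range_exp : (Set.range Complex.exp).Infinite := by
  rw [Complex.range_exp]
  exact (Set.finite_singleton (0 : ℂ)).infinite_compl

theorem Polynomial.eq_of_eval_exp_eq {P R : ℂ[X]}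
    (h : ∀ z, P.eval (Complex.exp z) = R.eval (Complex.exp z)) : P = R :=
  Polynomial.eq_of_infinite_eval_eq P R
    (infinite_range_exp.mono (by rintro _ ⟨z, rfl⟩; exact h z))

/-- If `g` is continuous on `ℂ` and `P(e^z) g(z) = R(e^z)` with `P(0) ≠ 0`, then `g` is a polynomial
in `e^z`. -/
theorem exists_polynomial_of_mul_eq {g : ℂ → ℂ} (hg : Continuous g) (k : ℕ) :
    ∀ P R : ℂ[X], P.natDegree = k → P.coeff 0 ≠ 0 →
      (∀ z, P.eval (Complex.exp z) * g z = R.eval (Complex.exp z)) →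
      ∃ S : ℂ[X], R = P * S ∧ ∀ z, g z = S.eval (Complex.exp z) := by
  induction k with
  | zero =>
    intro P R hP hP0 h
    rw [Polynomial.eq_C_of_natDegree_eq_zero hP] at h ⊢
    refine ⟨Polynomial.C (P.coeff 0)⁻¹ * R, ?_, fun z => ?_⟩
    · rw [← mul_assoc, ← Polynomial.C_mul, mul_inv_cancel₀ hP0, Polynomial.C_1, one_mul]
    · rw [Polynomial.eval_mul, ← h, Polynomial.eval_C, Polynomial.eval_C,
        inv_mul_cancel_left₀ hP0]
  | succ k ih =>
    intro P R hP hP0 h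
    obtain ⟨x, hx⟩ := IsAlgClosed.exists_root P (by
      intro h0
      have := Polynomial.natDegree_eq_zero_iff_degree_le_zero.mpr h0.le
      omega)
    have hx0 : x ≠ 0 := by
      rintro rfl
      rw [Polynomial.IsRoot, ← Polynomial.coeff_zero_eq_eval_zero] at hx
      exact hP0 hx
    obtain ⟨P', rfl⟩ := Polynomial.dvd_iff_isRoot.mpr hx
    have hRx : R.IsRoot x := by
      have := h (Complex.log x)
      rw [Complex.exp_log hx0, hx.eq_zero, zero_mul] at this
      exact this.symm
    obtain ⟨R', rfl⟩ := Polynomial.dvd_iff_isRoot.mpr hRx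
    have hP'0 : P' ≠ 0 := by rintro rfl; simp at hP
    rw [Polynomial.natDegree_mul (Polynomial.X_sub_C_ne_zero x) hP'0,
      Polynomial.natDegree_X_sub_C] at hP
    have hcoeff : P'.coeff 0 ≠ 0 := by
      rw [Polynomial.mul_coeff_zero] at hP0
      exact right_ne_zero_of_mul hP0
    obtain ⟨S, hS, hS'⟩ := ih P' R' (by omega) hcoeff (by
      have hc : (fun z => P'.eval (Complex.exp z) * g z) = fun z => R'.eval (Complex.exp z) := by
        have hdense : Dense {z | Complex.exp z ≠ x} := by
          have hcl : Dense (({x} : Set ℂ)ᶜ) := dense_compl_singleton x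
          exact hcl.preimage Complex.isOpenMap_exp
        refine Continuous.ext_on hdense ?_ ?_ ?_
        · exact (P'.continuous.comp Complex.continuous_exp).mul hg
        · exact R'.continuous.comp Complex.continuous_exp
        · intro z hz
          have h1 := h z
          simp only [Polynomial.eval_mul, Polynomial.eval_sub, Polynomial.eval_X,
            Polynomial.eval_C, mul_assoc] at h1
          exact mul_left_cancel₀ (sub_ne_zero.mpr hz) h1
      exact fun z => congrFun hc z)
    exact ⟨S, by rw [hS, mul_assoc], hS'⟩

theorem exists_comp_sq_of_even {S : ℂ[X]}
    (h : ∀ z, S.eval (-Complex.exp z) = S.eval (Complex.exp z)) {K : ℕ} (hS : S.natDegree ≤ 2 * K) :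
    ∃ r : ℂ[X], r.natDegree ≤ K ∧ ∀ x, S.eval x = r.eval (x ^ 2) := by
  have heven : S.comp (Polynomial.C (-1) * Polynomial.X) = S :=
    Polynomial.eq_of_eval_exp_eq fun z => by simpa using h z
  have hodd : ∀ i, ¬ 2 ∣ i → S.coeff i = 0 := by
    intro i hi
    have h1 := congrArg (fun R : ℂ[X] => R.coeff i) heven
    simp only [Polynomial.comp_C_mul_X_coeff] at h1
    rw [(Nat.not_even_iff_odd.mp (fun h => hi h.two_dvd)).neg_one_pow] at h1
    linear_combination -h1 / 2
  have hexp : Polynomial.expand ℂ 2 (Polynomial.contract 2 S) = S := by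
    ext i
    rw [Polynomial.coeff_expand two_pos]
    split_ifs with hi
    · rw [Polynomial.coeff_contract two_ne_zero, Nat.div_mul_cancel hi]
    · exact (hodd i hi).symm
  refine ⟨Polynomial.contract 2 S, ?_, fun x => ?_⟩
  · rw [Polynomial.natDegree_le_iff_coeff_eq_zero]
    intro i hi
    rw [Polynomial.coeff_contract two_ne_zero]
    exact Polynomial.coeff_eq_zero_of_natDegree_lt (by omega)
  · conv_lhs => rw [← hexp]
    exact Polynomial.expand_eval 2 _ x

namespace XXZChain

variable {N : ℕ} (X : XXZChain N)

/-- The function `e^{-N_s z / 2} P(e^z)`. -/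
noncomputable def halfPoly (P : ℂ[X]) (z : ℂ) : ℂ :=
  Complex.exp (-X.Ns * z / 2) * P.eval (Complex.exp z)

theorem prod_sinh_half (k : ℕ) (μ : Fin k → ℂ) :
    ∃ P : ℂ[X], P.natDegree ≤ k ∧ P.coeff k * P.coeff 0 = (-1 / 4) ^ k ∧
      ∀ z, ∏ j, Complex.sinh ((z - μ j) / 2)
        = Complex.exp (-k * z / 2) * P.eval (Complex.exp z) := by
  induction k with
  | zero => exact ⟨1, by simp, by simp, by simp⟩
  | succ k ih =>
    obtain ⟨P, hP1, hP2, hP3⟩ := ih (fun j => μ j.succ)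
    set u : ℂ := Complex.exp (-μ 0 / 2) / 2 with hu
    set v : ℂ := -Complex.exp (μ 0 / 2) / 2 with hv
    have huv : u * v = -1 / 4 := by
      have : Complex.exp (-μ 0 / 2) * Complex.exp (μ 0 / 2) = 1 := by
        rw [← Complex.exp_add, neg_div, neg_add_cancel, Complex.exp_zero]
      rw [hu, hv]; linear_combination -this / 4
    have hF : (Polynomial.C u * Polynomial.X + Polynomial.C v).natDegree ≤ 1 := by compute_degree
    refine ⟨(Polynomial.C u * Polynomial.X + Polynomial.C v) * P, ?_, ?_, fun z => ?_⟩
    · exact Polynomial.natDegree_mul_le.trans (by omega)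
    · rw [add_comm k 1, Polynomial.coeff_mul_add_eq_of_natDegree_le hF hP1,
        Polynomial.mul_coeff_zero]
      simp only [Polynomial.coeff_add, Polynomial.coeff_C_mul, Polynomial.coeff_X_one,
        Polynomial.coeff_X_zero, Polynomial.coeff_C_succ, mul_one, mul_zero,
        add_zero, zero_add, Polynomial.coeff_C, if_true]
      rw [pow_add, pow_one, ← hP2]
      linear_combination (P.coeff k * P.coeff 0) * huv
    · rw [Fin.prod_univ_succ, hP3]
      simp only [Polynomial.eval_mul, Polynomial.eval_add, Polynomial.eval_C, Polynomial.eval_X,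
        Complex.sinh, hu, hv]
      rw [show -((k + 1 : ℕ) : ℂ) * z / 2 = -(z / 2) + -k * z / 2 by push_cast; ring,
        Complex.exp_add, show -((z - μ 0) / 2) = -(z / 2) + μ 0 / 2 by ring,
        show (z - μ 0) / 2 = -(z / 2) + (-μ 0 / 2 + z) by ring, Complex.exp_add _ (-μ 0 / 2 + z),
        Complex.exp_add (-μ 0 / 2), Complex.exp_add (-(z / 2)) (μ 0 / 2)]
      ring

theorem exists_prod_sinh_half (k : ℕ) : ∀ P : ℂ[X], P.natDegree ≤ k → P.coeff k ≠ 0 →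
    P.coeff 0 ≠ 0 → ∃ c : ℂ, c ≠ 0 ∧ ∃ μ : Fin k → ℂ, ∀ z,
      c * (Complex.exp (-k * z / 2) * P.eval (Complex.exp z))
        = ∏ j, Complex.sinh ((z - μ j) / 2) := by
  induction k with
  | zero =>
    intro P hP hk h0
    refine ⟨(P.coeff 0)⁻¹, inv_ne_zero h0, fun j => 0, fun z => ?_⟩
    rw [Polynomial.eq_C_of_natDegree_le_zero hP]
    simp [h0]
  | succ k ih =>
    intro P hP hk h0
    have hdeg : P.natDegree = k + 1 := Polynomial.natDegree_eq_of_le_of_coeff_ne_zero hP hk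
    obtain ⟨x, hx⟩ := IsAlgClosed.exists_root P (by
      intro h
      have := Polynomial.natDegree_eq_zero_iff_degree_le_zero.mpr h.le
      omega)
    obtain ⟨P', rfl⟩ := Polynomial.dvd_iff_isRoot.mpr hx
    have hP'0 : P' ≠ 0 := by rintro rfl; simp at h0
    rw [Polynomial.natDegree_mul (Polynomial.X_sub_C_ne_zero x) hP'0,
      Polynomial.natDegree_X_sub_C] at hdeg
    rw [Polynomial.mul_coeff_zero] at h0
    have hx0 : x ≠ 0 := by
      rintro rfl
      simp at h0
    have hdeg' : P'.natDegree = k := by omega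
    obtain ⟨c, hc, μ, hμ⟩ := ih P' hdeg'.le
      (by rw [← hdeg', Polynomial.coeff_natDegree]; exact Polynomial.leadingCoeff_ne_zero.mpr hP'0)
      (right_ne_zero_of_mul h0)
    set b := Complex.log x with hb
    refine ⟨c * (Complex.exp (-b / 2) / 2),
      mul_ne_zero hc (div_ne_zero (Complex.exp_ne_zero _) two_ne_zero), Fin.cons b μ, fun z => ?_⟩
    rw [Fin.prod_univ_succ]
    simp only [Fin.cons_zero, Fin.cons_succ]
    rw [← hμ]
    simp only [Polynomial.eval_mul, Polynomial.eval_sub, Polynomial.eval_C, Polynomial.eval_X,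
        Complex.sinh]
    rw [show x = Complex.exp (b / 2) * Complex.exp (b / 2) by
      rw [← Complex.exp_add, add_halves, hb, Complex.exp_log hx0]]
    have e1 : Complex.exp (-b / 2) * Complex.exp (b / 2) = 1 := by
      rw [← Complex.exp_add, neg_div, neg_add_cancel, Complex.exp_zero]
    rw [show -((k + 1 : ℕ) : ℂ) * z / 2 = -(z / 2) + -k * z / 2 by push_cast; ring,
        Complex.exp_add, show -((z - b) / 2) = -(z / 2) + b / 2 by ring,
        show (z - b) / 2 = -(z / 2) + (-b / 2 + z) by ring, Complex.exp_add _ (-b / 2 + z),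
        Complex.exp_add (-b / 2), Complex.exp_add (-(z / 2)) (b / 2)]
    linear_combination (-(c / 2) * Complex.exp (-(z / 2)) * Complex.exp (-k * z / 2)
      * P'.eval (Complex.exp z) * Complex.exp (b / 2)) * e1

theorem IsQForm.exists_halfPoly {Q : ℂ → ℂ} (hQ : X.IsQForm Q) :
    ∃ P : ℂ[X], P.natDegree ≤ X.Ns ∧ P.coeff X.Ns * P.coeff 0 = (-1 / 4) ^ X.Ns ∧
      Q = X.halfPoly P := by
  obtain ⟨μ, hμ⟩ := hQ
  obtain ⟨P, h1, h2, h3⟩ := prod_sinh_half X.Ns μ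
  exact ⟨P, h1, h2, funext fun z => by rw [hμ, h3, halfPoly]⟩

theorem exists_isQForm {P : ℂ[X]} (h1 : P.natDegree ≤ X.Ns) (h2 : P.coeff X.Ns ≠ 0)
    (h3 : P.coeff 0 ≠ 0) : ∃ c : ℂ, c ≠ 0 ∧ X.IsQForm (X.halfPoly (Polynomial.C c * P)) := by
  obtain ⟨c, hc, μ, hμ⟩ := exists_prod_sinh_half X.Ns P h1 h2 h3
  refine ⟨c, hc, μ, fun z => ?_⟩
  rw [← hμ, halfPoly, Polynomial.eval_mul, Polynomial.eval_C]
  ring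

theorem halfPoly_C_mul (c : ℂ) (P : ℂ[X]) (z : ℂ) :
    X.halfPoly (Polynomial.C c * P) z = c * X.halfPoly P z := by
  rw [halfPoly, halfPoly, Polynomial.eval_mul, Polynomial.eval_C]; ring

theorem halfPoly_injective {P R : ℂ[X]} (h : X.halfPoly P = X.halfPoly R) : P = R := by
  refine Polynomial.eq_of_eval_exp_eq fun z => ?_
  exact mul_left_cancel₀ (Complex.exp_ne_zero _) (congrFun h z)

theorem IsQForm.add_two_pi {Q : ℂ → ℂ} (hQ : X.IsQForm Q) (z : ℂ) :
    Q (z + Complex.I * Real.pi + Complex.I * Real.pi) = (-1) ^ X.Ns * Q z := by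
  obtain ⟨μ, hμ⟩ := hQ
  rw [hμ, hμ]
  have : ∀ j, Complex.sinh ((z + Complex.I * Real.pi + Complex.I * Real.pi - μ j) / 2)
      = -Complex.sinh ((z - μ j) / 2) := by
    intro j
    rw [show (z + Complex.I * Real.pi + Complex.I * Real.pi - μ j) / 2
      = (z - μ j) / 2 + Real.pi * Complex.I by ring, Complex.sinh_add, Complex.sinh_mul_I,
      Complex.cosh_mul_I, Complex.sin_pi, Complex.cos_pi]
    ring
  simp only [this, Finset.prod_neg, Finset.card_univ, Fintype.card_fin]

theorem IsQForm.differentiable {Q : ℂ → ℂ} (hQ : X.IsQForm Q) : Differentiable ℂ Q := by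
  obtain ⟨μ, hμ⟩ := hQ
  rw [show Q = fun z => ∏ j, Complex.sinh ((z - μ j) / 2) from funext hμ]
  exact Differentiable.fun_finsetProd fun j _ => by fun_prop

end XXZChain

/-! ### The Baxter equation as a polynomial difference equation -/

namespace XXZChain

open QDifference

variable {N : ℕ} (X : XXZChain N)

/-- The parameter `ζₙ = e^{-2 ξₙ^{(0)}}` of the `n`-th string in the variable `e^z`. -/
noncomputable def zeta (n : Fin N) : ℂ := Complex.exp (-2 * X.xiShift n 0)

/-- `τ` describes `t` in the variable `e^z`, with the normalization in which the Baxter equation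
becomes the difference equation `IsSolution`. -/
def HasPoly (τ : ℂ[X]) (t : ℂ → ℂ) : Prop :=
  ∀ z, t z = (-1 / 2) ^ N * Complex.exp (∑ n, X.ξ n) * Complex.exp (-((N : ℂ) - 1) * z)
    * τ.eval (Complex.exp z ^ 2)

theorem zeta_ne_zero (n : Fin N) : X.zeta n ≠ 0 := Complex.exp_ne_zero _

theorem zeta_mul_pow (n : Fin N) (k : ℕ) :
    X.zeta n * Complex.exp X.η ^ (2 * k) = Complex.exp (-2 * X.xiShift n k) := by
  rw [zeta, ← Complex.exp_nat_mul, ← Complex.exp_add]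
  congr 1
  simp only [xiShift]; push_cast; ring

theorem zeta_mul_sq (n : Fin N) : X.zeta n * Complex.exp (X.xiShift n 0) ^ 2 = 1 := by
  rw [zeta, ← Complex.exp_nat_mul, ← Complex.exp_add, ← Complex.exp_zero]
  congr 1; push_cast; ring

theorem exp_neg_eta_mul : Complex.exp (-X.η) * Complex.exp X.η = 1 := by
  rw [← Complex.exp_add, neg_add_cancel, Complex.exp_zero]

theorem exp_xiShift (n : Fin N) (k : ℕ) :
    Complex.exp (X.xiShift n k) = Complex.exp (X.xiShift n 0) * Complex.exp (-X.η) ^ k := by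
  rw [← Complex.exp_nat_mul, ← Complex.exp_add]
  congr 1
  simp only [xiShift]; push_cast; ring

variable {X}

theorem Generic.stringInjective (hX : X.Generic) :
    StringInjective (Complex.exp X.η) X.twoS X.zeta := by
  intro i h j h' hh hh' heq
  rw [zeta_mul_pow, zeta_mul_pow] at heq
  refine hX.eq_of_sinh_eq_zero hh hh' ?_
  have h1 : Complex.exp (X.xiShift i h - X.xiShift j h')
      * Complex.exp (X.xiShift i h - X.xiShift j h') = 1 := by
    rw [← Complex.exp_add, show X.xiShift i h - X.xiShift j h' + (X.xiShift i h - X.xiShift j h')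
      = -2 * X.xiShift j h' - -2 * X.xiShift i h by ring, Complex.exp_sub, heq,
      div_self (Complex.exp_ne_zero _)]
  rw [Complex.sinh, Complex.exp_neg, ← eq_inv_of_mul_eq_one_left h1, sub_self, zero_div]

variable (X)

theorem sinh_sub_xiShift (z : ℂ) (n : Fin N) (k : ℕ) :
    Complex.sinh (z - X.xiShift n k) = (-1 / 2) * Complex.exp (-z) * Complex.exp (X.xiShift n k)
      * (1 - X.zeta n * Complex.exp X.η ^ (2 * k) * Complex.exp z ^ 2) := by
  rw [zeta_mul_pow, Complex.sinh, ← Complex.exp_nat_mul]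
  have e1 : Complex.exp (z - X.xiShift n k) = Complex.exp (-z) * Complex.exp (X.xiShift n k)
      * (Complex.exp (-2 * X.xiShift n k) * Complex.exp ((2 : ℕ) * z)) := by
    rw [← Complex.exp_add, ← Complex.exp_add, ← Complex.exp_add]
    congr 1; push_cast; ring
  have e2 : Complex.exp (-(z - X.xiShift n k))
      = Complex.exp (-z) * Complex.exp (X.xiShift n k) := by
    rw [← Complex.exp_add]; congr 1; ring
  rw [e1, e2]; ring

theorem sum_spin_mul : ∑ n, X.spin n * X.η = X.Ns * X.η / 2 := by
  rw [← Finset.sum_mul, Ns]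
  simp only [spin]
  rw [← Finset.sum_div]; push_cast; ring

theorem a_eq_eval (z : ℂ) : X.a z = (-1 / 2) ^ N * Complex.exp (-N * z)
    * Complex.exp (∑ n, X.ξ n) * Complex.exp (-(X.Ns * X.η / 2))
    * (tailPoly (Complex.exp X.η) X.twoS X.zeta).eval (Complex.exp z) := by
  rw [a_eq, eval_tailPoly]
  simp only [sinh_sub_xiShift]
  rw [Finset.prod_mul_distrib, Finset.prod_mul_distrib, Finset.prod_const, Finset.card_univ,
    Fintype.card_fin, mul_pow, ← Complex.exp_sum, ← Complex.exp_nat_mul]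
  have : ∑ n, X.xiShift n (X.twoS n) = ∑ n, X.ξ n + -(X.Ns * X.η / 2) := by
    rw [← sum_spin_mul, ← Finset.sum_neg_distrib, ← Finset.sum_add_distrib]
    refine Finset.sum_congr rfl fun n _ => ?_
    simp only [xiShift, spin]; ring
  rw [this, Complex.exp_add, mul_neg, neg_mul]
  ring

theorem d_eq_eval (z : ℂ) : X.d z = (-1 / 2) ^ N * Complex.exp (-N * z)
    * Complex.exp (∑ n, X.ξ n) * Complex.exp (X.Ns * X.η / 2)
    * (headPoly X.zeta).eval (Complex.exp z) := by
  rw [d_eq, eval_headPoly]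
  simp only [sinh_sub_xiShift]
  rw [Finset.prod_mul_distrib, Finset.prod_mul_distrib, Finset.prod_const, Finset.card_univ,
    Fintype.card_fin, mul_pow, ← Complex.exp_sum, ← Complex.exp_nat_mul]
  have : ∑ n, X.xiShift n 0 = ∑ n, X.ξ n + X.Ns * X.η / 2 := by
    rw [← sum_spin_mul, ← Finset.sum_add_distrib]
    refine Finset.sum_congr rfl fun n _ => ?_
    simp only [xiShift, spin]; push_cast; ring
  rw [this, Complex.exp_add, mul_neg, neg_mul]
  simp only [mul_zero, pow_zero, mul_one]
  ring

theorem halfPoly_sub (P : ℂ[X]) (z : ℂ) : X.halfPoly P (z - X.η)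
    = Complex.exp (-X.Ns * z / 2) * Complex.exp (X.Ns * X.η / 2)
      * P.eval (Complex.exp (-X.η) * Complex.exp z) := by
  rw [halfPoly, ← Complex.exp_add, ← Complex.exp_add]
  congr 2
  · ring
  · congr 1; ring

theorem halfPoly_add (P : ℂ[X]) (z : ℂ) : X.halfPoly P (z + X.η)
    = Complex.exp (-X.Ns * z / 2) * Complex.exp (-(X.Ns * X.η / 2))
      * P.eval (Complex.exp X.η * Complex.exp z) := by
  rw [halfPoly, ← Complex.exp_add, ← Complex.exp_add]
  congr 2
  · ring
  · congr 1; ring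

theorem halfPoly_add_pi (P : ℂ[X]) (z : ℂ) : X.halfPoly P (z + Complex.I * Real.pi)
    = (-Complex.I) ^ X.Ns * (Complex.exp (-X.Ns * z / 2) * P.eval (-Complex.exp z)) := by
  have h1 : Complex.exp (z + Complex.I * Real.pi) = -Complex.exp z := by
    rw [Complex.exp_add, mul_comm Complex.I, Complex.exp_pi_mul_I]; ring
  have h2 : Complex.exp (-X.Ns * (z + Complex.I * Real.pi) / 2)
      = (-Complex.I) ^ X.Ns * Complex.exp (-X.Ns * z / 2) := by
    have h3 : -Complex.I = Complex.exp (-(Real.pi / 2 * Complex.I)) := by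
      rw [Complex.exp_neg, Complex.exp_pi_div_two_mul_I, Complex.inv_I]
    rw [h3, ← Complex.exp_nat_mul, ← Complex.exp_add]
    congr 1; ring
  rw [halfPoly, h1, h2, mul_assoc]

/-- The Baxter equation as a polynomial difference equation. -/
theorem baxter_halfPoly_iff {τ : ℂ[X]} {t : ℂ → ℂ} (ht : X.HasPoly τ t) (P : ℂ[X]) :
    X.Baxter t (X.halfPoly P)
      ↔ IsSolution (Complex.exp (-X.η)) (Complex.exp X.η) X.twoS X.zeta τ P := by
  have hG : Complex.exp (-(X.Ns * X.η / 2)) * Complex.exp (X.Ns * X.η / 2) = 1 := by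
    rw [← Complex.exp_add, neg_add_cancel, Complex.exp_zero]
  have key : ∀ z, (-1 / 2) ^ N * Complex.exp (-N * z) * Complex.exp (∑ n, X.ξ n)
        * Complex.exp (-X.Ns * z / 2) * ((oddPoly τ).eval (Complex.exp z) * P.eval (Complex.exp z)
        + (tailPoly (Complex.exp X.η) X.twoS X.zeta).eval (Complex.exp z)
          * P.eval (Complex.exp (-X.η) * Complex.exp z)
        - (headPoly X.zeta).eval (Complex.exp z) * P.eval (Complex.exp X.η * Complex.exp z))
      = t z * X.halfPoly P z
        - (-X.a z * X.halfPoly P (z - X.η) + X.d z * X.halfPoly P (z + X.η)) := by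
    intro z
    rw [a_eq_eval, d_eq_eval, halfPoly_sub, halfPoly_add, ht z, halfPoly, eval_oddPoly,
      show -((N : ℂ) - 1) * z = -N * z + z by ring, Complex.exp_add]
    linear_combination ((-1 / 2) ^ N * Complex.exp (-N * z) * Complex.exp (∑ n, X.ξ n)
      * Complex.exp (-X.Ns * z / 2)
      * ((headPoly X.zeta).eval (Complex.exp z) * P.eval (Complex.exp X.η * Complex.exp z)
        - (tailPoly (Complex.exp X.η) X.twoS X.zeta).eval (Complex.exp z)
          * P.eval (Complex.exp (-X.η) * Complex.exp z))) * hG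
  have hne : ∀ z, (-1 / 2) ^ N * Complex.exp (-N * z) * Complex.exp (∑ n, X.ξ n)
        * Complex.exp (-X.Ns * z / 2) ≠ 0 := fun z =>
    mul_ne_zero (mul_ne_zero (mul_ne_zero (pow_ne_zero _ (by norm_num)) (Complex.exp_ne_zero _))
      (Complex.exp_ne_zero _)) (Complex.exp_ne_zero _)
  rw [isSolution_coe_iff]
  constructor
  · intro h
    refine Polynomial.eq_of_eval_exp_eq fun z => ?_
    have h1 := key z
    rw [h z, sub_self] at h1
    have h2 := (mul_eq_zero.mp h1).resolve_left (hne z)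
    simp only [Polynomial.eval_mul, Polynomial.eval_add, Polynomial.eval_neg, Polynomial.eval_comp,
      Polynomial.eval_C, Polynomial.eval_X]
    linear_combination h2
  · intro h z
    have h1 := congrArg (Polynomial.eval (Complex.exp z)) h
    simp only [Polynomial.eval_mul, Polynomial.eval_add, Polynomial.eval_neg, Polynomial.eval_comp,
      Polynomial.eval_C, Polynomial.eval_X] at h1
    rw [← sub_eq_zero, ← key z, h1]
    ring

theorem _root_.TrigPoly.exists_hasPoly {t : ℂ → ℂ} (hN : 1 ≤ N) (ht : TrigPoly (N - 1) t) :
    ∃ τ : ℂ[X], τ.natDegree ≤ N - 1 ∧ X.HasPoly τ t := by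
  obtain ⟨r, hr, hr'⟩ := ht
  have hE : (-1 / 2 : ℂ) ^ N * Complex.exp (∑ n, X.ξ n) ≠ 0 :=
    mul_ne_zero (pow_ne_zero _ (by norm_num)) (Complex.exp_ne_zero _)
  refine ⟨Polynomial.C ((-1 / 2 : ℂ) ^ N * Complex.exp (∑ n, X.ξ n))⁻¹ * r,
    (Polynomial.natDegree_C_mul_le _ _).trans hr, fun z => ?_⟩
  rw [hr', Polynomial.eval_mul, Polynomial.eval_C, Nat.cast_sub hN, ← Complex.exp_nat_mul]
  push_cast
  field_simp

/-- The discrete Baxter equations are those of `StringSolvable`, up to a rescaling of the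
solutions. -/
theorem DiscreteBaxter.stringSolvable {t : ℂ → ℂ} (ht : X.DiscreteBaxter t) {τ : ℂ[X]}
    (hτ : X.HasPoly τ t) :
    StringSolvable (Complex.exp (-X.η)) (Complex.exp X.η) X.twoS X.zeta τ := by
  intro n
  obtain ⟨y, hy0, hy⟩ := ht.2 n
  set G := Complex.exp (X.Ns * X.η / 2) with hGdef
  have hG0 : G ≠ 0 := Complex.exp_ne_zero _
  refine ⟨Complex.exp (X.xiShift n 0), X.zeta_mul_sq n, fun k => G⁻¹ ^ k * y k,
    by simpa using hy0, fun k hk => ?_⟩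
  have h1 := hy k hk
  have hGi : Complex.exp (-(X.Ns * X.η / 2)) = G⁻¹ := by rw [hGdef, Complex.exp_neg]
  rw [hτ, a_eq_eval, d_eq_eval, show -((N : ℂ) - 1) * X.xiShift n k
    = -N * X.xiShift n k + X.xiShift n k by ring, Complex.exp_add, exp_xiShift X n k, ← hGdef,
    hGi] at h1
  rw [eval_oddPoly]
  have hne : (-1 / 2) ^ N * Complex.exp (-N * X.xiShift n k) * Complex.exp (∑ n, X.ξ n) ≠ 0 :=
    mul_ne_zero (mul_ne_zero (pow_ne_zero _ (by norm_num)) (Complex.exp_ne_zero _))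
      (Complex.exp_ne_zero _)
  apply mul_left_cancel₀ hne
  rcases k with _ | k
  · rw [show (headPoly X.zeta).eval (Complex.exp (X.xiShift n 0) * Complex.exp (-X.η) ^ 0) = 0 by
      rw [pow_zero, mul_one]; exact headPoly_eval_first (X.zeta_mul_sq n)] at h1 ⊢
    linear_combination h1
  · simp only [Nat.add_sub_cancel] at h1 ⊢
    have hGG : G⁻¹ * G = 1 := inv_mul_cancel₀ hG0
    linear_combination (G⁻¹ ^ (k + 1)) * h1
      + ((-1 / 2) ^ N * Complex.exp (-N * X.xiShift n (k + 1)) * Complex.exp (∑ n, X.ξ n)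
        * (headPoly X.zeta).eval (Complex.exp (X.xiShift n 0) * Complex.exp (-X.η) ^ (k + 1))
        * G⁻¹ ^ k * y k) * hGG

/-- The sum of all the points `ξₙ^{(h)}` with `h < 2 sₙ`. -/
noncomputable def bodySum : ℂ := ∑ n, ∑ h ∈ Finset.range (X.twoS n), X.xiShift n h

theorem d_mul_w (hs : ∀ n, 1 ≤ X.twoS n) (ε : ℤ) (z : ℂ) : X.d z * X.w ε z
    = 2 * ε * (Complex.I / 2) ^ X.Ns
      * ∏ n, ∏ h ∈ Finset.range (X.twoS n), Complex.sinh (z - X.xiShift n h) := by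
  have h1 : ∀ n, ∏ h ∈ Finset.range (X.twoS n), Complex.sinh (z - X.xiShift n h)
      = Complex.sinh (z - X.xiShift n 0)
        * ∏ h ∈ Finset.Icc 1 (X.twoS n - 1), Complex.sinh (z - X.xiShift n h) := by
    intro n
    have h2 : Finset.range (X.twoS n) = insert 0 (Finset.Icc 1 (X.twoS n - 1)) := by
      ext k
      have := hs n
      simp only [Finset.mem_range, Finset.mem_insert, Finset.mem_Icc]
      omega
    rw [h2, Finset.prod_insert (by simp)]
  simp only [h1]
  rw [Finset.prod_mul_distrib, ← d_eq, w]
  ring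

theorem a_mul_w (hs : ∀ n, 1 ≤ X.twoS n) (ε : ℤ) (z : ℂ) :
    X.a z * X.w ε z = X.d (z + X.η) * X.w ε (z + X.η) := by
  rw [X.d_mul_w hs, a_eq, w, mul_left_comm, ← Finset.prod_mul_distrib]
  congr 1
  refine Finset.prod_congr rfl fun n _ => ?_
  obtain ⟨k, hk⟩ : ∃ k, X.twoS n = k + 1 := ⟨X.twoS n - 1, by have := hs n; omega⟩
  have h1 : ∀ h : ℕ, Complex.sinh (z + X.η - X.xiShift n h)
      = Complex.sinh (z - X.xiShift n (h + 1)) := by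
    intro h; rw [xiShift_succ]; congr 1; ring
  simp only [h1]
  rw [hk, Finset.prod_range_succ, mul_comm, Nat.add_sub_cancel, Finset.range_eq_Ico,
    Finset.prod_Ico_add' (fun h => Complex.sinh (z - X.xiShift n h)) 0 k 1]
  rfl

theorem d_mul_w_eq_eval (hs : ∀ n, 1 ≤ X.twoS n) (ε : ℤ) (z : ℂ) : X.d z * X.w ε z
    = 2 * ε * (Complex.I / 2) ^ X.Ns * (-1 / 2) ^ X.Ns * Complex.exp X.bodySum
      * Complex.exp (-X.Ns * z)
      * (bodyPoly (Complex.exp X.η) X.twoS X.zeta).eval (Complex.exp z) := by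
  rw [X.d_mul_w hs, eval_bodyPoly]
  simp only [sinh_sub_xiShift, Finset.prod_mul_distrib, Finset.prod_const, Finset.card_range]
  rw [Finset.prod_pow_eq_pow_sum, Finset.prod_pow_eq_pow_sum, ← Ns, ← Complex.exp_nat_mul]
  simp only [← Complex.exp_sum]
  rw [← bodySum, mul_neg, neg_mul]
  ring

theorem exists_d_mul_w_ne_zero (hs : ∀ n, 1 ≤ X.twoS n) {ε : ℤ} (hε : ε ≠ 0) :
    ∃ z, X.d z * X.w ε z ≠ 0 := by
  by_contra! h
  have hb : bodyPoly (Complex.exp X.η) X.twoS X.zeta = 0 := by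
    refine Polynomial.eq_of_eval_exp_eq fun z => ?_
    have h1 := h z
    rw [X.d_mul_w_eq_eval hs] at h1
    rw [Polynomial.eval_zero]
    refine (mul_eq_zero.mp h1).resolve_left ?_
    have hI : (Complex.I / 2) ≠ 0 := div_ne_zero Complex.I_ne_zero two_ne_zero
    refine mul_ne_zero (mul_ne_zero (mul_ne_zero (mul_ne_zero (mul_ne_zero two_ne_zero ?_)
      (pow_ne_zero _ hI)) (pow_ne_zero _ (by norm_num))) (Complex.exp_ne_zero _))
      (Complex.exp_ne_zero _)
    exact_mod_cast hε
  exact one_ne_zero ((coeff_zero_bodyPoly (Complex.exp X.η) X.twoS X.zeta).symm.trans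
    (by rw [hb, Polynomial.coeff_zero]))

theorem w_differentiable (ε : ℤ) : Differentiable ℂ (X.w ε) := by
  unfold w
  exact (Differentiable.fun_finsetProd fun n _ => Differentiable.fun_finsetProd fun h _ => by
    fun_prop).const_mul _

theorem d_differentiable : Differentiable ℂ X.d := by
  unfold d
  exact Differentiable.fun_finsetProd fun n _ => by fun_prop

theorem a_differentiable : Differentiable ℂ X.a := by
  unfold a
  exact Differentiable.fun_finsetProd fun n _ => by fun_prop

theorem sinh_add_pi (z : ℂ) : Complex.sinh (z + Complex.I * Real.pi) = -Complex.sinh z := by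
  rw [mul_comm, Complex.sinh_add, Complex.sinh_mul_I, Complex.cosh_mul_I, Complex.sin_pi,
    Complex.cos_pi]
  ring

theorem a_add_pi (z : ℂ) : X.a (z + Complex.I * Real.pi) = (-1) ^ N * X.a z := by
  rw [a_eq, a_eq]
  simp only [add_sub_right_comm, sinh_add_pi, Finset.prod_neg, Finset.card_univ, Fintype.card_fin]

theorem d_add_pi (z : ℂ) : X.d (z + Complex.I * Real.pi) = (-1) ^ N * X.d z := by
  rw [d_eq, d_eq]
  simp only [add_sub_right_comm, sinh_add_pi, Finset.prod_neg, Finset.card_univ, Fintype.card_fin]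

theorem w_add_pi (ε : ℤ) (z : ℂ) : X.w ε (z + Complex.I * Real.pi)
    = (-1) ^ (∑ n, (X.twoS n - 1)) * X.w ε z := by
  rw [w, w]
  simp only [add_sub_right_comm, sinh_add_pi, Finset.prod_neg, Nat.card_Icc,
    Nat.add_sub_cancel, Finset.prod_mul_distrib, Finset.prod_pow_eq_pow_sum]
  ring

end XXZChain

/-! ### Wronskian identity, admissibility and uniqueness -/

namespace XXZChain

open QDifference

variable {N : ℕ} {X : XXZChain N}

theorem prod_zeta_mul_pow : ∏ n, ∏ h ∈ Finset.range (X.twoS n),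
    (X.zeta n * Complex.exp X.η ^ (2 * h)) = Complex.exp (-2 * X.bodySum) := by
  simp only [zeta_mul_pow, bodySum, ← Complex.exp_sum, Finset.mul_sum]

/-- The Wronskian of `Q` and `Q(· + iπ)` is `ε d w₁` for a constant `ε`. The product of the constant
and the top coefficient of `P` being fixed, comparison of the top coefficients on both sides gives
`ε² = 1`. -/
theorem Generic.exists_wronskianIdentity (hX : X.Generic) (hs : ∀ n, 1 ≤ X.twoS n) {τ P : ℂ[X]}
    (hdeg : P.natDegree ≤ X.Ns) (hP : P.coeff X.Ns * P.coeff 0 = (-1 / 4) ^ X.Ns)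
    (hsol : IsSolution (Complex.exp (-X.η)) (Complex.exp X.η) X.twoS X.zeta τ P) :
    ∃ ε : ℤ, (ε = 1 ∨ ε = -1) ∧ X.WronskianIdentity ε (X.halfPoly P) := by
  set G := Complex.exp (X.Ns * X.η / 2) with hG
  have hcs := hsol.coeff_sq X.exp_neg_eta_mul hX.exp_pow_ne_one X.zeta_ne_zero hdeg
  rw [prod_zeta_mul_pow, ← Ns] at hcs
  have hGp : G ^ 2 * Complex.exp (-X.η) ^ X.Ns = 1 := by
    rw [hG, ← Complex.exp_nat_mul, ← Complex.exp_nat_mul, ← Complex.exp_add, ← Complex.exp_zero]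
    congr 1; push_cast; ring
  have hb2 : Complex.exp (-X.bodySum) ^ 2 = Complex.exp (-2 * X.bodySum) := by
    rw [← Complex.exp_nat_mul]; congr 1; push_cast; ring
  have hb : Complex.exp (-X.bodySum) * Complex.exp X.bodySum = 1 := by
    rw [← Complex.exp_add, neg_add_cancel, Complex.exp_zero]
  set e : ℂ := P.coeff 0 ^ 2 * G * 4 ^ X.Ns * Complex.exp (-X.bodySum) with he
  have h16 : ((-1 / 4 : ℂ) ^ X.Ns) ^ 2 * ((4 : ℂ) ^ X.Ns) ^ 2 = 1 := by
    rw [← mul_pow, ← mul_pow, ← pow_mul, mul_comm X.Ns 2, pow_mul]; norm_num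
  have he2 : e ^ 2 = 1 := by
    rw [he]
    calc _ = P.coeff 0 ^ 2 * G ^ 2 * (4 ^ X.Ns) ^ 2
          * (P.coeff 0 ^ 2 * Complex.exp (-X.bodySum) ^ 2) := by ring
      _ = ((P.coeff X.Ns * P.coeff 0) ^ 2 * (4 ^ X.Ns) ^ 2)
          * (G ^ 2 * Complex.exp (-X.η) ^ X.Ns) := by rw [hb2, ← hcs]; ring
      _ = 1 := by rw [hP, h16, hGp, one_mul]
  obtain ⟨ε, hε, hεe⟩ : ∃ ε : ℤ, (ε = 1 ∨ ε = -1) ∧ (ε : ℂ) = e := by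
    rcases sq_eq_sq_iff_eq_or_eq_neg.mp (he2.trans (one_pow 2).symm) with h | h
    · exact ⟨1, Or.inl rfl, by rw [h]; norm_num⟩
    · exact ⟨-1, Or.inr rfl, by rw [h]; norm_num⟩
  refine ⟨ε, hε, fun z => ?_⟩
  have hW := congrArg (Polynomial.eval (Complex.exp z))
    (hsol.wronskian_polynomial X.exp_neg_eta_mul hX.exp_pow_ne_one)
  simp only [Polynomial.eval_mul, Polynomial.eval_add, Polynomial.eval_comp,
    Polynomial.eval_C, Polynomial.eval_X] at hW
  have h4 : (Complex.I / 2) ^ X.Ns * (-1 / 2) ^ X.Ns * 4 ^ X.Ns = (-Complex.I) ^ X.Ns := by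
    rw [← mul_pow, ← mul_pow]; congr 1; ring
  have hE : Complex.exp (-X.Ns * z / 2) * Complex.exp (-X.Ns * z / 2)
      = Complex.exp (-X.Ns * z) := by
    rw [← Complex.exp_add]; congr 1; ring
  have hE' : Complex.exp (-X.Ns * (z - X.η) / 2) = Complex.exp (-X.Ns * z / 2) * G := by
    rw [hG, ← Complex.exp_add]; congr 1; ring
  have hx : Complex.exp (z - X.η) = Complex.exp (-X.η) * Complex.exp z := by
    rw [← Complex.exp_add]; congr 1; ring
  rw [X.d_mul_w_eq_eval hs, hεe, he, add_sub_right_comm, halfPoly_add_pi, halfPoly_add_pi,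
    halfPoly_sub, hE', hx, halfPoly, ← hE, ← hG]
  rw [neg_mul, neg_one_mul] at hW
  set E := Complex.exp (-X.Ns * z / 2)
  calc _ = (-Complex.I) ^ X.Ns * E * E * G * (P.eval (Complex.exp z)
          * P.eval (-(Complex.exp (-X.η) * Complex.exp z))
        + P.eval (-Complex.exp z) * P.eval (Complex.exp (-X.η) * Complex.exp z)) := by ring
    _ = (Complex.I / 2) ^ X.Ns * (-1 / 2) ^ X.Ns * 4 ^ X.Ns * E * E * G * (2 * P.coeff 0 ^ 2
        * (bodyPoly (Complex.exp X.η) X.twoS X.zeta).eval (Complex.exp z))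
        * (Complex.exp (-X.bodySum) * Complex.exp X.bodySum) := by rw [hW, h4, hb, mul_one]
    _ = _ := by ring

theorem Generic.admissible (hX : X.Generic) (hs : ∀ n, 1 ≤ X.twoS n) {τ P : ℂ[X]}
    (hP0 : P.coeff 0 ≠ 0)
    (hsol : IsSolution (Complex.exp (-X.η)) (Complex.exp X.η) X.twoS X.zeta τ P) :
    X.Admissible (X.halfPoly P) := by
  intro n h
  obtain ⟨h1, h2⟩ := Prod.mk.inj h
  rw [halfPoly_add_pi] at h2
  refine hsol.eval_ne_zero X.exp_neg_eta_mul hX.exp_pow_ne_one hX.stringInjective hP0 (hs n)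
    (X.zeta_mul_sq n) ((mul_eq_zero.mp h1).resolve_left (Complex.exp_ne_zero _)) ?_
  exact (mul_eq_zero.mp ((mul_eq_zero.mp h2).resolve_left
    (pow_ne_zero _ (neg_ne_zero.mpr Complex.I_ne_zero)))).resolve_left (Complex.exp_ne_zero _)

theorem coeff_ne_zero_of_mul_eq {P : ℂ[X]} (hP : P.coeff X.Ns * P.coeff 0 = (-1 / 4) ^ X.Ns) :
    P.coeff X.Ns ≠ 0 ∧ P.coeff 0 ≠ 0 :=
  mul_ne_zero_iff.mp (hP ▸ pow_ne_zero _ (by norm_num))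

/-- The solutions of the Baxter equation that are polynomial in `e^z` form a line, on which the
normalization of the functions of the form `IsQForm` leaves only a sign. -/
theorem Generic.baxter_unique (hX : X.Generic) {τ : ℂ[X]} {t Q Q' : ℂ → ℂ} (hτ : X.HasPoly τ t)
    (hQ : X.IsQForm Q) (hQ' : X.IsQForm Q') (hB : X.Baxter t Q) (hB' : X.Baxter t Q') :
    Q' = Q ∨ Q' = -Q := by
  obtain ⟨P, -, hP2, rfl⟩ := hQ.exists_halfPoly X
  obtain ⟨P', -, hP2', rfl⟩ := hQ'.exists_halfPoly X
  rw [X.baxter_halfPoly_iff hτ] at hB hB'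
  have h0 := (coeff_ne_zero_of_mul_eq hP2).2
  have h := hB.eq_C_mul X.exp_neg_eta_mul hX.exp_pow_ne_one hB' (by rwa [constantCoeff_coe])
  set c := PowerSeries.constantCoeff (P' : PowerSeries ℂ)
    / PowerSeries.constantCoeff (P : PowerSeries ℂ)
  have hPP : P' = Polynomial.C c * P := by
    apply Polynomial.coe_injective ℂ
    rw [h, Polynomial.coe_mul, Polynomial.coe_C]
  have hc : c ^ 2 = 1 := by
    rw [hPP, Polynomial.coeff_C_mul, Polynomial.coeff_C_mul] at hP2'
    have h1 : c ^ 2 * (P.coeff X.Ns * P.coeff 0) = 1 * (P.coeff X.Ns * P.coeff 0) := by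
      rw [one_mul]; nth_rewrite 2 [hP2]; rw [← hP2']; ring
    exact mul_right_cancel₀ (hP2 ▸ pow_ne_zero _ (by norm_num)) h1
  rcases sq_eq_sq_iff_eq_or_eq_neg.mp (hc.trans (one_pow 2).symm) with h1 | h1
  · left; rw [hPP, h1, Polynomial.C_1, one_mul]
  · right
    funext z
    rw [hPP, h1, halfPoly_C_mul, Pi.neg_apply, neg_one_mul]

theorem Generic.exists_baxter (hX : X.Generic) (hN : 1 ≤ N) (hs : ∀ n, 1 ≤ X.twoS n) {t : ℂ → ℂ}
    (ht : X.DiscreteBaxter t) :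
    ∃ Q, X.IsQForm Q ∧ X.Baxter t Q ∧
      (∀ Q', X.IsQForm Q' → X.Baxter t Q' → Q' = Q ∨ Q' = -Q) ∧
      (∃ ε : ℤ, (ε = 1 ∨ ε = -1) ∧ X.WronskianIdentity ε Q) ∧ X.Admissible Q := by
  obtain ⟨τ, hτ, hτt⟩ := ht.1.exists_hasPoly X hN
  obtain ⟨P, hP0, hPdeg, hPtop, hP⟩ := exists_polynomial_isSolution X.exp_neg_eta_mul
    hX.exp_pow_ne_one hX.stringInjective X.zeta_ne_zero hτ hN (ht.stringSolvable X hτt)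
  obtain ⟨c, hc, hQ⟩ := X.exists_isQForm hPdeg hPtop (hP0 ▸ one_ne_zero)
  have hsol := hP.C_mul c
  have hB := (X.baxter_halfPoly_iff hτt _).mpr hsol
  obtain ⟨P', h1, h2, h3⟩ := hQ.exists_halfPoly X
  rw [X.halfPoly_injective h3] at hQ hsol hB
  exact ⟨_, hQ, hB, fun Q' hQ' hB' => hX.baxter_unique hτt hQ hQ' hB hB',
    hX.exists_wronskianIdentity hs h1 h2 hsol,
    hX.admissible hs (coeff_ne_zero_of_mul_eq h2).2 hsol⟩

/-- The Baxter equation for `Q(· + iπ)`: the sign on the right-hand side is reversed. -/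
theorem Baxter.add_pi (hN : 1 ≤ N) {t Q : ℂ → ℂ} (hB : X.Baxter t Q)
    (ht : ∀ z, t (z + Complex.I * Real.pi) = (-1) ^ (N - 1) * t z) (z : ℂ) :
    t z * Q (z + Complex.I * Real.pi) = X.a z * Q (z + Complex.I * Real.pi - X.η)
      - X.d z * Q (z + X.η + Complex.I * Real.pi) := by
  have h := hB (z + Complex.I * Real.pi)
  obtain ⟨M, rfl⟩ : ∃ M, N = M + 1 := ⟨N - 1, by omega⟩
  rw [ht, a_add_pi, d_add_pi, add_right_comm z _ X.η, Nat.add_sub_cancel, pow_succ] at h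
  apply mul_left_cancel₀ (pow_ne_zero M (neg_ne_zero.mpr (one_ne_zero (α := ℂ))))
  linear_combination h

/-- The Baxter equations for `Q` and for `Q(· + iπ)`, solved for `t`. -/
theorem Baxter.wronskianExpr (hN : 1 ≤ N) (hs : ∀ n, 1 ≤ X.twoS n) {ε : ℤ} (hε : ε ≠ 0)
    {t Q : ℂ → ℂ} (hB : X.Baxter t Q) (htd : Differentiable ℂ t) (hQ : X.IsQForm Q)
    (ht : ∀ z, t (z + Complex.I * Real.pi) = (-1) ^ (N - 1) * t z)
    (hW : X.WronskianIdentity ε Q) : X.WronskianExpr ε t Q := by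
  have hQd := hQ.differentiable X
  have hwd := X.w_differentiable ε
  obtain ⟨z₀, hz₀⟩ := X.exists_d_mul_w_ne_zero hs hε
  have key := eq_of_eq_on_ne_zero (f₁ := fun z => t z * X.w ε z)
    (f₂ := fun z => Q (z + X.η) * Q (z + Complex.I * Real.pi - X.η)
      - Q (z + X.η + Complex.I * Real.pi) * Q (z - X.η))
    (by fun_prop) (by fun_prop) X.d_differentiable ⟨z₀, left_ne_zero_of_mul hz₀⟩ (fun z hz => by
      apply mul_left_cancel₀ hz
      linear_combination -t z * hW z + Q (z + Complex.I * Real.pi - X.η) * hB z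
        + Q (z - X.η) * hB.add_pi hN ht z)
  intro z hz
  rw [eq_div_iff hz]
  exact key z

/-- Elimination of the Wronskian: `a w_ε` is the value of the Wronskian at `z + η`. -/
theorem WronskianExpr.baxter (hs : ∀ n, 1 ≤ X.twoS n) {ε : ℤ} (hε : ε ≠ 0) {t Q : ℂ → ℂ}
    (hE : X.WronskianExpr ε t Q) (hW : X.WronskianIdentity ε Q) (htd : Differentiable ℂ t)
    (hQ : X.IsQForm Q) : X.Baxter t Q := by
  have hQd := hQ.differentiable X
  have had := X.a_differentiable
  have hdd := X.d_differentiable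
  obtain ⟨z₀, hz₀⟩ := X.exists_d_mul_w_ne_zero hs hε
  refine eq_of_eq_on_ne_zero (f₁ := fun z => t z * Q z)
    (f₂ := fun z => -X.a z * Q (z - X.η) + X.d z * Q (z + X.η)) (by fun_prop) (by fun_prop)
    (X.w_differentiable ε) ⟨z₀, right_ne_zero_of_mul hz₀⟩ (fun z hz => ?_)
  have h1 := (eq_div_iff hz).mp (hE z hz)
  have h2 := hW (z + X.η)
  rw [← X.a_mul_w hs, add_sub_cancel_right, add_right_comm z X.η, add_sub_cancel_right] at h2
  rw [add_right_comm z X.η] at h1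
  apply mul_left_cancel₀ hz
  linear_combination Q z * h1 + Q (z + X.η) * hW z - Q (z - X.η) * h2

/-- Under `z ↦ z + iπ` the numerator of the expression for `t` is antisymmetric up to the sign
`(-1)^{N_s}` coming from the `2πi`-quasi-periodicity of `Q`. -/
theorem WronskianExpr.add_pi (hN : 1 ≤ N) (hs : ∀ n, 1 ≤ X.twoS n) {ε : ℤ} (hε : ε ≠ 0)
    {t Q : ℂ → ℂ} (hE : X.WronskianExpr ε t Q) (htd : Differentiable ℂ t) (hQ : X.IsQForm Q)
    (z : ℂ) : t (z + Complex.I * Real.pi) = (-1) ^ (N - 1) * t z := by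
  obtain ⟨z₀, hz₀⟩ := X.exists_d_mul_w_ne_zero hs hε
  refine eq_of_eq_on_ne_zero (f₁ := fun z => t (z + Complex.I * Real.pi))
    (f₂ := fun z => (-1) ^ (N - 1) * t z) (by fun_prop) (by fun_prop)
    (X.w_differentiable ε) ⟨z₀, right_ne_zero_of_mul hz₀⟩ (fun z hz => ?_) z
  have hsgn : ∀ k : ℕ, (-1 : ℂ) ^ k ≠ 0 := fun k => pow_ne_zero k (neg_ne_zero.mpr one_ne_zero)
  have hz' : X.w ε (z + Complex.I * Real.pi) ≠ 0 := by
    rw [w_add_pi]; exact mul_ne_zero (hsgn _) hz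
  have h1 := (eq_div_iff hz).mp (hE z hz)
  have h2 := (eq_div_iff hz').mp (hE _ hz')
  have hNs : X.Ns = ∑ n, (X.twoS n - 1) + (N - 1 + 1) := by
    rw [Nat.sub_add_cancel hN, Ns, Finset.sum_congr rfl fun n _ => (Nat.sub_add_cancel (hs n)).symm,
      Finset.sum_add_distrib]
    simp
  have e1 := hQ.add_two_pi X (z - X.η)
  have e2 := hQ.add_two_pi X (z + X.η)
  rw [show z - X.η + Complex.I * Real.pi + Complex.I * Real.pi
    = z + Complex.I * Real.pi + Complex.I * Real.pi - X.η by ring] at e1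
  rw [show z + X.η + Complex.I * Real.pi + Complex.I * Real.pi
    = z + Complex.I * Real.pi + X.η + Complex.I * Real.pi by ring] at e2
  rw [w_add_pi, e1, e2, hNs, pow_add, pow_succ, add_right_comm z _ X.η] at h2
  apply mul_left_cancel₀ (mul_ne_zero (hsgn (∑ n, (X.twoS n - 1))) hz)
  linear_combination h2 - (-1) ^ (∑ n, (X.twoS n - 1)) * (-1) ^ (N - 1) * h1

end XXZChain

/-! ### From entire solutions of the Baxter equation to the discrete equations -/

namespace QDifference

variable {N : ℕ}

/-- The two terms of top degree in `-A P(pX) + B P(qX)` cancel, and so do the constant terms. -/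
theorem exists_X_mul_eq {p q : ℂ} (hpq : p * q = 1) (m : Fin N → ℕ) {ζ : Fin N → ℂ}
    (hζ : ∀ n, ζ n ≠ 0) (hN : 1 ≤ N) {P : ℂ[X]} (hP : P.natDegree ≤ ∑ n, m n) :
    ∃ R : ℂ[X], R.natDegree ≤ 2 * (N - 1) + ∑ n, m n ∧
      -tailPoly q m ζ * P.comp (Polynomial.C p * Polynomial.X)
        + headPoly ζ * P.comp (Polynomial.C q * Polynomial.X) = Polynomial.X * R := by
  have hq0 : q ≠ 0 := right_ne_zero_of_mul_eq_one hpq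
  set M := ∑ n, m n with hM
  set F := -tailPoly q m ζ * P.comp (Polynomial.C p * Polynomial.X)
        + headPoly ζ * P.comp (Polynomial.C q * Polynomial.X) with hF
  have hF0 : F.coeff 0 = 0 := by
    rw [hF, Polynomial.coeff_add, Polynomial.mul_coeff_zero, Polynomial.mul_coeff_zero,
      Polynomial.coeff_neg, coeff_zero_tailPoly, coeff_zero_headPoly, Polynomial.comp_C_mul_X_coeff,
      Polynomial.comp_C_mul_X_coeff]
    ring
  have hlin : ∀ c : ℂ, (P.comp (Polynomial.C c * Polynomial.X)).natDegree ≤ M := by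
    intro c
    rw [Polynomial.natDegree_le_iff_coeff_eq_zero]
    intro i hi
    rw [Polynomial.comp_C_mul_X_coeff, Polynomial.coeff_eq_zero_of_natDegree_lt (by omega),
      zero_mul]
  have hA : (-tailPoly q m ζ).natDegree ≤ N * 2 := by
    rw [Polynomial.natDegree_neg, natDegree_tailPoly hq0 m hζ, mul_comm]
  have hB : (headPoly ζ).natDegree ≤ N * 2 := by
    rw [mul_comm]; exact natDegree_headPoly_le ζ
  have hprod : ∀ c : Fin N → ℂ, (∀ n, c n ≠ 0) →
      (∏ n, stringFactor (c n)).coeff (N * 2) = ∏ n, -c n := by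
    intro c hc
    have h := Polynomial.coeff_prod_of_natDegree_le (s := Finset.univ)
      (fun n : Fin N => stringFactor (c n)) 2 fun n _ => (natDegree_stringFactor (hc n)).le
    simpa [coeff_two_stringFactor] using h
  have hlead : F.coeff (N * 2 + M) = 0 := by
    rw [hF, Polynomial.coeff_add, Polynomial.coeff_mul_add_eq_of_natDegree_le hA (hlin p),
      Polynomial.coeff_mul_add_eq_of_natDegree_le hB (hlin q), Polynomial.comp_C_mul_X_coeff,
      Polynomial.comp_C_mul_X_coeff, Polynomial.coeff_neg, tailPoly, headPoly,
      hprod _ (fun n => mul_ne_zero (hζ n) (pow_ne_zero _ hq0)), hprod _ hζ]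
    have h1 : ∏ n, -(ζ n * q ^ (2 * m n)) = (∏ n, -ζ n) * (q ^ M * q ^ M) := by
      rw [hM, ← pow_add, ← two_mul, Finset.mul_sum, ← Finset.prod_pow_eq_pow_sum,
        ← Finset.prod_mul_distrib]
      exact Finset.prod_congr rfl fun n _ => by ring
    have h2 : p ^ M * q ^ M = 1 := by rw [← mul_pow, hpq, one_pow]
    rw [h1]
    linear_combination (-(∏ n, -ζ n) * P.coeff M * q ^ M) * h2
  refine ⟨F.divX, ?_, ?_⟩
  · rw [Polynomial.natDegree_le_iff_coeff_eq_zero]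
    intro i hi
    rw [Polynomial.coeff_divX]
    rcases Nat.lt_or_ge (N * 2 + M) (i + 1) with h | h
    · refine Polynomial.coeff_eq_zero_of_natDegree_lt (lt_of_le_of_lt ?_ h)
      refine (Polynomial.natDegree_add_le _ _).trans (max_le ?_ ?_)
      · exact Polynomial.natDegree_mul_le.trans (add_le_add hA (hlin p))
      · exact Polynomial.natDegree_mul_le.trans (add_le_add hB (hlin q))
    · rw [show i + 1 = N * 2 + M by omega]; exact hlead
  · conv_lhs => rw [← Polynomial.X_mul_divX_add F]
    rw [hF0, Polynomial.C_0, add_zero]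

end QDifference

namespace XXZChain

open QDifference

variable {N : ℕ} {X : XXZChain N}

/-- An entire `t` solving the Baxter equation with `Q` of the form `IsQForm` is a quotient of
Laurent polynomials in `e^z` without poles, hence a Laurent polynomial. -/
theorem Baxter.trigPoly (hN : 1 ≤ N) {t Q : ℂ → ℂ} (hB : X.Baxter t Q)
    (htd : Differentiable ℂ t) (hQ : X.IsQForm Q)
    (ht : ∀ z, t (z + Complex.I * Real.pi) = (-1) ^ (N - 1) * t z) : TrigPoly (N - 1) t := by
  obtain ⟨P, hPdeg, hP, rfl⟩ := hQ.exists_halfPoly X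
  obtain ⟨hPtop, hP0⟩ := coeff_ne_zero_of_mul_eq hP
  have hdeg : P.natDegree = X.Ns := Polynomial.natDegree_eq_of_le_of_coeff_ne_zero hPdeg hPtop
  obtain ⟨R, hRdeg, hR⟩ := exists_X_mul_eq X.exp_neg_eta_mul X.twoS X.zeta_ne_zero hN hPdeg
  set c : ℂ := (-1 / 2) ^ N * Complex.exp (∑ n, X.ξ n) with hc
  have hc0 : c ≠ 0 := mul_ne_zero (pow_ne_zero _ (by norm_num)) (Complex.exp_ne_zero _)
  have hG : Complex.exp (-(X.Ns * X.η / 2)) * Complex.exp (X.Ns * X.η / 2) = 1 := by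
    rw [← Complex.exp_add, neg_add_cancel, Complex.exp_zero]
  have hcast : ((N - 1 : ℕ) : ℂ) = (N : ℂ) - 1 := by rw [Nat.cast_sub hN, Nat.cast_one]
  have hE : ∀ z : ℂ, Complex.exp (((N - 1 : ℕ) : ℂ) * z) * Complex.exp (-((N - 1 : ℕ) : ℂ) * z)
      = 1 := by
    intro z; rw [← Complex.exp_add, ← Complex.exp_zero]; congr 1; ring
  obtain ⟨S, hS, hS'⟩ := exists_polynomial_of_mul_eq
    (g := fun z => c⁻¹ * (Complex.exp (((N - 1 : ℕ) : ℂ) * z) * t z))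
    (by have := htd.continuous; fun_prop) X.Ns P R hdeg hP0 (by
      intro z
      have h1 := hB z
      have h2 := congrArg (Polynomial.eval (Complex.exp z)) hR
      simp only [Polynomial.eval_mul, Polynomial.eval_add, Polynomial.eval_neg,
        Polynomial.eval_comp, Polynomial.eval_C, Polynomial.eval_X] at h2
      rw [a_eq_eval, d_eq_eval, halfPoly_sub, halfPoly_add, halfPoly] at h1
      have h3 : Complex.exp (((N - 1 : ℕ) : ℂ) * z) * Complex.exp z * Complex.exp (-N * z) = 1 := by
        rw [← Complex.exp_add, ← Complex.exp_add, ← Complex.exp_zero, hcast]; congr 1; ring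
      apply mul_left_cancel₀ (mul_ne_zero (mul_ne_zero (Complex.exp_ne_zero z) hc0)
        (Complex.exp_ne_zero (-X.Ns * z / 2)))
      have h4 : c * c⁻¹ = 1 := mul_inv_cancel₀ hc0
      set E := Complex.exp (-X.Ns * z / 2)
      set x := Complex.exp z
      set e₁ := Complex.exp (((N - 1 : ℕ) : ℂ) * z)
      set G := Complex.exp (X.Ns * X.η / 2)
      set G' := Complex.exp (-(X.Ns * X.η / 2))
      set A := (tailPoly (Complex.exp X.η) X.twoS X.zeta).eval x
      set B := (headPoly X.zeta).eval x
      calc _ = (c * c⁻¹) * (e₁ * x) * (t z * (E * P.eval x)) := by ring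
        _ = (e₁ * x * Complex.exp (-N * z)) * c * E * (G' * G)
            * (-A * P.eval (Complex.exp (-X.η) * x) + B * P.eval (Complex.exp X.η * x)) := by
          rw [h1, h4, hc]; ring
        _ = _ := by rw [h3, hG, h2]; ring)
  have hSdeg : S.natDegree ≤ 2 * (N - 1) := by
    rcases eq_or_ne S 0 with rfl | hS0
    · simp
    · rw [hS, Polynomial.natDegree_mul (by rintro rfl; simp at hP0) hS0,
        hdeg] at hRdeg
      have : X.Ns = ∑ n, X.twoS n := rfl
      omega
  obtain ⟨r, hr, hr'⟩ := exists_comp_sq_of_even (fun z => by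
    have h1 : Complex.exp (z + Complex.I * Real.pi) = -Complex.exp z := by
      rw [Complex.exp_add, mul_comm Complex.I, Complex.exp_pi_mul_I]; ring
    have h2 : Complex.exp (((N - 1 : ℕ) : ℂ) * (z + Complex.I * Real.pi))
        = (-1) ^ (N - 1) * Complex.exp (((N - 1 : ℕ) : ℂ) * z) := by
      rw [Complex.exp_nat_mul, h1, Complex.exp_nat_mul, neg_pow]
    have h3 : ((-1 : ℂ) ^ (N - 1)) * (-1) ^ (N - 1) = 1 := by
      rw [← mul_pow]; norm_num
    rw [← h1, ← hS', ← hS', ht, h2]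
    linear_combination (c⁻¹ * Complex.exp (((N - 1 : ℕ) : ℂ) * z) * t z) * h3) hSdeg
  refine ⟨Polynomial.C c * r, (Polynomial.natDegree_C_mul_le _ _).trans hr, fun z => ?_⟩
  have h1 := hS' z
  rw [hr', ← Complex.exp_nat_mul] at h1
  rw [Polynomial.eval_mul, Polynomial.eval_C, ← Nat.cast_ofNat (R := ℂ) (n := 2), ← h1]
  have h4 : c * c⁻¹ = 1 := mul_inv_cancel₀ hc0
  linear_combination (-t z) * hE z - (t z * Complex.exp (((N - 1 : ℕ) : ℂ) * z)
    * Complex.exp (-((N - 1 : ℕ) : ℂ) * z)) * h4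

/-- On a string, the values of `Q` and those of `Q(· + iπ)` with alternating signs solve the
discrete Baxter equation, and by admissibility one of these two solutions is not zero. -/
theorem Baxter.discreteBaxter (hN : 1 ≤ N) {t Q : ℂ → ℂ} (hB : X.Baxter t Q)
    (htd : Differentiable ℂ t) (hQ : X.IsQForm Q)
    (ht : ∀ z, t (z + Complex.I * Real.pi) = (-1) ^ (N - 1) * t z) (hadm : X.Admissible Q) :
    X.DiscreteBaxter t := by
  refine ⟨hB.trigPoly hN htd hQ ht, fun n => ?_⟩
  have hstep : ∀ k : ℕ, X.xiShift n (k + 1) + X.η = X.xiShift n k := by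
    intro k; rw [xiShift_succ, sub_add_cancel]
  by_cases h0 : Q (X.xiShift n 0) = 0
  · refine ⟨fun k => (-1) ^ k * Q (X.xiShift n k + Complex.I * Real.pi), ?_, fun k _ => ?_⟩
    · intro h
      simp only [pow_zero, one_mul] at h
      exact hadm n (by rw [h0, h])
    · have h := hB.add_pi hN ht (X.xiShift n k)
      rw [add_sub_right_comm, ← xiShift_succ] at h
      rcases k with _ | k
      · rw [d_first] at h ⊢
        linear_combination h
      · rw [hstep] at h
        simp only [Nat.add_sub_cancel]
        linear_combination (-1) ^ (k + 1) * h
  · refine ⟨fun k => Q (X.xiShift n k), h0, fun k _ => ?_⟩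
    have h := hB (X.xiShift n k)
    rw [← xiShift_succ] at h
    rcases k with _ | k
    · rw [d_first] at h ⊢
      linear_combination h
    · rw [hstep] at h
      exact h

end XXZChain

/-- A function of the form `∏ sinh ((z - μ_j) / 2)` remains of this form when it is negated (shift
one root by `2πi`), so that uniqueness is understood up to the sign of `Q`. -/
theorem theorem5p1 {N : ℕ} (hN : 1 ≤ N) (X : XXZChain N)
    (hη : ∀ m : ℕ, 1 ≤ m → Complex.exp X.η ^ m ≠ 1)
    (hs : ∀ n, 1 ≤ X.twoS n)
    (hξ : ∀ i j, i ≠ j → X.xiString i ∩ X.xiString j = ∅)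
    (κ : ℂ) (hκ : κ ≠ 0) (t : ℂ → ℂ) :
    List.TFAE [
      t ∈ X.eigenvalueFunctions κ,
      Differentiable ℂ t ∧
        (∀ z, t (z + Complex.I * Real.pi) = (-1) ^ (N - 1) * t z) ∧
        ∃ Q : ℂ → ℂ, (X.IsQForm Q ∧ X.Baxter t Q) ∧
          (∀ Q' : ℂ → ℂ, X.IsQForm Q' ∧ X.Baxter t Q' → Q' = Q ∨ Q' = -Q) ∧
          X.Admissible Q,
      Differentiable ℂ t ∧
        ∃ (ε : ℤ) (Q : ℂ → ℂ),
          ((ε = 1 ∨ ε = -1) ∧ X.IsQForm Q ∧ X.WronskianIdentity ε Q ∧ X.WronskianExpr ε t Q) ∧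
          (∀ (ε' : ℤ) (Q' : ℂ → ℂ),
            (ε' = 1 ∨ ε' = -1) ∧ X.IsQForm Q' ∧ X.WronskianIdentity ε' Q' ∧
              X.WronskianExpr ε' t Q' → ε' = ε ∧ (Q' = Q ∨ Q' = -Q)) ∧
          X.Admissible Q] := by
  have hX : X.Generic := ⟨hη, hξ⟩
  have hsgn : ∀ {ε : ℤ}, (ε = 1 ∨ ε = -1) → ε ≠ 0 := by rintro ε (rfl | rfl) <;> decide
  have h12 := hX.mem_eigenvalueFunctions_iff hN hκ t
  tfae_have 1 → 2 := fun h => by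
    have hd := h12.mp h
    obtain ⟨Q, hQ, hB, huniq, -, hadm⟩ := hX.exists_baxter hN hs hd
    exact ⟨hd.1.differentiable, hd.1.add_pi, Q, ⟨hQ, hB⟩, fun Q' h' => huniq Q' h'.1 h'.2, hadm⟩
  tfae_have 2 → 1 := by
    rintro ⟨htd, hper, Q, ⟨hQ, hB⟩, -, hadm⟩
    exact h12.mpr (hB.discreteBaxter hN htd hQ hper hadm)
  tfae_have 1 → 3 := fun h => by
    have hd := h12.mp h
    have htd := hd.1.differentiable
    obtain ⟨Q, hQ, hB, huniq, ⟨ε, hε, hW⟩, hadm⟩ := hX.exists_baxter hN hs hd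
    refine ⟨htd, ε, Q, ⟨hε, hQ, hW,
      hB.wronskianExpr hN hs (hsgn hε) htd hQ hd.1.add_pi hW⟩, ?_, hadm⟩
    rintro ε' Q' ⟨hε', hQ', hW', hE'⟩
    have hQQ := huniq Q' hQ' (hE'.baxter hs (hsgn hε') hW' htd hQ')
    refine ⟨?_, hQQ⟩
    -- The left-hand side of the Wronskian identity does not see the sign of `Q`.
    have hW'' : X.WronskianIdentity ε' Q := by
      rcases hQQ with rfl | rfl
      · exact hW'
      · intro z
        have := hW' z
        simpa only [Pi.neg_apply, neg_mul_neg] using this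
    obtain ⟨z, hz⟩ := X.exists_d_mul_w_ne_zero hs (one_ne_zero (α := ℤ))
    have hlin : ∀ δ : ℤ, X.d z * X.w δ z = δ * (X.d z * X.w 1 z) := by
      intro δ; simp only [XXZChain.w]; push_cast; ring
    have h1 := (hW'' z).symm.trans (hW z)
    rw [hlin ε', hlin ε] at h1
    exact_mod_cast mul_right_cancel₀ hz h1
  tfae_have 3 → 1 := by
    rintro ⟨htd, ε, Q, ⟨hε, hQ, hW, hE⟩, -, hadm⟩
    exact h12.mpr ((hE.baxter hs (hsgn hε) hW htd hQ).discreteBaxter hN htd hQ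
      (hE.add_pi hN hs (hsgn hε) htd hQ) hadm)
  tfae_finish
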